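/- Let $X$ be a diffeological space, i.e. a set with a family of plots $U\to X$ ($U$ open in some $\mathbb R^n$) that contains the constant maps, is closed under precomposition with smooth maps, and is local. * **Forms.** $\Omega^p(X)$ is the real vector space of differential $p$-forms on $X$: families $\omega=(\omega_\sigma)$ assigning to every plot $\sigma:U\to X$ a smooth $p$-form $\omega_\sigma$ on $U$ such that $\omega_{\sigma\circ f}=f^*\omega_\sigma$ for all smooth maps $f:V\to U$. With the exterior derivative and the exterior product taken plotwise, $\Omega^*(X)$ is a cochain algebra (differential graded algebra). A smooth map $g:Y\to X$ induces $g^*:\Omega^*(X)\to\Omega^*(Y)$, $(g^*\omega)_\sigma=\omega_{g\circ\sigma}$. * **Simplicial de Rham algebra.** Let $\mathbb A^n=\{x\in\mathbb R^{n+1}\mid \sum_{i=0}^n x_i=1\}$ with the sub-diffeology of $\mathbb R^{n+1}$, and let $S^D_\bullet(X)$ be the simplicial set whose $n$-simplices are the smooth maps $\mathbb A^n\to X$. For a simplicial set $K$, $A^*_{DR}(K)$ is the cochain algebra of simplicial maps from $K$ to the simplicial cochain algebra $[n]\mapsto\Omega^*(\mathbb A^n)$. The map $\alpha:\Omega^*(X)\to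 A^*_{DR}(S^D_\bullet(X))$ is $\alpha(\omega)(\sigma)=\sigma^*\omega$. * **Cubical cochains.** A $p$-cube of $X$ is a smooth map $\sigma:\mathbb R^p\to X$; it is degenerate if it does not depend on one of its coordinates. $C^p_{\rm cube}(X)$ is the real vector space of real-valued functions on the set of $p$-cubes that vanish on the degenerate cubes, with the coboundary $$(\delta f)(\sigma)=\sum_{i=1}^{p+1}(-1)^{i-1}\bigl(f(\sigma|_{x_i=1})-f(\sigma|_{x_i=0})\bigr)$$ and the cup product, for $f\in C^p_{\rm cube}(X)$ and $g\in C^q_{\rm cube}(X)$, $$(f\cup g)(\sigma)=\sum_{S}\varepsilon(S)\,f\bigl(\sigma|_{x_j=0,\ j\notin S}\bigr)\,g\bigl(\sigma|_{x_i=1,\ i\in S}\bigr),$$ the sum being over the $p$-element subsets $S\subseteq\{1,\dots,p+q\}$, with $\varepsilon(S)=(-1)^{\#\{(i,j)\,\mid\, i\in S,\ j\notin S,\ j<i\}}$. With these, $C^*_{\rm cube}(X)$ is a cochain algebra. * **Integration.** Iglesias-Zemmour's integration map $\int^{\rm IZ}:\Omega^*(X)\to C^*_{\rm cube}(X)$ is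 the cochain map $$\Bigl(\int^{\rm IZ}\omega\Bigr)(\sigma)=\int_{[0,1]^p}\omega_\sigma\qquad(\omega\in\Omega^p(X),\ \sigma:\mathbb R^p\to X).$$ Then, for every diffeological space $X$: (i) the map $H^*(\Omega^*(X))\to H^*(C^*_{\rm cube}(X))$ induced by $\int^{\rm IZ}$ is a morphism of graded algebras (it preserves products and units); (ii) $\int^{\rm IZ}$ induces an isomorphism of graded algebras on cohomology if and only if $\alpha$ induces an isomorphism of graded algebras $H^*(\Omega^*(X))\to H^*(A^*_{DR}(S^D_\bullet(X)))$. -/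

import Mathlib

namespace DeRham

open scoped ContDiff

universe u

/-! ### Graded algebras, cochain algebras and their cohomology -/

/-- A graded (associative, unital) real algebra `C⁰, C¹, C², …`.  The product `C^p × C^q → C^n` is
indexed by a proof of `p + q = n`, so that no transport between degrees is ever needed. -/
structure GrAlg where
  C : ℕ → Type u
  [grp : ∀ p, AddCommGroup (C p)]
  [mod : ∀ p, Module ℝ (C p)]
  mul : ∀ {p q n : ℕ}, p + q = n → C p →ₗ[ℝ] C q →ₗ[ℝ] C n
  one : C 0
  one_mul : ∀ {p : ℕ} (h : 0 + p = p) (a : C p), mul h one a = a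
  mul_one : ∀ {p : ℕ} (h : p + 0 = p) (a : C p), mul h a one = a
  mul_assoc : ∀ {p q r m k n : ℕ} (h₁ : p + q = m) (h₂ : m + r = n) (h₃ : q + r = k)
    (h₄ : p + k = n) (a : C p) (b : C q) (c : C r),
    mul h₂ (mul h₁ a b) c = mul h₄ a (mul h₃ b c)

attribute [instance] GrAlg.grp GrAlg.mod

/-- A family of linear maps is a morphism of graded algebras: it preserves units and products. -/
def IsAlgHom {A B : GrAlg.{u}} (f : ∀ p, A.C p →ₗ[ℝ] B.C p) : Prop :=
  f 0 A.one = B.one ∧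
    ∀ {p q n : ℕ} (h : p + q = n) (a : A.C p) (b : A.C q),
      f n (A.mul h a b) = B.mul h (f p a) (f q b)

/-- An isomorphism of graded algebras: a morphism that is bijective in every degree. -/
def IsAlgIso {A B : GrAlg.{u}} (f : ∀ p, A.C p →ₗ[ℝ] B.C p) : Prop :=
  IsAlgHom f ∧ ∀ p, Function.Bijective (f p)

/-- A cochain algebra (differential graded algebra concentrated in degrees `≥ 0`). -/
structure CochainAlg extends GrAlg.{u} where
  d : ∀ p, C p →ₗ[ℝ] C (p + 1)
  d_d : ∀ (p : ℕ) (a : C p), d (p + 1) (d p a) = 0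
  leibniz : ∀ {p q n : ℕ} (h : p + q = n) (a : C p) (b : C q),
    d n (mul h a b) = mul (show p + 1 + q = n + 1 by omega) (d p a) b
      + (-1 : ℝ) ^ p • mul (show p + (q + 1) = n + 1 by omega) a (d q b)

/-- A morphism of cochain complexes between cochain algebras (no compatibility with products). -/
structure CochainMap (A B : CochainAlg.{u}) where
  f : ∀ p, A.C p →ₗ[ℝ] B.C p
  comm : ∀ (p : ℕ) (a : A.C p), f (p + 1) (A.d p a) = B.d p (f p a)

namespace CochainAlg

variable (A : CochainAlg.{u})

/-- Cocycles. -/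
def Z (p : ℕ) : Submodule ℝ (A.C p) := LinearMap.ker (A.d p)

/-- Coboundaries. -/
def B : ∀ p : ℕ, Submodule ℝ (A.C p)
  | 0 => ⊥
  | p + 1 => LinearMap.range (A.d p)

variable {A}

theorem mem_Z {p : ℕ} {a : A.C p} : a ∈ A.Z p ↔ A.d p a = 0 := LinearMap.mem_ker

theorem mul_mem_Z {p q n : ℕ} (h : p + q = n) {a : A.C p} {b : A.C q} (ha : a ∈ A.Z p)
    (hb : b ∈ A.Z q) : A.mul h a b ∈ A.Z n := by
  rw [mem_Z] at *
  rw [A.leibniz, ha, hb]; simp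

theorem one_mem_Z : A.one ∈ A.Z 0 := by
  have h := A.leibniz (show 0 + 0 = 0 from rfl) A.one A.one
  rw [A.one_mul, A.mul_one, pow_zero, one_smul, A.one_mul] at h
  rw [mem_Z]
  simpa using h

theorem mul_mem_B_left {p q n : ℕ} (h : p + q = n) {a : A.C p} {b : A.C q} (ha : a ∈ A.B p)
    (hb : b ∈ A.Z q) : A.mul h a b ∈ A.B n := by
  cases p with
  | zero =>
    have : a = 0 := ha
    subst this; simp
  | succ p =>
    obtain ⟨c, rfl⟩ := ha
    obtain ⟨n, rfl⟩ : ∃ k, n = k + 1 := ⟨p + q, by omega⟩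
    refine ⟨A.mul (show p + q = n by omega) c b, ?_⟩
    rw [A.leibniz, mem_Z.1 hb]; simp

theorem mul_mem_B_right {p q n : ℕ} (h : p + q = n) {a : A.C p} {b : A.C q} (ha : a ∈ A.Z p)
    (hb : b ∈ A.B q) : A.mul h a b ∈ A.B n := by
  cases q with
  | zero =>
    have : b = 0 := hb
    subst this; simp
  | succ q =>
    obtain ⟨c, rfl⟩ := hb
    obtain ⟨n, rfl⟩ : ∃ k, n = k + 1 := ⟨p + q, by omega⟩
    refine ⟨(-1 : ℝ) ^ p • A.mul (show p + q = n by omega) a c, ?_⟩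
    rw [map_smul, A.leibniz, mem_Z.1 ha, smul_add, smul_smul, ← mul_pow]; simp

variable (A)

/-- The coboundaries as a submodule of the cocycles. -/
def BZ (p : ℕ) : Submodule ℝ (A.Z p) := (A.B p).comap (A.Z p).subtype

/-- The `p`-th cohomology, cocycles modulo coboundaries. -/
abbrev HC (p : ℕ) : Type u := A.Z p ⧸ A.BZ p

variable {A}

/-- The cohomology class of a cocycle. -/
def cls {p : ℕ} : A.Z p →ₗ[ℝ] A.HC p := (A.BZ p).mkQ

theorem cls_surjective {p : ℕ} (x : A.HC p) : ∃ a : A.Z p, cls a = x :=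
  (A.BZ p).mkQ_surjective x

/-- The product of cohomology classes, `[a] [b] = [a b]`. -/
def hmulFun {p q n : ℕ} (h : p + q = n) (x : A.HC p) (y : A.HC q) : A.HC n :=
  Quotient.liftOn₂' x y
    (fun a b => cls ⟨A.mul h (a : A.C p) (b : A.C q), mul_mem_Z h a.2 b.2⟩) (by
      intro a₁ b₁ a₂ b₂ ha hb
      rw [Submodule.quotientRel_def] at ha hb
      refine (Submodule.Quotient.eq _).2 ?_
      change A.mul h a₁.1 b₁.1 - A.mul h a₂.1 b₂.1 ∈ A.B n
      have : A.mul h a₁.1 b₁.1 - A.mul h a₂.1 b₂.1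
          = A.mul h (a₁.1 - a₂.1) b₁.1 + A.mul h a₂.1 (b₁.1 - b₂.1) := by
        simp
      rw [this]
      exact add_mem (mul_mem_B_left h ha b₁.2) (mul_mem_B_right h a₂.2 hb))

theorem hmulFun_cls {p q n : ℕ} (h : p + q = n) (a : A.Z p) (b : A.Z q) :
    hmulFun h (cls a) (cls b)
      = cls ⟨A.mul h (a : A.C p) (b : A.C q), mul_mem_Z h a.2 b.2⟩ := rfl

variable (A)

/-- The cohomology algebra of a cochain algebra. -/
def H : GrAlg.{u} where
  C := A.HC
  mul h := LinearMap.mk₂ ℝ (hmulFun h)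
    (by
      intro x x' y
      obtain ⟨a, rfl⟩ := cls_surjective x
      obtain ⟨a', rfl⟩ := cls_surjective x'
      obtain ⟨b, rfl⟩ := cls_surjective y
      rw [hmulFun_cls, hmulFun_cls, ← map_add, ← map_add, hmulFun_cls]
      exact congrArg _ (Subtype.ext (by simp)))
    (by
      intro c x y
      obtain ⟨a, rfl⟩ := cls_surjective x
      obtain ⟨b, rfl⟩ := cls_surjective y
      rw [hmulFun_cls, ← map_smul, ← map_smul, hmulFun_cls]
      exact congrArg _ (Subtype.ext (by simp)))
    (by
      intro x y y'
      obtain ⟨a, rfl⟩ := cls_surjective x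
      obtain ⟨b, rfl⟩ := cls_surjective y
      obtain ⟨b', rfl⟩ := cls_surjective y'
      rw [hmulFun_cls, hmulFun_cls, ← map_add, ← map_add, hmulFun_cls]
      exact congrArg _ (Subtype.ext (by simp)))
    (by
      intro c x y
      obtain ⟨a, rfl⟩ := cls_surjective x
      obtain ⟨b, rfl⟩ := cls_surjective y
      rw [hmulFun_cls, ← map_smul, ← map_smul, hmulFun_cls]
      exact congrArg _ (Subtype.ext (by simp)))
  one := cls ⟨A.one, one_mem_Z⟩
  one_mul := by
    intro p h x
    obtain ⟨a, rfl⟩ := cls_surjective x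
    exact congrArg cls (Subtype.ext (A.one_mul h a.1))
  mul_one := by
    intro p h x
    obtain ⟨a, rfl⟩ := cls_surjective x
    exact congrArg cls (Subtype.ext (A.mul_one h a.1))
  mul_assoc := by
    intro p q r m k n h₁ h₂ h₃ h₄ x y z
    obtain ⟨a, rfl⟩ := cls_surjective x
    obtain ⟨b, rfl⟩ := cls_surjective y
    obtain ⟨c, rfl⟩ := cls_surjective z
    exact congrArg cls (Subtype.ext (A.mul_assoc h₁ h₂ h₃ h₄ a.1 b.1 c.1))

end CochainAlg

namespace CochainMap

variable {A B : CochainAlg.{u}} (φ : CochainMap A B)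

theorem map_mem_Z {p : ℕ} (a : A.C p) (ha : a ∈ A.Z p) : φ.f p a ∈ B.Z p := by
  rw [CochainAlg.mem_Z] at *
  rw [← φ.comm, ha, map_zero]

theorem map_mem_B : ∀ {p : ℕ} (a : A.C p), a ∈ A.B p → φ.f p a ∈ B.B p
  | 0, a, ha => by
    have : a = 0 := ha
    subst this; simp
  | p + 1, _, ha => by
    obtain ⟨c, rfl⟩ := ha
    exact ⟨φ.f p c, (φ.comm p c).symm⟩

/-- The map `[a] ↦ [φ a]` induced on cohomology by a cochain map. -/
def H (p : ℕ) : A.H.C p →ₗ[ℝ] B.H.C p :=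
  Submodule.mapQ (A.BZ p) (B.BZ p) ((φ.f p).restrict φ.map_mem_Z)
    (fun a ha => φ.map_mem_B a.1 ha)

end CochainMap

/-! ### The exterior product of alternating forms -/

section Wedge

open Equiv

set_option linter.unusedSectionVars false

variable {V W : Type*} [NormedAddCommGroup V] [NormedSpace ℝ V]
  [NormedAddCommGroup W] [NormedSpace ℝ W]

/-- The inclusion of `{0, …, p-1}` into `{0, …, n-1}` as the first `p` elements (`n = p + q`). -/
def lIdx {p q n : ℕ} (h : p + q = n) (i : Fin p) : Fin n := Fin.cast h (Fin.castAdd q i)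

/-- The inclusion of `{0, …, q-1}` into `{0, …, n-1}` as the last `q` elements (`n = p + q`). -/
def rIdx {p q n : ℕ} (h : p + q = n) (j : Fin q) : Fin n := Fin.cast h (Fin.natAdd p j)

/-- The previous two inclusions together form a bijection. -/
def lrEquiv {p q n : ℕ} (h : p + q = n) : Fin p ⊕ Fin q ≃ Fin n :=
  finSumFinEquiv.trans (finCongr h)

theorem lrEquiv_inl {p q n : ℕ} (h : p + q = n) (i : Fin p) :
    lrEquiv h (Sum.inl i) = lIdx h i := rfl

theorem lrEquiv_inr {p q n : ℕ} (h : p + q = n) (j : Fin q) :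
    lrEquiv h (Sum.inr j) = rIdx h j := rfl

theorem lIdx_injective {p q n : ℕ} (h : p + q = n) : Function.Injective (lIdx h) :=
  (lrEquiv h).injective.comp Sum.inl_injective

theorem rIdx_injective {p q n : ℕ} (h : p + q = n) : Function.Injective (rIdx h) :=
  (lrEquiv h).injective.comp Sum.inr_injective

theorem lIdx_ne_rIdx {p q n : ℕ} (h : p + q = n) (i : Fin p) (j : Fin q) :
    lIdx h i ≠ rIdx h j := by
  rw [← lrEquiv_inl, ← lrEquiv_inr]
  simp

theorem exists_idx {p q n : ℕ} (h : p + q = n) (i : Fin n) :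
    (∃ j, lIdx h j = i) ∨ ∃ j, rIdx h j = i := by
  obtain ⟨x, rfl⟩ := (lrEquiv h).surjective i
  rcases x with x | x
  exacts [.inl ⟨x, rfl⟩, .inr ⟨x, rfl⟩]

/-- The tensor product `(v₀, …, vₙ₋₁) ↦ a (v₀, …, v_{p-1}) * b (v_p, …, vₙ₋₁)`. -/
def tensor {p q n : ℕ} (h : p + q = n) (a : V [⋀^Fin p]→L[ℝ] ℝ) (b : V [⋀^Fin q]→L[ℝ] ℝ) :
    ContinuousMultilinearMap ℝ (fun _ : Fin n => V) ℝ where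
  toFun v := a (v ∘ lIdx h) * b (v ∘ rIdx h)
  map_update_add' {inst} v i x y := by
    have := Subsingleton.elim inst (instDecidableEqFin n)
    subst this
    rcases exists_idx h i with ⟨j, rfl⟩ | ⟨j, rfl⟩
    · simp only [Function.update_comp_eq_of_injective _ (lIdx_injective h),
        Function.update_comp_eq_of_notMem_range v (f := rIdx h) _
          (fun ⟨k, hk⟩ => lIdx_ne_rIdx h j k hk.symm), a.map_update_add, add_mul]
    · simp only [Function.update_comp_eq_of_injective _ (rIdx_injective h),
        Function.update_comp_eq_of_notMem_range v (f := lIdx h) _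
          (fun ⟨k, hk⟩ => lIdx_ne_rIdx h k j hk), b.map_update_add, mul_add]
  map_update_smul' {inst} v i c x := by
    have := Subsingleton.elim inst (instDecidableEqFin n)
    subst this
    rcases exists_idx h i with ⟨j, rfl⟩ | ⟨j, rfl⟩
    · simp only [Function.update_comp_eq_of_injective _ (lIdx_injective h),
        Function.update_comp_eq_of_notMem_range v (f := rIdx h) _
          (fun ⟨k, hk⟩ => lIdx_ne_rIdx h j k hk.symm), a.map_update_smul, smul_eq_mul, mul_assoc]
    · simp only [Function.update_comp_eq_of_injective _ (rIdx_injective h),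
        Function.update_comp_eq_of_notMem_range v (f := lIdx h) _
          (fun ⟨k, hk⟩ => lIdx_ne_rIdx h k j hk), b.map_update_smul, smul_eq_mul]
      ring
  cont := by
    refine (a.coe_continuous.comp ?_).mul (b.coe_continuous.comp ?_) <;>
    · refine continuous_pi fun i => continuous_apply _

/-- Antisymmetrization, without normalizing factor. -/
def Alt {n : ℕ} (T : (Fin n → V) → ℝ) (v : Fin n → V) : ℝ :=
  ∑ σ : Perm (Fin n), ((Perm.sign σ : ℤ) : ℝ) * T (v ∘ σ)

/-- The exterior product
`(a ∧ b) (v₀, …, vₙ₋₁) = (p! q!)⁻¹ ∑_σ sign σ * a (v_σ(0), …, v_σ(p-1)) * b (v_σ(p), …, v_σ(n-1))`,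
normalized so that `dx₁ ∧ … ∧ dxₙ` has value `1` on the standard basis. -/
noncomputable def wedgeFun {p q n : ℕ} (h : p + q = n) (a : V [⋀^Fin p]→L[ℝ] ℝ)
    (b : V [⋀^Fin q]→L[ℝ] ℝ) : V [⋀^Fin n]→L[ℝ] ℝ :=
  ((p.factorial : ℝ) * q.factorial)⁻¹ •
    ContinuousMultilinearMap.alternatization (tensor h a b)

theorem wedgeFun_apply {p q n : ℕ} (h : p + q = n) (a : V [⋀^Fin p]→L[ℝ] ℝ)
    (b : V [⋀^Fin q]→L[ℝ] ℝ) (v : Fin n → V) :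
    wedgeFun h a b v = ((p.factorial : ℝ) * q.factorial)⁻¹ *
      Alt (fun w => a (w ∘ lIdx h) * b (w ∘ rIdx h)) v := by
  simp only [wedgeFun, ContinuousAlternatingMap.smul_apply, smul_eq_mul,
    ContinuousMultilinearMap.alternatization_apply_apply, Alt]
  congr 1
  refine Finset.sum_congr rfl fun σ _ => ?_
  rw [Units.smul_def, zsmul_eq_mul]
  rfl

theorem norm_wedgeFun_le {p q n : ℕ} (h : p + q = n) (a : V [⋀^Fin p]→L[ℝ] ℝ)
    (b : V [⋀^Fin q]→L[ℝ] ℝ) :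
    ‖wedgeFun h a b‖ ≤ (((p.factorial : ℝ) * q.factorial)⁻¹ * n.factorial) * ‖a‖ * ‖b‖ := by
  refine ContinuousAlternatingMap.opNorm_le_bound _ (by positivity) fun v => ?_
  rw [wedgeFun_apply, norm_mul, mul_assoc, mul_assoc, mul_assoc, norm_inv,
    Real.norm_of_nonneg (by positivity : (0 : ℝ) ≤ (p.factorial : ℝ) * q.factorial)]
  refine mul_le_mul_of_nonneg_left ?_ (by positivity)
  refine (norm_sum_le _ _).trans ?_
  have hb : ∀ σ ∈ (Finset.univ : Finset (Perm (Fin n))),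
      ‖((Perm.sign σ : ℤ) : ℝ) * (a ((v ∘ σ) ∘ lIdx h) * b ((v ∘ σ) ∘ rIdx h))‖
        ≤ ‖a‖ * (‖b‖ * ∏ i, ‖v i‖) := by
    intro σ _
    have h1 : ‖((Perm.sign σ : ℤ) : ℝ)‖ = 1 := by
      rcases Int.units_eq_one_or (Perm.sign σ) with h | h <;> simp [h]
    have h2 : ∏ i, ‖v i‖ = (∏ i, ‖v (σ (lIdx h i))‖) * ∏ j, ‖v (σ (rIdx h j))‖ := by
      rw [← Equiv.prod_comp σ, ← Equiv.prod_comp (lrEquiv h), Fintype.prod_sum_type]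
      rfl
    rw [norm_mul, h1, one_mul, norm_mul, h2]
    calc _ ≤ (‖a‖ * ∏ i, ‖v (σ (lIdx h i))‖) * (‖b‖ * ∏ j, ‖v (σ (rIdx h j))‖) :=
          mul_le_mul (a.le_opNorm _) (b.le_opNorm _) (norm_nonneg _) (by positivity)
      _ = _ := by ring
  refine (Finset.sum_le_sum hb).trans ?_
  rw [Finset.sum_const, Finset.card_univ, Fintype.card_perm, Fintype.card_fin, nsmul_eq_mul]

/-- The exterior product as a continuous bilinear map. -/
noncomputable def wedge {p q n : ℕ} (h : p + q = n) :
    (V [⋀^Fin p]→L[ℝ] ℝ) →L[ℝ] (V [⋀^Fin q]→L[ℝ] ℝ) →L[ℝ] (V [⋀^Fin n]→L[ℝ] ℝ) :=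
  LinearMap.mkContinuous₂
    (LinearMap.mk₂ ℝ (wedgeFun h)
      (by
        intro a a' b
        ext v
        simp only [wedgeFun_apply, ContinuousAlternatingMap.add_apply, Alt, add_mul, mul_add,
          Finset.sum_add_distrib])
      (by
        intro c a b
        ext v
        simp only [wedgeFun_apply, ContinuousAlternatingMap.smul_apply, Alt, smul_eq_mul,
          Finset.mul_sum]
        exact Finset.sum_congr rfl fun σ _ => by ring)
      (by
        intro a b b'
        ext v
        simp only [wedgeFun_apply, ContinuousAlternatingMap.add_apply, Alt, mul_add,
          Finset.sum_add_distrib])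
      (by
        intro c a b
        ext v
        simp only [wedgeFun_apply, ContinuousAlternatingMap.smul_apply, Alt, smul_eq_mul,
          Finset.mul_sum]
        exact Finset.sum_congr rfl fun σ _ => by ring))
    _ (norm_wedgeFun_le h)

theorem wedge_apply {p q n : ℕ} (h : p + q = n) (a : V [⋀^Fin p]→L[ℝ] ℝ)
    (b : V [⋀^Fin q]→L[ℝ] ℝ) (v : Fin n → V) :
    wedge h a b v = ((p.factorial : ℝ) * q.factorial)⁻¹ *
      Alt (fun w => a (w ∘ lIdx h) * b (w ∘ rIdx h)) v :=
  wedgeFun_apply h a b v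

theorem wedge_comp {p q n : ℕ} (h : p + q = n) (a : W [⋀^Fin p]→L[ℝ] ℝ)
    (b : W [⋀^Fin q]→L[ℝ] ℝ) (L : V →L[ℝ] W) :
    (wedge h a b).compContinuousLinearMap L
      = wedge h (a.compContinuousLinearMap L) (b.compContinuousLinearMap L) := by
  ext v
  simp only [ContinuousAlternatingMap.compContinuousLinearMap_apply, wedge_apply, Alt]
  rfl

theorem sign_mul_sign {n : ℕ} (σ : Perm (Fin n)) :
    ((Perm.sign σ : ℤ) : ℝ) * ((Perm.sign σ : ℤ) : ℝ) = 1 := by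
  rcases Int.units_eq_one_or (Perm.sign σ) with h | h <;> simp [h]

theorem Alt_const_mul {n : ℕ} (c : ℝ) (T : (Fin n → V) → ℝ) (v : Fin n → V) :
    Alt (fun w => c * T w) v = c * Alt T v := by
  simp only [Alt, Finset.mul_sum]
  exact Finset.sum_congr rfl fun σ _ => by ring

theorem Alt_add {n : ℕ} (S T : (Fin n → V) → ℝ) (v : Fin n → V) :
    Alt (fun w => S w + T w) v = Alt S v + Alt T v := by
  simp only [Alt, mul_add, Finset.sum_add_distrib]

theorem Alt_perm {n : ℕ} (τ : Perm (Fin n)) (T : (Fin n → V) → ℝ) (v : Fin n → V) :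
    Alt (fun w => T (w ∘ τ)) v = ((Perm.sign τ : ℤ) : ℝ) * Alt T v := by
  simp only [Alt, Finset.mul_sum]
  refine Fintype.sum_equiv (Equiv.mulRight τ) _ _ fun σ => ?_
  simp only [Equiv.coe_mulRight, Perm.sign_mul, Units.val_mul, Int.cast_mul]
  have := sign_mul_sign τ
  rw [show (v ∘ σ) ∘ τ = v ∘ ⇑(σ * τ) from rfl]
  linear_combination (-((Perm.sign σ : ℤ) : ℝ) * T (v ∘ ⇑(σ * τ))) * this

theorem Alt_alternating {n : ℕ} (a : V [⋀^Fin n]→L[ℝ] ℝ) (v : Fin n → V) :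
    Alt (fun w => a w) v = n.factorial * a v := by
  have : ∀ σ : Perm (Fin n), ((Perm.sign σ : ℤ) : ℝ) * a (v ∘ σ) = a v := by
    intro σ
    have h := a.toAlternatingMap.map_perm v σ
    rw [Units.smul_def, zsmul_eq_mul] at h
    change a (v ∘ σ) = _ * a v at h
    rw [h, ← mul_assoc, sign_mul_sign, one_mul]
  simp only [Alt, this, Finset.sum_const, Finset.card_univ, Fintype.card_perm, Fintype.card_fin,
    nsmul_eq_mul]

/-- Antisymmetrizing in a block of the variables first only changes the result by a factor. -/
theorem Alt_block {k m n : ℕ} (e : Fin k ⊕ Fin m ≃ Fin n)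
    (S : (Fin k → V) → (Fin m → V) → ℝ) (v : Fin n → V) :
    Alt (fun w => Alt (fun u => S u (w ∘ e ∘ Sum.inr)) (w ∘ e ∘ Sum.inl)) v
      = k.factorial * Alt (fun w => S (w ∘ e ∘ Sum.inl) (w ∘ e ∘ Sum.inr)) v := by
  have key : ∀ τ : Perm (Fin k),
      Alt (fun w => ((Perm.sign τ : ℤ) : ℝ) *
        S ((w ∘ e ∘ Sum.inl) ∘ τ) (w ∘ e ∘ Sum.inr)) v
      = Alt (fun w => S (w ∘ e ∘ Sum.inl) (w ∘ e ∘ Sum.inr)) v := by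
    intro τ
    let τ' : Perm (Fin n) := e.permCongr (Equiv.sumCongr τ (Equiv.refl _))
    have h1 : ∀ w : Fin n → V, (w ∘ e ∘ Sum.inl) ∘ τ = (w ∘ τ') ∘ e ∘ Sum.inl := by
      intro w; funext i; simp [τ']
    have h2 : ∀ w : Fin n → V, w ∘ e ∘ Sum.inr = (w ∘ τ') ∘ e ∘ Sum.inr := by
      intro w; funext i; simp [τ']
    have h3 : Perm.sign τ' = Perm.sign τ := by
      simp only [τ', Perm.sign_permCongr]
      simp
    rw [Alt_const_mul]
    conv_lhs =>
      enter [2, 1, w]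
      rw [h1, h2]
    rw [Alt_perm τ' (fun w => S (w ∘ e ∘ Sum.inl) (w ∘ e ∘ Sum.inr)), h3, ← mul_assoc,
      sign_mul_sign, one_mul]
  calc _ = ∑ τ : Perm (Fin k), Alt (fun w => ((Perm.sign τ : ℤ) : ℝ) *
        S ((w ∘ e ∘ Sum.inl) ∘ τ) (w ∘ e ∘ Sum.inr)) v := by
        simp only [Alt, Finset.mul_sum]
        rw [Finset.sum_comm]
    _ = _ := by
        rw [Finset.sum_congr rfl fun τ _ => key τ, Finset.sum_const, Finset.card_univ,
          Fintype.card_perm, Fintype.card_fin, nsmul_eq_mul]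

theorem wedge_assoc {p q r m k n : ℕ} (h₁ : p + q = m) (h₂ : m + r = n) (h₃ : q + r = k)
    (h₄ : p + k = n) (a : V [⋀^Fin p]→L[ℝ] ℝ) (b : V [⋀^Fin q]→L[ℝ] ℝ)
    (c : V [⋀^Fin r]→L[ℝ] ℝ) :
    wedge h₂ (wedge h₁ a b) c = wedge h₄ a (wedge h₃ b c) := by
  ext v
  rw [wedge_apply, wedge_apply]
  have hm : (m.factorial : ℝ) ≠ 0 := by positivity
  have hk : (k.factorial : ℝ) ≠ 0 := by positivity
  have e1 := Alt_block (lrEquiv h₂)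
    (fun u w => (a (u ∘ lIdx h₁) * b (u ∘ rIdx h₁)) * c w) v
  have e2 := Alt_block ((Equiv.sumComm _ _).trans (lrEquiv h₄))
    (fun u w => a w * (b (u ∘ lIdx h₃) * c (u ∘ rIdx h₃))) v
  have e3 : Alt (fun w => (wedge h₁ a b) (w ∘ lIdx h₂) * c (w ∘ rIdx h₂)) v
      = ((p.factorial : ℝ) * q.factorial)⁻¹ * (m.factorial *
        Alt (fun w => (a (w ∘ lIdx h₂ ∘ lIdx h₁) * b (w ∘ lIdx h₂ ∘ rIdx h₁))
          * c (w ∘ rIdx h₂)) v) := by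
    refine Eq.trans ?_ (congrArg _ e1)
    rw [← Alt_const_mul]
    congr 1; funext w
    rw [wedge_apply, mul_assoc, Alt, Alt, Finset.sum_mul]
    congr 1
    refine Finset.sum_congr rfl fun σ _ => ?_
    rw [mul_assoc]; rfl
  have e4 : Alt (fun w => a (w ∘ lIdx h₄) * (wedge h₃ b c) (w ∘ rIdx h₄)) v
      = ((q.factorial : ℝ) * r.factorial)⁻¹ * (k.factorial *
        Alt (fun w => a (w ∘ lIdx h₄) * (b (w ∘ rIdx h₄ ∘ lIdx h₃)
          * c (w ∘ rIdx h₄ ∘ rIdx h₃))) v) := by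
    refine Eq.trans ?_ (congrArg _ e2)
    rw [← Alt_const_mul]
    congr 1; funext w
    rw [wedge_apply, mul_left_comm, Alt, Alt, Finset.mul_sum]
    congr 1
    refine Finset.sum_congr rfl fun σ _ => ?_
    rw [mul_left_comm]; rfl
  have i1 : lIdx h₂ ∘ lIdx h₁ = lIdx h₄ := by
    funext i; apply Fin.ext; simp [lIdx]
  have i2 : lIdx h₂ ∘ rIdx h₁ = rIdx h₄ ∘ lIdx h₃ := by
    funext i; apply Fin.ext; simp [lIdx, rIdx]
  have i3 : rIdx h₂ = rIdx h₄ ∘ rIdx h₃ := by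
    funext i; apply Fin.ext; simp [rIdx]; omega
  rw [e3, e4, i1, i2, i3]
  simp only [mul_assoc, mul_inv]
  field_simp

/-- The constant function `1` as a form of degree `0`. -/
noncomputable def oneForm (V : Type*) [NormedAddCommGroup V] [NormedSpace ℝ V] :
    V [⋀^Fin 0]→L[ℝ] ℝ :=
  ContinuousAlternatingMap.constOfIsEmpty ℝ V (Fin 0) 1

theorem one_wedge {p : ℕ} (h : 0 + p = p) (a : V [⋀^Fin p]→L[ℝ] ℝ) :
    wedge h (oneForm V) a = a := by
  ext v
  have : (fun w : Fin p → V => oneForm V (w ∘ lIdx h) * a (w ∘ rIdx h)) = fun w => a w := by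
    funext w
    have : rIdx h = id := by funext i; apply Fin.ext; simp [rIdx]
    rw [this]; simp [oneForm]
  rw [wedge_apply, this, Alt_alternating]
  have : (p.factorial : ℝ) ≠ 0 := by positivity
  simp; field_simp

theorem wedge_one {p : ℕ} (h : p + 0 = p) (a : V [⋀^Fin p]→L[ℝ] ℝ) :
    wedge h a (oneForm V) = a := by
  ext v
  have : (fun w : Fin p → V => a (w ∘ lIdx h) * oneForm V (w ∘ rIdx h)) = fun w => a w := by
    funext w
    have : lIdx h = id := by funext i; apply Fin.ext; simp [lIdx]
    rw [this]; simp [oneForm]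
  rw [wedge_apply, this, Alt_alternating]
  have : (p.factorial : ℝ) ≠ 0 := by positivity
  simp; field_simp

theorem alternatizeUncurryFin_eq_Alt {n : ℕ} (f : V →L[ℝ] V [⋀^Fin n]→L[ℝ] ℝ)
    (v : Fin (n + 1) → V) :
    ContinuousAlternatingMap.alternatizeUncurryFin f v
      = (n.factorial : ℝ)⁻¹ * Alt (fun w => f (w 0) (w ∘ Fin.succ)) v := by
  have h1 : ∀ w : Fin (n + 1) → V, ContinuousAlternatingMap.alternatizeUncurryFin f w
      = ∑ i : Fin (n + 1), ((Perm.sign (i.cycleRange.symm) : ℤ) : ℝ) *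
        f ((w ∘ i.cycleRange.symm) 0) ((w ∘ i.cycleRange.symm) ∘ Fin.succ) := by
    intro w
    rw [ContinuousAlternatingMap.alternatizeUncurryFin_apply]
    refine Finset.sum_congr rfl fun i _ => ?_
    have e1 : (w ∘ i.cycleRange.symm) ∘ Fin.succ = i.removeNth w := by
      funext j; simp [Fin.removeNth, Fin.cycleRange_symm_succ]
    rw [e1, Perm.sign_symm, Fin.sign_cycleRange]
    simp [Fin.cycleRange_symm_zero]
  have h2 := Alt_alternating (ContinuousAlternatingMap.alternatizeUncurryFin f) v
  have h3 : Alt (fun w => ContinuousAlternatingMap.alternatizeUncurryFin f w) v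
      = (n + 1) * Alt (fun w => f (w 0) (w ∘ Fin.succ)) v := by
    have : ∀ i : Fin (n + 1), Alt (fun w => ((Perm.sign (i.cycleRange.symm) : ℤ) : ℝ) *
        f ((w ∘ i.cycleRange.symm) 0) ((w ∘ i.cycleRange.symm) ∘ Fin.succ)) v
        = Alt (fun w => f (w 0) (w ∘ Fin.succ)) v := by
      intro i
      rw [Alt_const_mul, Alt_perm i.cycleRange.symm (fun w => f (w 0) (w ∘ Fin.succ)), ← mul_assoc,
        sign_mul_sign, one_mul]
    calc _ = ∑ i : Fin (n + 1), Alt (fun w => ((Perm.sign (i.cycleRange.symm) : ℤ) : ℝ) *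
        f ((w ∘ i.cycleRange.symm) 0) ((w ∘ i.cycleRange.symm) ∘ Fin.succ)) v := by
          simp only [h1]
          simp only [Alt, Finset.mul_sum]
          rw [Finset.sum_comm]
      _ = _ := by
          rw [Finset.sum_congr rfl fun i _ => this i]; simp
  rw [h3, Nat.factorial_succ] at h2
  push_cast at h2
  have hn : (n.factorial : ℝ) ≠ 0 := by positivity
  have hn1 : (n + 1 : ℝ) ≠ 0 := by positivity
  rw [mul_assoc] at h2
  rw [mul_left_cancel₀ hn1 h2]
  field_simp

theorem wedge_alternatizeUncurryFin_left {p q n : ℕ} (h : p + q = n) (h' : p + 1 + q = n + 1)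
    (f : V →L[ℝ] V [⋀^Fin p]→L[ℝ] ℝ) (b : V [⋀^Fin q]→L[ℝ] ℝ) :
    ContinuousAlternatingMap.alternatizeUncurryFin ((wedge h).flip b ∘L f)
      = wedge h' (ContinuousAlternatingMap.alternatizeUncurryFin f) b := by
  ext v
  rw [alternatizeUncurryFin_eq_Alt, wedge_apply]
  have hn : (n.factorial : ℝ) ≠ 0 := by positivity
  have hp : ((p + 1).factorial : ℝ) ≠ 0 := by positivity
  have e1 := Alt_block ((Equiv.sumComm _ _).trans (lrEquiv (Nat.add_comm 1 n)))
    (fun u w => f (w 0) (u ∘ lIdx h) * b (u ∘ rIdx h)) v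
  have e2 := Alt_block (lrEquiv h') (fun u w => f (u 0) (u ∘ Fin.succ) * b w) v
  have e3 : Alt (fun w => ((wedge h).flip b ∘L f) (w 0) (w ∘ Fin.succ)) v
      = ((p.factorial : ℝ) * q.factorial)⁻¹ * (n.factorial *
        Alt (fun w => f (w 0) (w ∘ Fin.succ ∘ lIdx h) * b (w ∘ Fin.succ ∘ rIdx h)) v) := by
    have i1 : (⇑((Equiv.sumComm _ _).trans (lrEquiv (Nat.add_comm 1 n))) ∘ Sum.inl)
        = Fin.succ := by
      funext i; apply Fin.ext; simp [lrEquiv]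
    have i2 : (⇑((Equiv.sumComm _ _).trans (lrEquiv (Nat.add_comm 1 n))) ∘ Sum.inr)
        = fun _ => 0 := by
      funext i; apply Fin.ext; simp [lrEquiv]
    rw [i1, i2] at e1
    refine Eq.trans ?_ (congrArg _ e1)
    rw [← Alt_const_mul]
    congr 1; funext w
    exact wedge_apply h _ _ _
  have e4 : Alt (fun w => (ContinuousAlternatingMap.alternatizeUncurryFin f) (w ∘ lIdx h') *
        b (w ∘ rIdx h')) v
      = (p.factorial : ℝ)⁻¹ * ((p + 1).factorial *
        Alt (fun w => f (w (lIdx h' 0)) (w ∘ lIdx h' ∘ Fin.succ) * b (w ∘ rIdx h')) v) := by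
    refine Eq.trans ?_ (congrArg _ e2)
    rw [← Alt_const_mul]
    congr 1; funext w
    rw [alternatizeUncurryFin_eq_Alt, mul_assoc, Alt, Alt, Finset.sum_mul]
    congr 1
    refine Finset.sum_congr rfl fun σ _ => ?_
    rw [mul_assoc]; rfl
  have i1 : lIdx h' 0 = 0 := by apply Fin.ext; simp [lIdx]
  have i2 : lIdx h' ∘ Fin.succ = Fin.succ ∘ lIdx h := by
    funext i; apply Fin.ext; simp [lIdx]
  have i3 : rIdx h' = Fin.succ ∘ rIdx h := by
    funext i; apply Fin.ext; simp [rIdx]; omega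
  rw [e3, e4, i1, i2, i3]
  simp only [mul_inv]
  field_simp

theorem wedge_alternatizeUncurryFin_right {p q n : ℕ} (h : p + q = n) (h' : p + (q + 1) = n + 1)
    (a : V [⋀^Fin p]→L[ℝ] ℝ) (f : V →L[ℝ] V [⋀^Fin q]→L[ℝ] ℝ) :
    ContinuousAlternatingMap.alternatizeUncurryFin (wedge h a ∘L f)
      = (-1 : ℝ) ^ p • wedge h' a (ContinuousAlternatingMap.alternatizeUncurryFin f) := by
  ext v
  rw [alternatizeUncurryFin_eq_Alt, ContinuousAlternatingMap.smul_apply, wedge_apply, smul_eq_mul]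
  have hn : (n.factorial : ℝ) ≠ 0 := by positivity
  have hq : ((q + 1).factorial : ℝ) ≠ 0 := by positivity
  have e1 := Alt_block ((Equiv.sumComm _ _).trans (lrEquiv (Nat.add_comm 1 n)))
    (fun u w => a (u ∘ lIdx h) * f (w 0) (u ∘ rIdx h)) v
  have e2 := Alt_block ((Equiv.sumComm _ _).trans (lrEquiv h'))
    (fun u w => a w * f (u 0) (u ∘ Fin.succ)) v
  have e3 : Alt (fun w => (wedge h a ∘L f) (w 0) (w ∘ Fin.succ)) v
      = ((p.factorial : ℝ) * q.factorial)⁻¹ * (n.factorial *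
        Alt (fun w => a (w ∘ Fin.succ ∘ lIdx h) * f (w 0) (w ∘ Fin.succ ∘ rIdx h)) v) := by
    have i1 : (⇑((Equiv.sumComm _ _).trans (lrEquiv (Nat.add_comm 1 n))) ∘ Sum.inl)
        = Fin.succ := by
      funext i; apply Fin.ext; simp [lrEquiv]
    have i2 : (⇑((Equiv.sumComm _ _).trans (lrEquiv (Nat.add_comm 1 n))) ∘ Sum.inr)
        = fun _ => 0 := by
      funext i; apply Fin.ext; simp [lrEquiv]
    rw [i1, i2] at e1
    refine Eq.trans ?_ (congrArg _ e1)
    rw [← Alt_const_mul]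
    congr 1; funext w
    exact wedge_apply h _ _ _
  have e4 : Alt (fun w => a (w ∘ lIdx h') *
        (ContinuousAlternatingMap.alternatizeUncurryFin f) (w ∘ rIdx h')) v
      = (q.factorial : ℝ)⁻¹ * ((q + 1).factorial *
        Alt (fun w => a (w ∘ lIdx h') * f (w (rIdx h' 0)) (w ∘ rIdx h' ∘ Fin.succ)) v) := by
    refine Eq.trans ?_ (congrArg _ e2)
    rw [← Alt_const_mul]
    congr 1; funext w
    rw [alternatizeUncurryFin_eq_Alt, mul_left_comm, Alt, Alt, Finset.mul_sum]
    congr 1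
    refine Finset.sum_congr rfl fun σ _ => ?_
    rw [mul_left_comm]; rfl
  -- the cycle moving the `p`-th variable to the front
  let c : Fin (n + 1) := ⟨p, by omega⟩
  have hs : ((Perm.sign c.cycleRange : ℤ) : ℝ) = (-1) ^ p := by
    rw [Fin.sign_cycleRange]; simp [c]
  have i1 : c.cycleRange (rIdx h' 0) = 0 := by
    have : rIdx h' 0 = c := by apply Fin.ext; simp [rIdx, c]
    rw [this, Fin.cycleRange_self]
  have i2 : c.cycleRange ∘ lIdx h' = Fin.succ ∘ lIdx h := by
    funext i; apply Fin.ext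
    have : lIdx h' i < c := by
      rw [Fin.lt_def]; simp [lIdx, c]
    rw [Function.comp_apply, Fin.coe_cycleRange_of_lt this]; simp [lIdx]
  have i3 : c.cycleRange ∘ rIdx h' ∘ Fin.succ = Fin.succ ∘ rIdx h := by
    funext i; apply Fin.ext
    have : c < rIdx h' i.succ := by
      rw [Fin.lt_def]; simp [rIdx, c]
    rw [Function.comp_apply, Function.comp_apply, Fin.cycleRange_of_gt this]; simp [rIdx]; omega
  have e5 := Alt_perm c.cycleRange
    (fun w => a (w ∘ lIdx h') * f (w (rIdx h' 0)) (w ∘ rIdx h' ∘ Fin.succ)) v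
  simp only [Function.comp_assoc, i2, i3, Function.comp_apply, i1] at e5
  rw [e3, e4, e5, hs]
  simp only [mul_inv]
  field_simp

theorem extDeriv_wedge {p q n : ℕ} (h : p + q = n) (h₁ : p + 1 + q = n + 1)
    (h₂ : p + (q + 1) = n + 1) {α : V → V [⋀^Fin p]→L[ℝ] ℝ} {β : V → V [⋀^Fin q]→L[ℝ] ℝ} {x : V}
    (hα : DifferentiableAt ℝ α x) (hβ : DifferentiableAt ℝ β x) :
    extDeriv (fun y => wedge h (α y) (β y)) x
      = wedge h₁ (extDeriv α x) (β x) + (-1 : ℝ) ^ p • wedge h₂ (α x) (extDeriv β x) := by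
  have : fderiv ℝ (fun y => wedge h (α y) (β y)) x
      = (wedge h).flip (β x) ∘L fderiv ℝ α x + wedge h (α x) ∘L fderiv ℝ β x := by
    rw [ContinuousLinearMap.fderiv_of_bilinear _ hα hβ, add_comm]
    ext u; simp
  rw [extDeriv, this, ContinuousAlternatingMap.alternatizeUncurryFin_add,
    wedge_alternatizeUncurryFin_left h h₁, wedge_alternatizeUncurryFin_right h h₂]
  rfl

end Wedge

/-! ### Differential forms on diffeological spaces -/

open Diffeology

/-- The Euclidean space `ℝⁿ`. -/
abbrev E (n : ℕ) : Type := EuclideanSpace ℝ (Fin n)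

/-- The plots `ℝⁿ → X` of a diffeological space, i.e. the smooth maps from `ℝⁿ` to `X`. -/
abbrev Plot (X : Type u) [DiffeologicalSpace X] (n : ℕ) : Type u := {σ : E n → X // IsPlot σ}

/-- Reparametrization of a plot by a smooth map. -/
def Plot.comp {X : Type u} [DiffeologicalSpace X] {m n : ℕ} (σ : Plot X n) (f : E m → E n)
    (hf : ContDiff ℝ ∞ f) : Plot X m :=
  ⟨σ.1 ∘ f, isPlot_reparam σ.2 hf⟩

/-- The differential `p`-forms on a diffeological space `X`: families assigning to every plot
`σ : ℝⁿ → X` a smooth `p`-form on `ℝⁿ`, naturally with respect to smooth maps `f : ℝᵐ → ℝⁿ`,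
`τ (σ ∘ f) = f^* τ (σ)`.  (As in Mathlib's definition of a diffeology, the domains of plots are the
spaces `ℝⁿ`; since forms and plots are determined locally, a form extends uniquely to the plots
that are defined on open subsets.) -/
def formSubmodule (X : Type u) [DiffeologicalSpace X] (p : ℕ) :
    Submodule ℝ (∀ n : ℕ, Plot X n → E n → E n [⋀^Fin p]→L[ℝ] ℝ) where
  carrier := {τ | (∀ n (σ : Plot X n), ContDiff ℝ ∞ (τ n σ)) ∧
    ∀ m n (σ : Plot X n) (f : E m → E n) (hf : ContDiff ℝ ∞ f) (x : E m),
      τ m (σ.comp f hf) x = (τ n σ (f x)).compContinuousLinearMap (fderiv ℝ f x)}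
  zero_mem' := ⟨fun _ _ => contDiff_const, fun _ _ _ _ _ _ => rfl⟩
  add_mem' := by
    rintro τ η ⟨h₁, h₂⟩ ⟨h₃, h₄⟩
    refine ⟨fun n σ => (h₁ n σ).add (h₃ n σ), fun m n σ f hf x => ?_⟩
    simp only [Pi.add_apply, h₂, h₄]
    rfl
  smul_mem' := by
    rintro c τ ⟨h₁, h₂⟩
    refine ⟨fun n σ => (h₁ n σ).const_smul c, fun m n σ f hf x => ?_⟩
    simp only [Pi.smul_apply, h₂]
    rfl

/-- The real vector space `Ω^p(X)` of differential `p`-forms on `X`. -/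
def Form (X : Type u) [DiffeologicalSpace X] (p : ℕ) : Type u := formSubmodule X p

noncomputable instance (X : Type u) [DiffeologicalSpace X] (p : ℕ) : AddCommGroup (Form X p) :=
  inferInstanceAs (AddCommGroup (formSubmodule X p))

noncomputable instance (X : Type u) [DiffeologicalSpace X] (p : ℕ) : Module ℝ (Form X p) :=
  inferInstanceAs (Module ℝ (formSubmodule X p))

theorem two_le_infty : minSmoothness ℝ 2 ≤ ∞ := by
  rw [minSmoothness_of_isRCLikeNormedField]
  exact WithTop.coe_le_coe.2 le_top

namespace Form

variable {X : Type u} {Y : Type*} [DiffeologicalSpace X] [DiffeologicalSpace Y] {p : ℕ}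

/-- Constructor for differential forms. -/
def mk (val : ∀ n : ℕ, Plot X n → E n → E n [⋀^Fin p]→L[ℝ] ℝ)
    (h : val ∈ formSubmodule X p) : Form X p := ⟨val, h⟩

theorem smooth (τ : Form X p) {n : ℕ} (σ : Plot X n) : ContDiff ℝ ∞ (τ.1 n σ) := τ.2.1 n σ

theorem natural (τ : Form X p) {m n : ℕ} (σ : Plot X n) (f : E m → E n) (hf : ContDiff ℝ ∞ f)
    (x : E m) :
    τ.1 m (σ.comp f hf) x = (τ.1 n σ (f x)).compContinuousLinearMap (fderiv ℝ f x) :=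
  τ.2.2 m n σ f hf x

theorem ext {τ η : Form X p} (h : ∀ n (σ : Plot X n) x, τ.1 n σ x = η.1 n σ x) : τ = η :=
  Subtype.ext (funext fun n => funext fun σ => funext fun x => h n σ x)

/-- The exterior derivative, `(dτ)(σ) = d (τ (σ))`. -/
noncomputable def d (p : ℕ) : Form X p →ₗ[ℝ] Form X (p + 1) where
  toFun τ := Form.mk (fun n σ => extDeriv (τ.1 n σ)) <| by
    refine ⟨fun n σ => ?_, fun m n σ f hf x => ?_⟩
    · exact (ContinuousAlternatingMap.alternatizeUncurryFinCLM ℝ (E n) ℝ).contDiff.comp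
        ((smooth τ σ).fderiv_right (m := ∞) (by simp))
    · beta_reduce
      rw [show τ.1 m (σ.comp f hf) = fun x =>
          (τ.1 n σ (f x)).compContinuousLinearMap (fderiv ℝ f x) from
        funext fun x => natural τ σ f hf x]
      exact extDeriv_pullback ((smooth τ σ).differentiable (by simp) _) hf.contDiffAt
        two_le_infty
  map_add' τ η := Form.ext fun n σ x =>
    extDeriv_add ((smooth τ σ).differentiable (by simp) _)
      ((smooth η σ).differentiable (by simp) _)
  map_smul' c τ := Form.ext fun n σ x => extDeriv_smul c (τ.1 n σ)

/-- The exterior product, `(τ ∧ η)(σ) = τ (σ) ∧ η (σ)`. -/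
noncomputable def mulFun {p q n : ℕ} (h : p + q = n) (τ : Form X p) (η : Form X q) : Form X n :=
  Form.mk (fun k σ x => wedge h (τ.1 k σ x) (η.1 k σ x)) <| by
    refine ⟨fun k σ => ?_, fun m k σ f hf x => ?_⟩
    · exact (wedge h).isBoundedBilinearMap.contDiff.comp ((smooth τ σ).prodMk (smooth η σ))
    · beta_reduce
      rw [natural τ, natural η, wedge_comp]

/-- The exterior product as a bilinear map. -/
noncomputable def mul {p q n : ℕ} (h : p + q = n) :
    Form X p →ₗ[ℝ] Form X q →ₗ[ℝ] Form X n :=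
  LinearMap.mk₂ ℝ (mulFun h)
    (fun τ τ' η => Form.ext fun k σ x =>
      (wedge h).map_add₂ (τ.1 k σ x) (τ'.1 k σ x) (η.1 k σ x))
    (fun c τ η => Form.ext fun k σ x =>
      (wedge h).map_smul₂ c (τ.1 k σ x) (η.1 k σ x))
    (fun τ η η' => Form.ext fun k σ x =>
      (wedge h (τ.1 k σ x)).map_add (η.1 k σ x) (η'.1 k σ x))
    (fun c τ η => Form.ext fun k σ x =>
      (wedge h (τ.1 k σ x)).map_smul c (η.1 k σ x))

/-- The constant function `1`. -/
noncomputable def one : Form X 0 :=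
  Form.mk (fun n _ _ => oneForm (E n)) ⟨fun _ _ => contDiff_const, fun _ _ _ _ _ _ => rfl⟩

/-- The pullback of forms along a smooth map, `(g^* τ)(σ) = τ (g ∘ σ)`. -/
def pullback (g : X → Y) (hg : DSmooth g) (p : ℕ) : Form Y p →ₗ[ℝ] Form X p where
  toFun τ := Form.mk (fun n σ => τ.1 n ⟨g ∘ σ.1, hg n σ.1 σ.2⟩)
    ⟨fun _ _ => smooth τ _, fun _ _ σ f hf x => natural τ ⟨g ∘ σ.1, hg _ σ.1 σ.2⟩ f hf x⟩
  map_add' _ _ := rfl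
  map_smul' _ _ := rfl

theorem d_d (p : ℕ) (τ : Form X p) : d (p + 1) (d p τ) = 0 :=
  Form.ext fun _ σ _ => extDeriv_extDeriv_apply (smooth τ σ).contDiffAt
    two_le_infty

theorem leibniz {p q n : ℕ} (h : p + q = n) (τ : Form X p) (η : Form X q) :
    d n (mul h τ η) = mul (show p + 1 + q = n + 1 by omega) (d p τ) η
      + (-1 : ℝ) ^ p • mul (show p + (q + 1) = n + 1 by omega) τ (d q η) :=
  Form.ext fun _ σ _ => extDeriv_wedge h (by omega) (by omega)
    ((smooth τ σ).differentiable (by simp) _) ((smooth η σ).differentiable (by simp) _)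

end Form

/-- The de Rham cochain algebra `Ω^*(X)` of a diffeological space. -/
noncomputable def Omega (X : Type u) [DiffeologicalSpace X] : CochainAlg.{u} where
  C p := Form X p
  mul h := Form.mul h
  one := Form.one
  one_mul h _ := Form.ext fun _ _ _ => one_wedge h _
  mul_one h _ := Form.ext fun _ _ _ => wedge_one h _
  mul_assoc h₁ h₂ h₃ h₄ _ _ _ := Form.ext fun _ _ _ => wedge_assoc h₁ h₂ h₃ h₄ _ _ _
  d := Form.d
  d_d := Form.d_d
  leibniz := Form.leibniz

/-! ### The de Rham algebra of a simplicial set and the smooth singular simplicial set -/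

/-- The sub-diffeology on a subset: a map into the subset is a plot iff it is a plot of the
ambient space. -/
@[reducible]
def subDiffeology {X : Type u} [DiffeologicalSpace X] (P : X → Prop) :
    DiffeologicalSpace {x : X // P x} where
  plots n := {σ | IsPlot (fun x => (σ x : X))}
  constant_plots _ := isPlot_const
  plot_reparam hp hf := isPlot_reparam hp hf
  locality hp := DiffeologicalSpace.locality hp

/-- The affine space `𝔸ⁿ = {(x₀, …, xₙ) ∈ ℝⁿ⁺¹ | x₀ + ⋯ + xₙ = 1}`. -/
abbrev Aff (n : ℕ) : Type := {x : E (n + 1) // ∑ i, x i = 1}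

noncomputable instance (n : ℕ) : DiffeologicalSpace (Aff n) :=
  subDiffeology fun x : E (n + 1) => ∑ i, x i = 1

/-- The affine map `𝔸ᵐ → 𝔸ⁿ` induced by a map of indices, sending the `i`-th vertex to the
`θ i`-th vertex. -/
noncomputable def affMap {m n : ℕ} (θ : Fin (m + 1) → Fin (n + 1)) (x : Aff m) : Aff n :=
  ⟨WithLp.toLp 2 fun j => ∑ i, if θ i = j then x.1 i else 0, by
    simp only
    rw [Finset.sum_comm]
    simpa using x.2⟩

theorem affMap_apply {m n : ℕ} (θ : Fin (m + 1) → Fin (n + 1)) (x : Aff m) (j : Fin (n + 1)) :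
    (affMap θ x).1 j = ∑ i, if θ i = j then x.1 i else 0 := rfl

theorem Aff.ext {n : ℕ} {x y : Aff n} (h : ∀ i, x.1 i = y.1 i) : x = y :=
  Subtype.ext (PiLp.ext h)

theorem affMap_id {n : ℕ} (x : Aff n) : affMap id x = x :=
  Aff.ext fun j => by simp [affMap_apply]

theorem affMap_comp {l m n : ℕ} (θ : Fin (l + 1) → Fin (m + 1)) (η : Fin (m + 1) → Fin (n + 1))
    (x : Aff l) : affMap (η ∘ θ) x = affMap η (affMap θ x) :=
  Aff.ext fun j => by
    simp only [affMap_apply, Function.comp_apply]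
    have : ∀ k : Fin (m + 1), (if η k = j then ∑ i, if θ i = k then x.1 i else 0 else 0)
        = ∑ i, if θ i = k then (if η (θ i) = j then x.1 i else 0) else 0 := by
      intro k
      by_cases hk : η k = j
      · rw [if_pos hk]
        refine Finset.sum_congr rfl fun i _ => ?_
        by_cases hi : θ i = k <;> simp [hi, hk]
      · rw [if_neg hk]
        refine (Finset.sum_eq_zero fun i _ => ?_).symm
        by_cases hi : θ i = k <;> simp [hi, hk]
    simp only [this]
    rw [Finset.sum_comm]
    simp

theorem affMap_dSmooth {m n : ℕ} (θ : Fin (m + 1) → Fin (n + 1)) : DSmooth (affMap θ) := by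
  intro k σ hσ
  change ContDiff ℝ ∞ (fun x => ((affMap θ (σ x)).1 : E (n + 1)))
  have hσ' : ContDiff ℝ ∞ (fun x => ((σ x).1 : E (m + 1))) := hσ
  rw [contDiff_euclidean] at hσ' ⊢
  intro j
  simp only [affMap_apply]
  refine ContDiff.sum fun i _ => ?_
  split_ifs
  exacts [hσ' i, contDiff_const]

open CategoryTheory Opposite

/-- The smooth singular simplicial set `S^D(X)`, whose `n`-simplices are the smooth maps
`𝔸ⁿ → X`. -/
noncomputable def smoothSing (X : Type u) [DiffeologicalSpace X] : SSet.{u} where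
  obj U := {σ : Aff U.unop.len → X // DSmooth σ}
  map θ := TypeCat.ofHom fun σ => ⟨σ.1 ∘ affMap θ.unop.toOrderHom, σ.2.comp (affMap_dSmooth _)⟩
  map_id U := by
    ext σ
    exact congrArg σ.1 (affMap_id _)
  map_comp θ η := by
    ext σ
    exact congrArg σ.1 (affMap_comp η.unop.toOrderHom θ.unop.toOrderHom _)

/-- The space `A_DR^p(K) = Sets^{Δᵒᵖ}(K, (A_DR^p)_•)` of simplicial maps from a simplicial set `K`
to the simplicial vector space `n ↦ Ω^p(𝔸ⁿ)`. -/
noncomputable def adrSubmodule (K : SSet.{u}) (p : ℕ) :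
    Submodule ℝ (∀ n : ℕ, K.obj (op (SimplexCategory.mk n)) → Form (Aff n) p) where
  carrier := {F | ∀ (m n : ℕ) (θ : SimplexCategory.mk m ⟶ SimplexCategory.mk n)
    (k : K.obj (op (SimplexCategory.mk n))),
    F m (K.map θ.op k)
      = Form.pullback (affMap θ.toOrderHom) (affMap_dSmooth θ.toOrderHom) p (F n k)}
  zero_mem' _ _ _ _ := (map_zero _).symm
  add_mem' {F G} hF hG m n θ k := by
    rw [Pi.add_apply, Pi.add_apply, Pi.add_apply, Pi.add_apply, hF m n, hG m n, map_add]
  smul_mem' c F hF m n θ k := by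
    rw [Pi.smul_apply, Pi.smul_apply, Pi.smul_apply, Pi.smul_apply, hF m n, map_smul]

/-- The real vector space `A_DR^p(K)`. -/
def ADRForm (K : SSet.{u}) (p : ℕ) : Type u := adrSubmodule K p

noncomputable instance (K : SSet.{u}) (p : ℕ) : AddCommGroup (ADRForm K p) :=
  inferInstanceAs (AddCommGroup (adrSubmodule K p))

noncomputable instance (K : SSet.{u}) (p : ℕ) : Module ℝ (ADRForm K p) :=
  inferInstanceAs (Module ℝ (adrSubmodule K p))

namespace ADRForm

variable {K : SSet.{u}}

/-- Constructor for elements of `A_DR^p(K)`. -/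
def mk {p : ℕ} (val : ∀ n : ℕ, K.obj (op (SimplexCategory.mk n)) → Form (Aff n) p)
    (h : val ∈ adrSubmodule K p) : ADRForm K p := ⟨val, h⟩

theorem ext {p : ℕ} {F G : ADRForm K p} (h : ∀ n k, F.1 n k = G.1 n k) : F = G :=
  Subtype.ext (funext fun n => funext fun k => h n k)

/-- The exterior derivative, computed simplexwise. -/
noncomputable def d (p : ℕ) : ADRForm K p →ₗ[ℝ] ADRForm K (p + 1) where
  toFun F := mk (fun n k => Form.d p (F.1 n k)) fun m n θ k => by
    beta_reduce
    rw [F.2 m n θ k]; rfl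
  map_add' F G := ext fun n k => map_add (Form.d p) (F.1 n k) (G.1 n k)
  map_smul' c F := ext fun n k => map_smul (Form.d p) c (F.1 n k)

/-- The exterior product, computed simplexwise. -/
noncomputable def mulFun {p q n : ℕ} (h : p + q = n) (F : ADRForm K p) (G : ADRForm K q) :
    ADRForm K n :=
  mk (fun l k => Form.mul h (F.1 l k) (G.1 l k)) fun m l θ k => by
    beta_reduce
    rw [F.2 m l θ k, G.2 m l θ k]; rfl

/-- The exterior product as a bilinear map. -/
noncomputable def mul {p q n : ℕ} (h : p + q = n) :
    ADRForm K p →ₗ[ℝ] ADRForm K q →ₗ[ℝ] ADRForm K n :=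
  LinearMap.mk₂ ℝ (mulFun h)
    (fun F F' G => ext fun l k => LinearMap.map_add₂ (Form.mul h) (F.1 l k) (F'.1 l k) (G.1 l k))
    (fun c F G => ext fun l k => LinearMap.map_smul₂ (Form.mul h) c (F.1 l k) (G.1 l k))
    (fun F G G' => ext fun l k => map_add (Form.mul h (F.1 l k)) (G.1 l k) (G'.1 l k))
    (fun c F G => ext fun l k => map_smul (Form.mul h (F.1 l k)) c (G.1 l k))

theorem leibniz {p q n : ℕ} (h : p + q = n) (F : ADRForm K p) (G : ADRForm K q) :
    d n (mul h F G) = mul (show p + 1 + q = n + 1 by omega) (d p F) G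
      + (-1 : ℝ) ^ p • mul (show p + (q + 1) = n + 1 by omega) F (d q G) :=
  ext fun l k => Form.leibniz h (F.1 l k) (G.1 l k)

end ADRForm

/-- The cochain algebra `A_DR^*(K)` of a simplicial set `K`. -/
noncomputable def ADR (K : SSet.{u}) : CochainAlg.{u} where
  C p := ADRForm K p
  mul h := ADRForm.mul h
  one := ADRForm.mk (fun _ _ => Form.one) fun _ _ _ _ => rfl
  one_mul h F := ADRForm.ext fun n k => (Omega (Aff n)).one_mul h (F.1 n k)
  mul_one h F := ADRForm.ext fun n k => (Omega (Aff n)).mul_one h (F.1 n k)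
  mul_assoc h₁ h₂ h₃ h₄ F G L := ADRForm.ext fun n k =>
    (Omega (Aff n)).mul_assoc h₁ h₂ h₃ h₄ (F.1 n k) (G.1 n k) (L.1 n k)
  d := ADRForm.d
  d_d p F := ADRForm.ext fun n k => Form.d_d p (F.1 n k)
  leibniz := ADRForm.leibniz

/-- The map `α : Ω^*(X) → A_DR^*(S^D(X))`, `α(τ)(σ) = σ^* τ`. -/
noncomputable def alpha (X : Type u) [DiffeologicalSpace X] :
    CochainMap (Omega X) (ADR (smoothSing X)) where
  f p :=
    { toFun := fun τ => ADRForm.mk (fun _ σ => Form.pullback σ.1 σ.2 p τ) fun _ _ _ _ => rfl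
      map_add' := fun _ _ => rfl
      map_smul' := fun _ _ => rfl }
  comm _ _ := rfl

/-! ### Normalized cubical cochains -/

section Cubes

/-- The affine embedding `ℝᵖ → ℝⁿ` that puts the coordinates `y₀, …, y_{p-1}` at the places
`e 0, …, e (p-1)` and the constants `c i` at all remaining places `i`. -/
noncomputable def faceMap {p n : ℕ} (e : Fin p → Fin n) (c : Fin n → ℝ) (y : E p) : E n :=
  WithLp.toLp 2 (Function.extend e y c)

theorem faceMap_apply {p n : ℕ} (e : Fin p → Fin n) (c : Fin n → ℝ) (y : E p) (i : Fin n) :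
    faceMap e c y i = Function.extend e y c i := rfl

theorem faceMap_of {p n : ℕ} {e : Fin p → Fin n} (he : Function.Injective e) (c : Fin n → ℝ)
    (y : E p) (j : Fin p) : faceMap e c y (e j) = y j := by
  rw [faceMap_apply, he.extend_apply]

theorem faceMap_of_not {p n : ℕ} {e : Fin p → Fin n} (c : Fin n → ℝ)
    (y : E p) {i : Fin n} (hi : ¬ ∃ j, e j = i) : faceMap e c y i = c i := by
  rw [faceMap_apply, Function.extend_apply' _ _ _ hi]

theorem faceMap_contDiff {p n : ℕ} (e : Fin p ↪o Fin n) (c : Fin n → ℝ) :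
    ContDiff ℝ ∞ (faceMap e c) := by
  rw [contDiff_euclidean]
  intro i
  by_cases hi : ∃ j, e j = i
  · obtain ⟨j, rfl⟩ := hi
    simp only [faceMap_of e.injective]
    fun_prop
  · simp only [faceMap_of_not c _ hi]
    exact contDiff_const

theorem faceMap_comp {l m n : ℕ} (e : Fin m ↪o Fin n) (e' : Fin l ↪o Fin m) (c : Fin n → ℝ)
    (c' : Fin m → ℝ) (y : E l) :
    faceMap e c (faceMap e' c' y) = faceMap (e'.trans e) (Function.extend e c' c) y := by
  refine PiLp.ext fun i => ?_
  by_cases hi : ∃ j, e j = i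
  · obtain ⟨j, rfl⟩ := hi
    rw [faceMap_of e.injective]
    by_cases hj : ∃ k, e' k = j
    · obtain ⟨k, rfl⟩ := hj
      rw [faceMap_of e'.injective]
      exact (faceMap_of (e'.trans e).injective _ _ k).symm
    · rw [faceMap_of_not _ _ hj, faceMap_of_not, e.injective.extend_apply]
      rintro ⟨k, hk⟩
      exact hj ⟨k, e.injective hk⟩
  · rw [faceMap_of_not _ _ hi, faceMap_of_not, Function.extend_apply' _ _ _ hi]
    rintro ⟨k, hk⟩
    exact hi ⟨e' k, hk⟩

variable {X : Type u} [DiffeologicalSpace X]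

/-- The value of a function `f` of `p`-cubes on the face of the `n`-cube `σ` on which the
coordinates in the `p`-element set `S` are free (in increasing order) and every other coordinate
`i` is fixed to `c i`; zero by convention if `S` does not have `p` elements. -/
noncomputable def evFace {p n : ℕ} (f : Plot X p → ℝ) (S : Finset (Fin n)) (c : Fin n → ℝ)
    (σ : Plot X n) : ℝ :=
  if h : S.card = p then
    f (σ.comp (faceMap (S.orderEmbOfFin h) c) (faceMap_contDiff (S.orderEmbOfFin h) c))
  else 0

/-- The sign of the shuffle `(S, T)`: the product of `-1` over all pairs `i ∈ S`, `j ∈ T` with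
`j < i`. -/
def rho {n : ℕ} (S T : Finset (Fin n)) : ℝ := ∏ i ∈ S, ∏ j ∈ T, if j < i then -1 else 1

/-- The coboundary `(δf)(σ) = ∑ᵢ (-1)ⁱ (f (σ|_{xᵢ = 1}) - f (σ|_{xᵢ = 0}))`. -/
noncomputable def coboundary {p : ℕ} (f : Plot X p → ℝ) (σ : Plot X (p + 1)) : ℝ :=
  ∑ i : Fin (p + 1), (-1) ^ (i : ℕ) *
    (f (σ.comp (faceMap i.succAboveOrderEmb fun _ => 1) (faceMap_contDiff _ _))
      - f (σ.comp (faceMap i.succAboveOrderEmb fun _ => 0) (faceMap_contDiff _ _)))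

/-- The (Serre) cup product of functions of `p`- and `q`-cubes, `p + q = n`:
`(f ∪ g)(σ) = ∑_S ± f (σ|_{x_j = 0, j ∉ S}) * g (σ|_{x_i = 1, i ∈ S})`, the sum being over the
`p`-element subsets `S` of the set of coordinates and the sign being that of the shuffle
`(S, Sᶜ)`. -/
noncomputable def cup {p q n : ℕ} (f : Plot X p → ℝ) (g : Plot X q → ℝ) (σ : Plot X n) : ℝ :=
  ∑ S : Finset (Fin n), rho S Sᶜ * (evFace f S (fun _ => 0) σ * evFace g Sᶜ (fun _ => 1) σ)

theorem evFace_of_card {p n : ℕ} (f : Plot X p → ℝ) {S : Finset (Fin n)} (h : S.card = p)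
    (c : Fin n → ℝ) (σ : Plot X n) :
    evFace f S c σ
      = f (σ.comp (faceMap (S.orderEmbOfFin h) c) (faceMap_contDiff (S.orderEmbOfFin h) c)) :=
  dif_pos h

theorem evFace_of_card_ne {p n : ℕ} (f : Plot X p → ℝ) {S : Finset (Fin n)} (h : S.card ≠ p)
    (c : Fin n → ℝ) (σ : Plot X n) : evFace f S c σ = 0 := dif_neg h

theorem Plot.comp_congr {m n : ℕ} (σ : Plot X n) {f g : E m → E n} (hf : ContDiff ℝ ∞ f)
    (hg : ContDiff ℝ ∞ g) (h : ∀ y, σ.1 (f y) = σ.1 (g y)) : σ.comp f hf = σ.comp g hg :=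
  Subtype.ext (funext h)

/-- Only the values of `c` outside `S` matter. -/
theorem evFace_congr {p n : ℕ} (f : Plot X p → ℝ) (S : Finset (Fin n)) {c c' : Fin n → ℝ}
    (hc : ∀ i ∉ S, c i = c' i) (σ : Plot X n) : evFace f S c σ = evFace f S c' σ := by
  by_cases h : S.card = p
  · rw [evFace_of_card f h, evFace_of_card f h]
    congr 1
    refine σ.comp_congr _ _ fun y => congrArg σ.1 (PiLp.ext fun i => ?_)
    by_cases hi : ∃ j, S.orderEmbOfFin h j = i
    · obtain ⟨j, rfl⟩ := hi
      rw [faceMap_of (S.orderEmbOfFin h).injective, faceMap_of (S.orderEmbOfFin h).injective]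
    · rw [faceMap_of_not _ _ hi, faceMap_of_not _ _ hi]
      refine hc i fun hS => hi ?_
      have : i ∈ Set.range (S.orderEmbOfFin h) := by rw [Finset.range_orderEmbOfFin]; exact hS
      exact this
  · rw [evFace_of_card_ne f h, evFace_of_card_ne f h]

/-- A face of a face is a face. -/
theorem evFace_comp {p m n : ℕ} (f : Plot X p → ℝ) (e : Fin m ↪o Fin n) (T : Finset (Fin m))
    (c : Fin n → ℝ) (c' : Fin m → ℝ) (σ : Plot X n) :
    evFace f T c' (σ.comp (faceMap e c) (faceMap_contDiff e c))
      = evFace f (T.map e.toEmbedding) (Function.extend e c' c) σ := by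
  by_cases h : T.card = p
  · have h' : (T.map e.toEmbedding).card = p := by rw [Finset.card_map, h]
    have he : (T.orderEmbOfFin h).trans e = (T.map e.toEmbedding).orderEmbOfFin h' := by
      refine Finset.orderEmbOfFin_unique' h' fun x => ?_
      exact Finset.mem_map_of_mem _ (Finset.orderEmbOfFin_mem T h x)
    rw [evFace_of_card f h, evFace_of_card f h', ← he]
    congr 1
    refine Subtype.ext (funext fun y => ?_)
    exact congrArg σ.1 (faceMap_comp e (T.orderEmbOfFin h) c c' y)
  · rw [evFace_of_card_ne f h, evFace_of_card_ne f (by rwa [Finset.card_map])]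

theorem rho_map {m n : ℕ} (e : Fin m ↪o Fin n) (S T : Finset (Fin m)) :
    rho (S.map e.toEmbedding) (T.map e.toEmbedding) = rho S T := by
  simp [rho, Finset.prod_map]

theorem rho_union_left {n : ℕ} {S S' : Finset (Fin n)} (h : Disjoint S S') (T : Finset (Fin n)) :
    rho (S ∪ S') T = rho S T * rho S' T := by
  rw [rho, Finset.prod_union h]; rfl

theorem rho_union_right {n : ℕ} (S : Finset (Fin n)) {T T' : Finset (Fin n)} (h : Disjoint T T') :
    rho S (T ∪ T') = rho S T * rho S T' := by
  simp only [rho, Finset.prod_union h, Finset.prod_mul_distrib]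

theorem rho_swap {n : ℕ} {S : Finset (Fin n)} {i : Fin n} (h : i ∉ S) :
    rho S {i} = (-1) ^ S.card * rho {i} S := by
  simp only [rho, Finset.prod_singleton]
  rw [← Finset.prod_const, ← Finset.prod_mul_distrib]
  refine Finset.prod_congr rfl fun j hj => ?_
  have : j ≠ i := fun hji => h (hji ▸ hj)
  rcases lt_or_gt_of_ne this with hlt | hlt
  · simp [hlt, hlt.le]
  · simp [hlt, hlt.le]

theorem rho_singleton_compl {n : ℕ} (i : Fin n) : rho {i} {i}ᶜ = (-1) ^ (i : ℕ) := by
  simp only [rho, Finset.prod_singleton]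
  rw [Finset.prod_ite]
  simp only [Finset.prod_const, one_pow, mul_one]
  have : Finset.filter (fun j => j < i) ({i}ᶜ : Finset (Fin n)) = Finset.Iio i := by
    ext j
    simp only [Finset.mem_filter, Finset.mem_compl, Finset.mem_singleton, Finset.mem_Iio]
    exact ⟨fun h => h.2, fun h => ⟨h.ne, h⟩⟩
  rw [this, Fin.card_Iio]

theorem extend_const {m n : ℕ} (M : Finset (Fin n)) (h : M.card = m) (a : ℝ) (c : Fin n → ℝ) :
    Function.extend (M.orderEmbOfFin h) (fun _ => a) c = M.piecewise (fun _ => a) c := by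
  funext i
  by_cases hi : i ∈ M
  · have : i ∈ Set.range (M.orderEmbOfFin h) := by rw [Finset.range_orderEmbOfFin]; exact hi
    obtain ⟨j, rfl⟩ := this
    rw [(M.orderEmbOfFin h).injective.extend_apply, Finset.piecewise_eq_of_mem _ _ _ hi]
  · rw [Finset.piecewise_eq_of_notMem _ _ _ hi, Function.extend_apply']
    rintro ⟨j, rfl⟩
    exact hi (Finset.orderEmbOfFin_mem M h j)

/-- Summing over the subsets of `M` is the same as summing over the subsets of `{0, …, m-1}`. -/
theorem sum_powerset_eq {m n : ℕ} (M : Finset (Fin n)) (h : M.card = m)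
    (φ : Finset (Fin n) → ℝ) :
    ∑ H ∈ M.powerset, φ H
      = ∑ T : Finset (Fin m), φ (T.map (M.orderEmbOfFin h).toEmbedding) := by
  symm
  refine Finset.sum_bij (fun T _ => T.map (M.orderEmbOfFin h).toEmbedding) ?_ ?_ ?_ ?_
  · intro T _
    rw [Finset.mem_powerset]
    intro i hi
    obtain ⟨j, -, rfl⟩ := Finset.mem_map.1 hi
    exact Finset.orderEmbOfFin_mem M h j
  · intro T _ T' _ hT
    exact Finset.map_injective _ hT
  · intro H hH
    rw [Finset.mem_powerset, ← Finset.map_orderEmbOfFin_univ M h] at hH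
    obtain ⟨T, -, rfl⟩ := Finset.subset_map_iff.1 hH
    exact ⟨T, Finset.mem_univ _, rfl⟩
  · intro T _; rfl

theorem map_compl_eq {m n : ℕ} (M : Finset (Fin n)) (h : M.card = m) (T : Finset (Fin m)) :
    Tᶜ.map (M.orderEmbOfFin h).toEmbedding = M \ T.map (M.orderEmbOfFin h).toEmbedding := by
  rw [Finset.compl_eq_univ_sdiff, Finset.map_sdiff]
  congr 1
  exact Finset.map_orderEmbOfFin_univ M h

theorem evFace_cup {p q m n : ℕ} (h : p + q = m) (f : Plot X p → ℝ) (g : Plot X q → ℝ)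
    (M : Finset (Fin n)) (c : Fin n → ℝ) (σ : Plot X n) :
    evFace (cup f g : Plot X m → ℝ) M c σ
      = ∑ H ∈ M.powerset, rho H (M \ H) * (evFace f H (M.piecewise (fun _ => 0) c) σ
          * evFace g (M \ H) (M.piecewise (fun _ => 1) c) σ) := by
  by_cases hM : M.card = m
  · rw [evFace_of_card _ hM, cup, sum_powerset_eq M hM]
    refine Finset.sum_congr rfl fun T _ => ?_
    rw [evFace_comp, evFace_comp, extend_const, extend_const, ← rho_map (M.orderEmbOfFin hM),
      map_compl_eq]
  · rw [evFace_of_card_ne _ hM]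
    refine (Finset.sum_eq_zero fun H hH => ?_).symm
    by_cases h1 : H.card = p
    · have : (M \ H).card ≠ q := by
        have := Finset.card_sdiff_add_card_eq_card (Finset.mem_powerset.1 hH)
        omega
      rw [evFace_of_card_ne g this]; simp
    · rw [evFace_of_card_ne f h1]; simp

theorem cup_assoc {p q r m k n : ℕ} (h₁ : p + q = m) (h₃ : q + r = k)
    (f : Plot X p → ℝ) (g : Plot X q → ℝ) (l : Plot X r → ℝ) (σ : Plot X n) :
    cup (cup f g : Plot X m → ℝ) l σ = cup f (cup g l : Plot X k → ℝ) σ := by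
  rw [cup, cup]
  simp only [evFace_cup h₁, evFace_cup h₃, Finset.sum_mul, Finset.mul_sum]
  rw [Finset.sum_sigma', Finset.sum_sigma']
  refine Finset.sum_bij' (fun x _ => ⟨x.2, x.1 \ x.2⟩) (fun x _ => ⟨x.1 ∪ x.2, x.1⟩) ?_ ?_ ?_ ?_ ?_
  · rintro ⟨M, H⟩ hx
    simp only [Finset.mem_sigma, Finset.mem_univ, true_and, Finset.mem_powerset] at hx ⊢
    intro i hi
    simp only [Finset.mem_sdiff] at hi
    simpa using hi.2
  · rintro ⟨H, K⟩ hx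
    simp only [Finset.mem_sigma, Finset.mem_univ, true_and, Finset.mem_powerset]
    exact Finset.subset_union_left
  · rintro ⟨M, H⟩ hx
    simp only [Finset.mem_sigma, Finset.mem_univ, true_and, Finset.mem_powerset] at hx
    simp [Finset.union_sdiff_of_subset hx]
  · rintro ⟨H, K⟩ hx
    simp only [Finset.mem_sigma, Finset.mem_univ, true_and, Finset.mem_powerset] at hx
    have : Disjoint H K := by
      rw [Finset.disjoint_left]
      intro i hi hK
      simpa [hi] using hx hK
    simp [Finset.union_sdiff_cancel_left this]
  · rintro ⟨M, H⟩ hx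
    simp only [Finset.mem_sigma, Finset.mem_univ, true_and, Finset.mem_powerset] at hx
    simp only
    have hd : Disjoint H (M \ H) := Finset.disjoint_sdiff
    have hL : Hᶜ \ (M \ H) = Mᶜ := by
      ext i
      have := @hx i
      simp only [Finset.mem_sdiff, Finset.mem_compl]
      tauto
    have hH : Hᶜ = (M \ H) ∪ Mᶜ := by
      ext i
      have := @hx i
      simp only [Finset.mem_sdiff, Finset.mem_compl, Finset.mem_union]
      tauto
    have hd' : Disjoint (M \ H) Mᶜ := by
      rw [Finset.disjoint_left]
      intro i hi
      simp only [Finset.mem_sdiff, Finset.mem_compl, not_not] at hi ⊢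
      exact hi.1
    have s1 : rho M Mᶜ = rho H Mᶜ * rho (M \ H) Mᶜ := by
      rw [← rho_union_left hd, Finset.union_sdiff_of_subset hx]
    have s2 : rho H Hᶜ = rho H (M \ H) * rho H Mᶜ := by
      rw [← rho_union_right _ hd', ← hH]
    have c1 : evFace f H (M.piecewise (fun _ => 0) fun _ => 0) σ = evFace f H (fun _ => 0) σ :=
      evFace_congr f H (fun i _ => by by_cases hi : i ∈ M <;> simp [hi]) σ
    have c2 : evFace l Mᶜ (Hᶜ.piecewise (fun _ => 1) fun _ => 1) σ = evFace l Mᶜ (fun _ => 1) σ :=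
      evFace_congr l Mᶜ (fun i _ => by by_cases hi : i ∈ Hᶜ <;> simp [Finset.piecewise, hi]) σ
    have c3 : evFace g (M \ H) (M.piecewise (fun _ => 1) fun _ => 0) σ
        = evFace g (M \ H) (Hᶜ.piecewise (fun _ => 0) fun _ => 1) σ := by
      refine evFace_congr g (M \ H) (fun i hi => ?_) σ
      have := @hx i
      simp only [Finset.mem_sdiff, not_and, not_not] at hi
      by_cases hM : i ∈ M
      · simp [Finset.piecewise, hM, hi hM]
      · have hH : i ∉ H := fun h => hM (this h)
        simp [Finset.piecewise, hM, hH]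
    rw [hL, s1, s2, c1, c2, c3]
    ring

theorem coboundary_eq {p : ℕ} (f : Plot X p → ℝ) (σ : Plot X (p + 1)) :
    coboundary f σ = ∑ i : Fin (p + 1), rho {i} {i}ᶜ *
      (evFace f {i}ᶜ (fun _ => 1) σ - evFace f {i}ᶜ (fun _ => 0) σ) := by
  refine Finset.sum_congr rfl fun i _ => ?_
  have hc : ({i}ᶜ : Finset (Fin (p + 1))).card = p := by simp [Finset.card_compl]
  have he : ({i}ᶜ : Finset (Fin (p + 1))).orderEmbOfFin hc = i.succAboveOrderEmb := by
    symm
    refine Finset.orderEmbOfFin_unique' hc fun x => ?_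
    simp
  rw [rho_singleton_compl, evFace_of_card f hc, evFace_of_card f hc]
  simp only [he]

theorem evFace_coboundary {p n : ℕ} (f : Plot X p → ℝ) (M : Finset (Fin n)) (c : Fin n → ℝ)
    (σ : Plot X n) :
    evFace (coboundary f) M c σ = ∑ i ∈ M, rho {i} (M \ {i}) *
      (evFace f (M \ {i}) (Function.update c i 1) σ
        - evFace f (M \ {i}) (Function.update c i 0) σ) := by
  by_cases hM : M.card = p + 1
  · rw [evFace_of_card _ hM, coboundary_eq]
    conv_rhs => rw [← Finset.map_orderEmbOfFin_univ M hM, Finset.sum_map]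
    refine Finset.sum_congr rfl fun j _ => ?_
    have key : ∀ a : ℝ, evFace f {j}ᶜ (fun _ => a)
        (σ.comp (faceMap (M.orderEmbOfFin hM) c) (faceMap_contDiff (M.orderEmbOfFin hM) c))
        = evFace f (M \ {M.orderEmbOfFin hM j}) (Function.update c (M.orderEmbOfFin hM j) a) σ := by
      intro a
      rw [evFace_comp, extend_const, map_compl_eq, Finset.map_singleton]
      refine evFace_congr f _ (fun i hi => ?_) σ
      simp only [Finset.mem_sdiff, Finset.mem_singleton, not_and, not_not] at hi
      by_cases hiM : i ∈ M
      · have : i = M.orderEmbOfFin hM j := hi hiM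
        subst this
        simp [Finset.piecewise]
      · have : i ≠ M.orderEmbOfFin hM j :=
          fun h => hiM (h ▸ Finset.orderEmbOfFin_mem M hM j)
        simp [Finset.piecewise, hiM, this]
    rw [key, key, ← rho_map (M.orderEmbOfFin hM), map_compl_eq, Finset.map_singleton,
      Finset.map_orderEmbOfFin_univ M hM]
    rfl
  · rw [evFace_of_card_ne _ hM]
    refine (Finset.sum_eq_zero fun i hi => ?_).symm
    have : (M \ {i}).card ≠ p := by
      have := Finset.card_sdiff_add_card_eq_card (Finset.singleton_subset_iff.2 hi)
      simp only [Finset.card_singleton] at this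
      omega
    rw [evFace_of_card_ne f this, evFace_of_card_ne f this]; simp

theorem coboundary_coboundary {p : ℕ} (f : Plot X p → ℝ) (σ : Plot X (p + 1 + 1)) :
    coboundary (coboundary f) σ = 0 := by
  let a : Fin (p + 2) → Fin (p + 2) → ℝ := fun i j => rho {i} {i}ᶜ * (rho {j} ({i}ᶜ \ {j}) *
    ((evFace f ({i}ᶜ \ {j}) (Function.update (fun _ => 1) j 1) σ
      - evFace f ({i}ᶜ \ {j}) (Function.update (fun _ => 1) j 0) σ)
    - (evFace f ({i}ᶜ \ {j}) (Function.update (fun _ => 0) j 1) σ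
      - evFace f ({i}ᶜ \ {j}) (Function.update (fun _ => 0) j 0) σ)))
  have h1 : coboundary (coboundary f) σ = ∑ i, ∑ j ∈ {i}ᶜ, a i j := by
    rw [coboundary_eq]
    refine Finset.sum_congr rfl fun i _ => ?_
    rw [evFace_coboundary, evFace_coboundary, ← Finset.sum_sub_distrib, Finset.mul_sum]
    refine Finset.sum_congr rfl fun j _ => ?_
    simp only [a]
    ring
  have h2 : ∀ i j, i ≠ j → a i j = - a j i := by
    intro i j hij
    have e1 : ({i}ᶜ \ {j} : Finset (Fin (p + 2))) = {j}ᶜ \ {i} := by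
      ext k; simp only [Finset.mem_sdiff, Finset.mem_compl]; tauto
    have e2 : ∀ i j : Fin (p + 2), i ≠ j → rho {i} {i}ᶜ = rho {i} {j} * rho {i} ({i}ᶜ \ {j}) := by
      intro i j hij
      rw [← rho_union_right _ Finset.disjoint_sdiff]
      congr 1
      refine (Finset.union_sdiff_of_subset ?_).symm
      simpa using hij
    have e3 : rho {i} {j} = - rho {j} {i} := by
      have := rho_swap (S := {i}) (i := j) (by simpa using hij.symm)
      simpa using this
    have c : ∀ x y : ℝ, evFace f ({j}ᶜ \ {i}) (Function.update (fun _ => x) j y) σ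
        = evFace f ({j}ᶜ \ {i}) (Function.update (fun _ => y) i x) σ := by
      intro x y
      refine evFace_congr f _ (fun k hk => ?_) σ
      simp only [Finset.mem_sdiff, Finset.mem_compl, Finset.mem_singleton, not_and, not_not] at hk
      by_cases hkj : k = j
      · subst hkj
        simp [Function.update, hij.symm]
      · have := hk hkj
        subst this
        simp [Function.update, hij]
    simp only [a]
    rw [e2 i j hij, e2 j i hij.symm, e1, e3, c, c, c, c]
    ring
  have h3 : ∑ i, ∑ j ∈ {i}ᶜ, a i j = ∑ i, ∑ j ∈ {i}ᶜ, a j i :=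
    Finset.sum_comm' (by intro i j; simp [eq_comm])
  have h4 : ∑ i, ∑ j ∈ {i}ᶜ, a i j = - ∑ i, ∑ j ∈ {i}ᶜ, a j i := by
    rw [← Finset.sum_neg_distrib]
    refine Finset.sum_congr rfl fun i _ => ?_
    rw [← Finset.sum_neg_distrib]
    refine Finset.sum_congr rfl fun j hj => h2 i j ?_
    simpa [eq_comm] using hj
  rw [h1]
  linarith

theorem coboundary_cup {p q n : ℕ} (h : p + q = n) (f : Plot X p → ℝ) (g : Plot X q → ℝ)
    (σ : Plot X (n + 1)) :
    coboundary (cup f g : Plot X n → ℝ) σ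
      = cup (coboundary f) g σ + (-1) ^ p * cup f (coboundary g) σ := by
  -- all three terms as sums over a coordinate `i` and a set `H` not containing it
  have l1 : coboundary (cup f g : Plot X n → ℝ) σ = ∑ i, ∑ H ∈ ({i}ᶜ : Finset _).powerset,
      rho {i} {i}ᶜ * (rho H ({i}ᶜ \ H) *
        (evFace f H (Function.update (fun _ => 0) i 1) σ * evFace g ({i}ᶜ \ H) (fun _ => 1) σ
        - evFace f H (fun _ => 0) σ
          * evFace g ({i}ᶜ \ H) (Function.update (fun _ => 1) i 0) σ)) := by
    rw [coboundary_eq]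
    refine Finset.sum_congr rfl fun i _ => ?_
    rw [evFace_cup h, evFace_cup h, ← Finset.sum_sub_distrib, Finset.mul_sum]
    refine Finset.sum_congr rfl fun H hH => ?_
    have c : ∀ x y : ℝ, ({i}ᶜ : Finset (Fin (n + 1))).piecewise (fun _ => x) (fun _ => y)
        = Function.update (fun _ => x) i y := by
      intro x y
      funext k
      by_cases hk : k = i <;> simp [Finset.piecewise, hk]
    rw [c, c, c, c, Function.update_eq_self_iff.2 rfl, Function.update_eq_self_iff.2 rfl]
    ring
  have l2 : cup (coboundary f) g σ = ∑ i, ∑ H ∈ ({i}ᶜ : Finset _).powerset,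
      rho (H ∪ {i}) ({i}ᶜ \ H) * (rho {i} H *
        ((evFace f H (Function.update (fun _ => 0) i 1) σ - evFace f H (fun _ => 0) σ)
          * evFace g ({i}ᶜ \ H) (fun _ => 1) σ)) := by
    rw [cup]
    simp only [evFace_coboundary, Finset.sum_mul, Finset.mul_sum]
    rw [Finset.sum_sigma', Finset.sum_sigma']
    refine Finset.sum_bij' (fun x _ => ⟨x.2, x.1 \ {x.2}⟩) (fun x _ => ⟨x.2 ∪ {x.1}, x.1⟩)
      ?_ ?_ ?_ ?_ ?_
    · rintro ⟨S, i⟩ hx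
      simp only [Finset.mem_sigma, Finset.mem_univ, true_and, Finset.mem_powerset]
      intro k hk
      simp only [Finset.mem_sdiff] at hk
      simpa using hk.2
    · rintro ⟨i, H⟩ hx
      simp only [Finset.mem_sigma, Finset.mem_univ, true_and]
      simp
    · rintro ⟨S, i⟩ hx
      simp only [Finset.mem_sigma, Finset.mem_univ, true_and] at hx
      have : S \ {i} ∪ {i} = S := Finset.sdiff_union_of_subset (Finset.singleton_subset_iff.2 hx)
      simp only [this]
    · rintro ⟨i, H⟩ hx
      simp only [Finset.mem_sigma, Finset.mem_univ, true_and, Finset.mem_powerset] at hx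
      have hi : i ∉ H := fun hH => by simpa using hx hH
      have : (H ∪ {i}) \ {i} = H := by
        rw [Finset.union_sdiff_right, Finset.sdiff_singleton_eq_erase, Finset.erase_eq_of_notMem hi]
      simp only [this]
    · rintro ⟨S, i⟩ hx
      simp only [Finset.mem_sigma, Finset.mem_univ, true_and] at hx
      simp only
      have e1 : S \ {i} ∪ {i} = S := Finset.sdiff_union_of_subset (Finset.singleton_subset_iff.2 hx)
      have e2 : ({i}ᶜ \ (S \ {i}) : Finset (Fin (n + 1))) = Sᶜ := by
        ext k
        simp only [Finset.mem_sdiff, Finset.mem_compl, Finset.mem_singleton]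
        by_cases hk : k = i
        · subst hk; simp [hx]
        · simp [hk]
      rw [e1, e2, Function.update_eq_self_iff.2 rfl]
      ring
  have l3 : cup f (coboundary g) σ = ∑ i, ∑ H ∈ ({i}ᶜ : Finset _).powerset,
      rho H Hᶜ * (rho {i} ({i}ᶜ \ H) * (evFace f H (fun _ => 0) σ *
        (evFace g ({i}ᶜ \ H) (fun _ => 1) σ
          - evFace g ({i}ᶜ \ H) (Function.update (fun _ => 1) i 0) σ))) := by
    rw [cup]
    simp only [evFace_coboundary, Finset.mul_sum]
    rw [Finset.sum_comm' (t' := Finset.univ) (s' := fun i => ({i}ᶜ : Finset _).powerset)]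
    · refine Finset.sum_congr rfl fun i _ => Finset.sum_congr rfl fun H _ => ?_
      have e : (Hᶜ \ {i} : Finset (Fin (n + 1))) = {i}ᶜ \ H := by
        ext k; simp only [Finset.mem_sdiff, Finset.mem_compl]; tauto
      rw [e, Function.update_eq_self_iff.2 rfl]
      ring
    · intro H i
      simp
  rw [l1, l2, l3, Finset.mul_sum, ← Finset.sum_add_distrib]
  refine Finset.sum_congr rfl fun i _ => ?_
  rw [Finset.mul_sum, ← Finset.sum_add_distrib]
  refine Finset.sum_congr rfl fun H hH => ?_
  rw [Finset.mem_powerset] at hH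
  have hi : i ∉ H := fun h => by simpa using hH h
  by_cases hc : H.card = p
  · have d1 : Disjoint H ({i}ᶜ \ H) := Finset.disjoint_sdiff
    have d2 : Disjoint H {i} := Finset.disjoint_singleton_right.2 hi
    have d3 : Disjoint {i} ({i}ᶜ \ H) := by
      rw [Finset.disjoint_singleton_left]; simp
    have s1 : rho {i} {i}ᶜ = rho {i} H * rho {i} ({i}ᶜ \ H) := by
      rw [← rho_union_right _ d1, Finset.union_sdiff_of_subset hH]
    have s2 : rho (H ∪ {i}) ({i}ᶜ \ H) = rho H ({i}ᶜ \ H) * rho {i} ({i}ᶜ \ H) :=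
      rho_union_left d2 _
    have s3 : rho H Hᶜ = (-1) ^ p * rho {i} H * rho H ({i}ᶜ \ H) := by
      rw [← hc, ← rho_swap hi, ← rho_union_right _ d3]
      congr 1
      ext k
      simp only [Finset.mem_compl, Finset.mem_union, Finset.mem_sdiff, Finset.mem_singleton]
      by_cases hk : k = i
      · subst hk; simp [hi]
      · simp [hk]
    have s4 : ((-1 : ℝ) ^ p) * (-1) ^ p = 1 := by rw [← mul_pow]; simp
    rw [s1, s2, s3]
    linear_combination (-(rho {i} H * rho H ({i}ᶜ \ H) * rho {i} ({i}ᶜ \ H) *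
      evFace f H (fun _ => 0) σ * (evFace g ({i}ᶜ \ H) (fun _ => 1) σ
          - evFace g ({i}ᶜ \ H) (Function.update (fun _ => 1) i 0) σ))) * s4
  · simp [evFace_of_card_ne f hc]

theorem evFace_univ {p : ℕ} (f : Plot X p → ℝ) (c : Fin p → ℝ) (σ : Plot X p) :
    evFace f Finset.univ c σ = f σ := by
  have h : (Finset.univ : Finset (Fin p)).card = p := by simp
  rw [evFace_of_card f h]
  congr 1
  refine Subtype.ext (funext fun y => congrArg σ.1 (PiLp.ext fun i => ?_))
  have : Finset.univ.orderEmbOfFin h = RelEmbedding.refl _ :=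
    (Finset.orderEmbOfFin_unique' h fun x => Finset.mem_univ _).symm
  rw [this]
  exact faceMap_of Function.injective_id c y i

theorem one_cup {p : ℕ} (f : Plot X p → ℝ) (σ : Plot X p) :
    cup (fun _ : Plot X 0 => (1 : ℝ)) f σ = f σ := by
  rw [cup, Finset.sum_eq_single ∅]
  · rw [evFace_of_card _ Finset.card_empty, Finset.compl_empty, evFace_univ]
    simp [rho]
  · intro S _ hS
    rw [evFace_of_card_ne _ (by simpa using hS)]; simp
  · simp

theorem cup_one {p : ℕ} (f : Plot X p → ℝ) (σ : Plot X p) :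
    cup f (fun _ : Plot X 0 => (1 : ℝ)) σ = f σ := by
  rw [cup, Finset.sum_eq_single Finset.univ]
  · rw [Finset.compl_univ, evFace_of_card (fun _ : Plot X 0 => (1 : ℝ)) Finset.card_empty,
      evFace_univ]
    simp [rho]
  · intro S _ hS
    rw [evFace_of_card_ne (fun _ : Plot X 0 => (1 : ℝ))]
    · simp
    · intro h
      rw [Finset.card_eq_zero, Finset.compl_eq_empty_iff] at h
      exact hS h
  · simp

/-- The cube `σ` does not depend on its `i`-th coordinate. -/
def IndepOf {n : ℕ} (σ : Plot X n) (i : Fin n) : Prop :=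
  ∀ x y : E n, (∀ j, j ≠ i → x j = y j) → σ.1 x = σ.1 y

/-- A cube is degenerate if it does not depend on one of its coordinates, i.e. if it factors
through one of the coordinate projections `ℝⁿ → ℝⁿ⁻¹`. -/
def Degenerate {n : ℕ} (σ : Plot X n) : Prop := ∃ i, IndepOf σ i

theorem IndepOf.evFace_eq_zero {p n : ℕ} {f : Plot X p → ℝ} (hf : ∀ σ, Degenerate σ → f σ = 0)
    {σ : Plot X n} {i : Fin n} (hσ : IndepOf σ i) {S : Finset (Fin n)} (hi : i ∈ S)
    (c : Fin n → ℝ) : evFace f S c σ = 0 := by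
  by_cases h : S.card = p
  · rw [evFace_of_card f h]
    have : i ∈ Set.range (S.orderEmbOfFin h) := by rw [Finset.range_orderEmbOfFin]; exact hi
    obtain ⟨j, rfl⟩ := this
    refine hf _ ⟨j, fun x y hxy => hσ _ _ fun k hk => ?_⟩
    by_cases hk' : ∃ l, S.orderEmbOfFin h l = k
    · obtain ⟨l, rfl⟩ := hk'
      rw [faceMap_of (S.orderEmbOfFin h).injective, faceMap_of (S.orderEmbOfFin h).injective]
      exact hxy l fun hl => hk (congrArg _ hl)
    · rw [faceMap_of_not _ _ hk', faceMap_of_not _ _ hk']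
  · exact evFace_of_card_ne f h c σ

theorem IndepOf.evFace_congr {p n : ℕ} (f : Plot X p → ℝ)
    {σ : Plot X n} {i : Fin n} (hσ : IndepOf σ i) (S : Finset (Fin n))
    {c c' : Fin n → ℝ} (hc : ∀ j, j ∉ S → j ≠ i → c j = c' j) :
    evFace f S c σ = evFace f S c' σ := by
  by_cases h : S.card = p
  · rw [evFace_of_card f h, evFace_of_card f h]
    congr 1
    refine σ.comp_congr _ _ fun y => hσ _ _ fun k hk => ?_
    by_cases hk' : ∃ l, S.orderEmbOfFin h l = k
    · obtain ⟨l, rfl⟩ := hk'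
      rw [faceMap_of (S.orderEmbOfFin h).injective, faceMap_of (S.orderEmbOfFin h).injective]
    · rw [faceMap_of_not _ _ hk', faceMap_of_not _ _ hk']
      refine hc k (fun hS => hk' ?_) hk
      have : k ∈ Set.range (S.orderEmbOfFin h) := by rw [Finset.range_orderEmbOfFin]; exact hS
      exact this
  · rw [evFace_of_card_ne f h, evFace_of_card_ne f h]

variable (X)

/-- The normalized cubical `p`-cochains: real functions of the smooth `p`-cubes `ℝᵖ → X` that
vanish on degenerate cubes. -/
def cubeSubmodule (p : ℕ) : Submodule ℝ (Plot X p → ℝ) where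
  carrier := {f | ∀ σ, Degenerate σ → f σ = 0}
  zero_mem' _ _ := rfl
  add_mem' hf hg σ hσ := by rw [Pi.add_apply, hf σ hσ, hg σ hσ, add_zero]
  smul_mem' c f hf σ hσ := by rw [Pi.smul_apply, hf σ hσ, smul_zero]

/-- The real vector space `C^p_cube(X)` of normalized cubical `p`-cochains. -/
def CubeCochain (p : ℕ) : Type u := cubeSubmodule X p

noncomputable instance (p : ℕ) : AddCommGroup (CubeCochain X p) :=
  inferInstanceAs (AddCommGroup (cubeSubmodule X p))

noncomputable instance (p : ℕ) : Module ℝ (CubeCochain X p) :=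
  inferInstanceAs (Module ℝ (cubeSubmodule X p))

variable {X}

namespace CubeCochain

/-- Constructor for normalized cochains. -/
def mk {p : ℕ} (val : Plot X p → ℝ) (h : val ∈ cubeSubmodule X p) : CubeCochain X p := ⟨val, h⟩

theorem ext {p : ℕ} {f g : CubeCochain X p} (h : ∀ σ, f.1 σ = g.1 σ) : f = g :=
  Subtype.ext (funext h)

/-- The coboundary operator. -/
noncomputable def d (p : ℕ) : CubeCochain X p →ₗ[ℝ] CubeCochain X (p + 1) where
  toFun f := mk (coboundary f.1) (by
    rintro σ ⟨i, hσ⟩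
    rw [coboundary_eq]
    refine Finset.sum_eq_zero fun j _ => ?_
    by_cases hj : i = j
    · subst hj
      rw [hσ.evFace_congr f.1 {i}ᶜ (c := fun _ => 1) (c' := fun _ => 0)
        (fun k hk hk' => absurd (by simpa using hk) hk'), sub_self, mul_zero]
    · have : i ∈ ({j}ᶜ : Finset _) := by simpa using hj
      rw [hσ.evFace_eq_zero f.2 this, hσ.evFace_eq_zero f.2 this, sub_self, mul_zero])
  map_add' f g := ext fun σ => by
    change coboundary (f.1 + g.1) σ = coboundary f.1 σ + coboundary g.1 σ
    simp only [coboundary, Pi.add_apply, ← Finset.sum_add_distrib]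
    exact Finset.sum_congr rfl fun i _ => by ring
  map_smul' c f := ext fun σ => by
    change coboundary (c • f.1) σ = c * coboundary f.1 σ
    simp only [coboundary, Pi.smul_apply, Finset.mul_sum, smul_eq_mul]
    exact Finset.sum_congr rfl fun i _ => by ring

theorem evFace_add {p n : ℕ} (f g : Plot X p → ℝ) (S : Finset (Fin n)) (c : Fin n → ℝ)
    (σ : Plot X n) : evFace (f + g) S c σ = evFace f S c σ + evFace g S c σ := by
  by_cases h : S.card = p
  · rw [evFace_of_card _ h, evFace_of_card _ h, evFace_of_card _ h]; rfl
  · rw [evFace_of_card_ne _ h, evFace_of_card_ne _ h, evFace_of_card_ne _ h, add_zero]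

theorem evFace_smul {p n : ℕ} (a : ℝ) (f : Plot X p → ℝ) (S : Finset (Fin n)) (c : Fin n → ℝ)
    (σ : Plot X n) : evFace (a • f) S c σ = a * evFace f S c σ := by
  by_cases h : S.card = p
  · rw [evFace_of_card _ h, evFace_of_card _ h]; rfl
  · rw [evFace_of_card_ne _ h, evFace_of_card_ne _ h, mul_zero]

/-- The cup product of normalized cochains. -/
noncomputable def mulFun {p q n : ℕ} (_h : p + q = n) (f : CubeCochain X p)
    (g : CubeCochain X q) : CubeCochain X n :=
  mk (cup f.1 g.1) (by
    rintro σ ⟨i, hσ⟩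
    refine Finset.sum_eq_zero fun S _ => ?_
    by_cases hi : i ∈ S
    · rw [hσ.evFace_eq_zero f.2 hi]; simp
    · have : i ∈ Sᶜ := by simpa using hi
      rw [hσ.evFace_eq_zero g.2 this]; simp)

/-- The cup product as a bilinear map. -/
noncomputable def mul {p q n : ℕ} (h : p + q = n) :
    CubeCochain X p →ₗ[ℝ] CubeCochain X q →ₗ[ℝ] CubeCochain X n :=
  LinearMap.mk₂ ℝ (mulFun h)
    (fun f f' g => ext fun σ => by
      change cup (f.1 + f'.1) g.1 σ = cup f.1 g.1 σ + cup f'.1 g.1 σ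
      simp only [cup, evFace_add, ← Finset.sum_add_distrib]
      exact Finset.sum_congr rfl fun i _ => by ring)
    (fun c f g => ext fun σ => by
      change cup (c • f.1) g.1 σ = c * cup f.1 g.1 σ
      simp only [cup, evFace_smul, Finset.mul_sum]
      exact Finset.sum_congr rfl fun i _ => by ring)
    (fun f g g' => ext fun σ => by
      change cup f.1 (g.1 + g'.1) σ = cup f.1 g.1 σ + cup f.1 g'.1 σ
      simp only [cup, evFace_add, ← Finset.sum_add_distrib]
      exact Finset.sum_congr rfl fun i _ => by ring)
    (fun c f g => ext fun σ => by
      change cup f.1 (c • g.1) σ = c * cup f.1 g.1 σ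
      simp only [cup, evFace_smul, Finset.mul_sum]
      exact Finset.sum_congr rfl fun i _ => by ring)

theorem leibniz {p q n : ℕ} (h : p + q = n) (f : CubeCochain X p) (g : CubeCochain X q) :
    d n (mul h f g) = mul (show p + 1 + q = n + 1 by omega) (d p f) g
      + (-1 : ℝ) ^ p • mul (show p + (q + 1) = n + 1 by omega) f (d q g) :=
  ext fun σ => coboundary_cup h f.1 g.1 σ

end CubeCochain

variable (X)

/-- The cochain algebra `C^*_cube(X)` of normalized cubical cochains with the cup product. -/
noncomputable def Cube : CochainAlg.{u} where
  C p := CubeCochain X p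
  mul h := CubeCochain.mul h
  one := CubeCochain.mk (fun _ => 1) (fun _ ⟨i, _⟩ => i.elim0)
  one_mul _ f := CubeCochain.ext fun σ => one_cup f.1 σ
  mul_one _ f := CubeCochain.ext fun σ => cup_one f.1 σ
  mul_assoc h₁ _ h₃ _ f g l := CubeCochain.ext fun σ => cup_assoc h₁ h₃ f.1 g.1 l.1 σ
  d := CubeCochain.d
  d_d _ f := CubeCochain.ext fun σ => coboundary_coboundary f.1 σ
  leibniz := CubeCochain.leibniz

end Cubes

/-! ### Integration of forms over cubes -/

section Integration

open MeasureTheory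

theorem fderiv_coord {m n : ℕ} {f : E m → E n} (hf : ContDiff ℝ ∞ f) (x v : E m) (i : Fin n) :
    fderiv ℝ f x v i = fderiv ℝ (fun y => f y i) x v := by
  have h : HasFDerivAt (fun y => f y i)
      ((EuclideanSpace.proj (𝕜 := ℝ) i : E n →L[ℝ] ℝ).comp (fderiv ℝ f x)) x :=
    (EuclideanSpace.proj (𝕜 := ℝ) i : E n →L[ℝ] ℝ).hasFDerivAt.comp x
      ((hf.differentiable (by simp)) x).hasFDerivAt
  rw [h.fderiv]
  rfl

theorem fderiv_proj {n : ℕ} (x v : E n) (i : Fin n) :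
    fderiv ℝ (fun y : E n => y i) x v = v i := by
  have h : HasFDerivAt (fun y : E n => y i) (EuclideanSpace.proj (𝕜 := ℝ) i : E n →L[ℝ] ℝ) x :=
    (EuclideanSpace.proj (𝕜 := ℝ) i : E n →L[ℝ] ℝ).hasFDerivAt
  rw [h.fderiv]
  rfl

theorem fderiv_faceMap {p n : ℕ} (e : Fin p ↪o Fin n) (c : Fin n → ℝ) (y : E p) (j : Fin p) :
    fderiv ℝ (faceMap e c) y (EuclideanSpace.single j 1) = EuclideanSpace.single (e j) 1 := by
  refine PiLp.ext fun i => ?_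
  rw [fderiv_coord (faceMap_contDiff e c)]
  by_cases hi : ∃ k, e k = i
  · obtain ⟨k, rfl⟩ := hi
    simp only [faceMap_of e.injective]
    rw [fderiv_proj]
    simp
  · simp only [faceMap_of_not c _ hi]
    have : i ≠ e j := fun h => hi ⟨j, h.symm⟩
    simp [this]

variable {X : Type u} [DiffeologicalSpace X]

/-- The coefficient of `dx₀ ∧ ⋯ ∧ dx_{p-1}` in the `p`-form `σ^* τ` on `ℝᵖ`. -/
noncomputable def density {p : ℕ} (τ : Form X p) (σ : Plot X p) (x : Fin p → ℝ) : ℝ :=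
  τ.1 p σ (WithLp.toLp 2 x) fun i => EuclideanSpace.single i 1

/-- Coefficients of smooth forms are smooth. -/
theorem contDiff_coeff {n q : ℕ} {w : E n → E n [⋀^Fin q]→L[ℝ] ℝ} (hw : ContDiff ℝ ∞ w)
    (v : Fin q → E n) : ContDiff ℝ ∞ (fun x : Fin n → ℝ => w (WithLp.toLp 2 x) v) := by
  have h1 : ContDiff ℝ ∞ (fun x : Fin n → ℝ => (WithLp.toLp 2 x : E n)) :=
    PiLp.contDiff_toLp
  exact (ContinuousAlternatingMap.apply ℝ (E n) ℝ v).contDiff.comp (hw.comp h1)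

theorem density_continuous {p : ℕ} (τ : Form X p) (σ : Plot X p) : Continuous (density τ σ) :=
  (contDiff_coeff (τ.smooth σ) _).continuous

theorem density_integrableOn {p : ℕ} (τ : Form X p) (σ : Plot X p) :
    IntegrableOn (density τ σ) (Set.Icc 0 1) :=
  (density_continuous τ σ).continuousOn.integrableOn_compact isCompact_Icc

/-- The integral of the `p`-form `τ` over the `p`-cube `σ`, i.e. of `σ^* τ` over `[0,1]ᵖ`. -/
noncomputable def cubeIntegral {p : ℕ} (τ : Form X p) (σ : Plot X p) : ℝ :=
  ∫ x in Set.Icc (0 : Fin p → ℝ) 1, density τ σ x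

theorem density_degenerate {p : ℕ} (τ : Form X p) {σ : Plot X p} (hσ : Degenerate σ)
    (x : Fin p → ℝ) : density τ σ x = 0 := by
  obtain ⟨i, hi⟩ := hσ
  let P : E p → E p := fun y => WithLp.toLp 2 (Function.update y i 0)
  have hPj : ∀ y j, j ≠ i → P y j = y j := fun y j hj => Function.update_of_ne hj _ _
  have hPi : ∀ y, P y i = 0 := fun y => Function.update_self _ _ _
  have hP : ContDiff ℝ ∞ P := by
    rw [contDiff_euclidean]
    intro j
    by_cases hj : j = i
    · subst hj
      simp only [hPi]
      exact contDiff_const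
    · simp only [hPj _ _ hj]
      fun_prop
  have hc : σ.comp P hP = σ := Subtype.ext (funext fun y => hi _ _ fun j hj => hPj y j hj)
  rw [density]
  conv_lhs => rw [← hc]
  rw [τ.natural, ContinuousAlternatingMap.compContinuousLinearMap_apply]
  refine ContinuousAlternatingMap.map_coord_zero _ i ?_
  refine PiLp.ext fun j => ?_
  simp only [Function.comp_apply]
  rw [fderiv_coord hP]
  by_cases hj : j = i
  · subst hj
    simp [hPi]
  · simp only [hPj _ _ hj]
    rw [fderiv_proj]
    simp [hj]

theorem cubeIntegral_degenerate {p : ℕ} (τ : Form X p) {σ : Plot X p} (hσ : Degenerate σ) :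
    cubeIntegral τ σ = 0 := by
  simp only [cubeIntegral, density_degenerate _ hσ, integral_zero]

theorem density_face {p : ℕ} (τ : Form X p) (σ : Plot X (p + 1)) (i : Fin (p + 1)) (a : ℝ)
    (x : Fin p → ℝ) :
    density τ (σ.comp (faceMap i.succAboveOrderEmb fun _ => a) (faceMap_contDiff _ _)) x
      = τ.1 (p + 1) σ (WithLp.toLp 2 (i.insertNth a x))
          (i.removeNth fun j => EuclideanSpace.single j 1) := by
  rw [density, τ.natural, ContinuousAlternatingMap.compContinuousLinearMap_apply]
  have h1 : faceMap i.succAboveOrderEmb (fun _ => a) (WithLp.toLp 2 x)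
      = WithLp.toLp 2 (i.insertNth a x) := by
    refine PiLp.ext fun k => ?_
    refine Fin.succAboveCases i ?_ (fun j => ?_) k
    · rw [faceMap_of_not]
      · simp
      · rintro ⟨j, hj⟩
        exact Fin.succAbove_ne i j hj
    · have := faceMap_of i.succAboveOrderEmb.injective (fun _ => a) (WithLp.toLp 2 x) j
      simpa using this
  rw [h1]
  congr 1
  funext j
  exact fderiv_faceMap _ _ _ j

/-- Stokes' theorem for cubes. -/
theorem stokes {p : ℕ} (τ : Form X p) (σ : Plot X (p + 1)) :
    cubeIntegral (Form.d p τ) σ = coboundary (cubeIntegral τ) σ := by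
  let w : E (p + 1) → E (p + 1) [⋀^Fin p]→L[ℝ] ℝ := τ.1 (p + 1) σ
  have hw : ContDiff ℝ ∞ w := τ.smooth σ
  let e : Fin (p + 1) → E (p + 1) := fun j => EuclideanSpace.single j 1
  let F : Fin (p + 1) → (Fin (p + 1) → ℝ) → ℝ := fun i x =>
    (-1) ^ (i : ℕ) * w (WithLp.toLp 2 x) (i.removeNth e)
  have hF : ∀ i, ContDiff ℝ ∞ (F i) := fun i => contDiff_const.mul (contDiff_coeff hw _)
  have hd : ∀ x, density (Form.d p τ) σ x = ∑ i, fderiv ℝ (F i) x (Pi.single i 1) := by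
    intro x
    change extDeriv w (WithLp.toLp 2 x) e = _
    rw [extDeriv_apply (hw.differentiable (by simp) _)]
    refine Finset.sum_congr rfl fun i _ => ?_
    have h1 : DifferentiableAt ℝ (fun y => w y (i.removeNth e)) (WithLp.toLp 2 x) :=
      ((ContinuousAlternatingMap.apply ℝ (E (p + 1)) ℝ (i.removeNth e)).contDiff.comp
        hw).differentiable (n := ∞) (by simp) _
    have h2 : HasFDerivAt (F i) (((-1 : ℝ) ^ (i : ℕ)) •
        ((fderiv ℝ (fun y => w y (i.removeNth e)) (WithLp.toLp 2 x)).comp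
          ((PiLp.continuousLinearEquiv 2 ℝ (fun _ : Fin (p + 1) => ℝ)).symm :
            (Fin (p + 1) → ℝ) →L[ℝ] E (p + 1)))) x :=
      (HasFDerivAt.comp x h1.hasFDerivAt
        ((PiLp.continuousLinearEquiv 2 ℝ (fun _ : Fin (p + 1) => ℝ)).symm :
            (Fin (p + 1) → ℝ) →L[ℝ] E (p + 1)).hasFDerivAt).const_mul _
    rw [h2.fderiv]
    have h3 : ((PiLp.continuousLinearEquiv 2 ℝ (fun _ : Fin (p + 1) => ℝ)).symm (Pi.single i 1)
        : E (p + 1)) = e i := by simp [e]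
    simp [h3]
  rw [cubeIntegral]
  simp only [hd]
  rw [integral_divergence_of_hasFDerivAt_off_countable' 0 1 zero_le_one F
    (fun i x => fderiv ℝ (F i) x) ∅ Set.countable_empty (fun i => (hF i).continuous.continuousOn)
    (fun x _ i => ((hF i).differentiable (by simp) x).hasFDerivAt)
    (by
      have := density_integrableOn (Form.d p τ) σ
      rwa [show density (Form.d p τ) σ = _ from funext hd] at this)]
  refine Finset.sum_congr rfl fun i _ => ?_
  have key : ∀ a : ℝ, ∫ x in Set.Icc ((0 : Fin (p + 1) → ℝ) ∘ i.succAbove)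
      ((1 : Fin (p + 1) → ℝ) ∘ i.succAbove), F i (i.insertNth a x)
      = (-1) ^ (i : ℕ) * cubeIntegral τ
        (σ.comp (faceMap i.succAboveOrderEmb fun _ => a) (faceMap_contDiff _ _)) := by
    intro a
    rw [cubeIntegral, ← integral_const_mul]
    simp only [density_face]
    rfl
  rw [mul_sub, ← key, ← key]
  rfl

/-- The integration map `∫ : Ω^*(X) → C^*_cube(X)`, `(∫ τ)(σ) = ∫_{[0,1]ᵖ} σ^* τ`. -/
noncomputable def iz (X : Type u) [DiffeologicalSpace X] : CochainMap (Omega X) (Cube X) where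
  f _ :=
    { toFun := fun τ => CubeCochain.mk (cubeIntegral τ) fun _ hσ => cubeIntegral_degenerate τ hσ
      map_add' := fun τ η => CubeCochain.ext fun σ =>
        integral_add (density_integrableOn τ σ) (density_integrableOn η σ)
      map_smul' := fun c τ => CubeCochain.ext fun σ => integral_const_mul c (density τ σ) }
  comm _ τ := CubeCochain.ext fun σ => stokes τ σ

end Integration

end DeRham

namespace DeRham

open scoped ContDiff

universe u

open Diffeology

/-! ### Integrals depending smoothly on a parameter -/

section ParametricIntegral

variable {F G : Type u} [NormedAddCommGroup F] [NormedSpace ℝ F] [FiniteDimensional ℝ F]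
  [NormedAddCommGroup G] [NormedSpace ℝ G]

/-! The argument is the method of acyclic models on the category of the spaces `ℝⁿ` and smooth maps.
Forms, cubical cochains and alternating simplicial cochains of `X` restrict along plots to
presheaves of complexes on this category, and for the two kinds of cochains compatible local
sections glue uniquely. Suppose the source presheaf is contractible to constants on each `ℝⁿ`
(`LocCx.Contr`, not naturally), and the target is a natural retract of functions on plots
(`LocCx.Cofree`). Then a contraction used on the models alone spreads naturally to all plots.
Consequently a natural cochain map that kills the constant `1` is null-homotopic by a natural
homotopy (`NatMap.exists_homotopy`). The homotopy glues over `X`, so the map sends cocycles of `X`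
to coboundaries (`Glob.mem_B_of_natural`). Nothing is required of `X`, because all choices are made
on `ℝⁿ`.

Multiplicativity of integration: for a fixed closed form `b`, the defect `a ↦ ∫ (a ∧ b) - (∫ a) ∪ (∫
b)` is a natural cochain map from forms to the shifted cubical complex, and it vanishes at `a = 1`.
Forms on `ℝⁿ` are contractible by the Poincaré lemma and cubical cochains are cofree, so the defect
is a coboundary whenever `a` is closed (`iz_mul_sub_mem_B`).

Comparison with `α`: the targets of `α` and of integration are quasi-isomorphic for every `X`, in
two steps. A double complex of families of forms on the affine simplices, alternating in tuples of
vertices, is contracted in one direction by averaged homotopy operators and in the other by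
barycentric coordinates; it gives `theta` from the simplicial de Rham algebra to alternating
cochains. Alternating and cubical cochains are both contractible and cofree, hence quasi-isomorphic
(`Glob.exists_quasiIso`). Let `Ψ` be the composite. Integration and `Ψ ∘ α` are natural cochain maps
from forms to cubical cochains that agree on `1`, so they agree on cohomology
(`exists_iz_factorization`). As `Ψ` is bijective there, integration is bijective exactly when `α`
is, and both maps are multiplicative on cohomology. -/

theorem hasFDerivAt_parametric_integral {g : ℝ × F → G} (hg : ContDiff ℝ ∞ g) (x : F) :
    HasFDerivAt (fun x => ∫ t in (0 : ℝ)..1, g (t, x))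
      (∫ t in (0 : ℝ)..1, (fderiv ℝ g (t, x)).comp (ContinuousLinearMap.inr ℝ ℝ F)) x := by
  let F' : F → ℝ → F →L[ℝ] G :=
    fun y t => (fderiv ℝ g (t, y)).comp (ContinuousLinearMap.inr ℝ ℝ F)
  have hF' : Continuous fun z : ℝ × F => F' z.2 z.1 :=
    ((hg.continuous_fderiv (by simp)).clm_comp continuous_const)
  -- The continuous partial derivative is bounded on this compact set, and the bound `M` serves as
  -- dominating function. The ball is compact because `F` is finite-dimensional.
  have hc : IsCompact (Set.Icc (0 : ℝ) 1 ×ˢ Metric.closedBall x 1) :=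
    isCompact_Icc.prod (@isCompact_closedBall _ _ (FiniteDimensional.proper ℝ F) x 1)
  obtain ⟨M, hM⟩ := hc.exists_bound_of_continuousOn hF'.continuousOn
  refine intervalIntegral.hasFDerivAt_integral_of_dominated_of_fderiv_le (bound := fun _ => M)
    (F := fun y t => g (t, y)) (F' := F') (Metric.closedBall_mem_nhds x one_pos) ?_ ?_ ?_ ?_ ?_ ?_
  · refine Filter.Eventually.of_forall fun y => Continuous.aestronglyMeasurable ?_
    exact hg.continuous.comp (by fun_prop)
  · exact (hg.continuous.comp (by fun_prop : Continuous fun t : ℝ => (t, x))).intervalIntegrable _ _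
  · exact (hF'.comp (by fun_prop : Continuous fun t : ℝ => (t, x))).aestronglyMeasurable
  · refine Filter.Eventually.of_forall fun t ht y hy => hM (t, y) ⟨?_, hy⟩
    rw [Set.uIoc_of_le zero_le_one] at ht
    exact ⟨ht.1.le, ht.2⟩
  · exact intervalIntegrable_const
  · refine Filter.Eventually.of_forall fun t _ y _ => ?_
    exact ((hg.differentiable (by simp) (t, y)).hasFDerivAt).comp y (hasFDerivAt_prodMk_right t y)

/-- Induction on the order: the derivative is again a parametric integral of a smooth integrand, now
with values in `F →L[ℝ] G`, which is why the induction generalizes over `G`. -/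
theorem contDiff_parametric_integral {g : ℝ × F → G} (hg : ContDiff ℝ ∞ g) :
    ContDiff ℝ ∞ (fun x => ∫ t in (0 : ℝ)..1, g (t, x)) := by
  rw [contDiff_infty]
  intro n
  induction n generalizing G with
  | zero =>
    exact contDiff_zero.2 (continuous_iff_continuousAt.2 fun x =>
      (hasFDerivAt_parametric_integral hg x).continuousAt)
  | succ n ih =>
    push_cast
    rw [contDiff_succ_iff_fderiv]
    refine ⟨fun x => (hasFDerivAt_parametric_integral hg x).differentiableAt, by simp, ?_⟩
    rw [funext fun x => (hasFDerivAt_parametric_integral hg x).fderiv]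
    exact ih (g := fun z => (fderiv ℝ g z).comp (ContinuousLinearMap.inr ℝ ℝ F))
      ((hg.fderiv_right (m := ∞) (by simp)).clm_comp contDiff_const)

end ParametricIntegral

/-! ### The homotopy operator -/

section Cylinder

/-- The vector `∂/∂t` of the cylinder `ℝ × ℝⁿ = ℝⁿ⁺¹`. -/
noncomputable def cylVec (n : ℕ) : E (n + 1) := EuclideanSpace.single 0 1

/-- The inclusion of `ℝⁿ` into the cylinder `ℝ × ℝⁿ = ℝⁿ⁺¹` at `t = 0`. -/
noncomputable def cylInc (n : ℕ) : E n →L[ℝ] E (n + 1) :=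
  LinearMap.toContinuousLinearMap
    { toFun := fun x => WithLp.toLp 2 (Fin.cons 0 x)
      map_add' := fun x y => PiLp.ext fun i => by
        refine Fin.cases ?_ (fun j => ?_) i <;> simp
      map_smul' := fun c x => PiLp.ext fun i => by
        refine Fin.cases ?_ (fun j => ?_) i <;> simp }

/-- The projection of the cylinder `ℝ × ℝⁿ = ℝⁿ⁺¹` to `ℝⁿ`. -/
noncomputable def cylProj (n : ℕ) : E (n + 1) →L[ℝ] E n :=
  LinearMap.toContinuousLinearMap
    { toFun := fun x => WithLp.toLp 2 fun i => x i.succ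
      map_add' := fun _ _ => rfl
      map_smul' := fun _ _ => rfl }

/-- The point `(t, x)` of the cylinder. -/
noncomputable def cyl {n : ℕ} (t : ℝ) (x : E n) : E (n + 1) := t • cylVec n + cylInc n x

theorem cylInc_zero {n : ℕ} (x : E n) : cylInc n x 0 = 0 := rfl

theorem cylInc_succ {n : ℕ} (x : E n) (i : Fin n) : cylInc n x i.succ = x i := rfl

theorem cylProj_apply {n : ℕ} (x : E (n + 1)) (i : Fin n) : cylProj n x i = x i.succ := rfl

@[simp]
theorem cyl_zero {n : ℕ} (t : ℝ) (x : E n) : cyl t x 0 = t := by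
  simp [cyl, cylVec, cylInc_zero]

@[simp]
theorem cyl_succ {n : ℕ} (t : ℝ) (x : E n) (i : Fin n) : cyl t x i.succ = x i := by
  simp [cyl, cylVec, cylInc_succ]

@[simp]
theorem cylProj_cyl {n : ℕ} (t : ℝ) (x : E n) : cylProj n (cyl t x) = x :=
  PiLp.ext fun i => by rw [cylProj_apply, cyl_succ]

theorem cyl_cylProj {n : ℕ} (z : E (n + 1)) : cyl (z 0) (cylProj n z) = z :=
  PiLp.ext fun i => by refine Fin.cases ?_ (fun j => ?_) i <;> simp [cylProj_apply]

@[simp]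
theorem cylProj_cylVec (n : ℕ) : cylProj n (cylVec n) = 0 :=
  PiLp.ext fun i => by simp [cylProj_apply, cylVec]

@[simp]
theorem cylProj_cylInc {n : ℕ} (x : E n) : cylProj n (cylInc n x) = x :=
  PiLp.ext fun _ => rfl

theorem contDiff_cyl {n : ℕ} : ContDiff ℝ ∞ fun z : ℝ × E n => cyl z.1 z.2 := by
  unfold cyl; fun_prop

theorem contDiff_cyl_right {n : ℕ} (t : ℝ) : ContDiff ℝ ∞ fun x : E n => cyl t x := by
  unfold cyl; fun_prop

theorem hasFDerivAt_cyl_right {n : ℕ} (t : ℝ) (x : E n) :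
    HasFDerivAt (fun x : E n => cyl t x) (cylInc n) x :=
  (cylInc n).hasFDerivAt.const_add _

/-- The map `id × f` of cylinders. -/
noncomputable def cylMap {m n : ℕ} (f : E m → E n) (z : E (m + 1)) : E (n + 1) :=
  cyl (z 0) (f (cylProj m z))

theorem cylMap_cyl {m n : ℕ} (f : E m → E n) (t : ℝ) (x : E m) :
    cylMap f (cyl t x) = cyl t (f x) := by
  simp [cylMap]

theorem cylMap_contDiff {m n : ℕ} {f : E m → E n} (hf : ContDiff ℝ ∞ f) :
    ContDiff ℝ ∞ (cylMap f) :=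
  contDiff_cyl.comp (ContDiff.prodMk (by fun_prop) (hf.comp (cylProj m).contDiff))

theorem fderiv_cylMap {m n : ℕ} {f : E m → E n} (hf : ContDiff ℝ ∞ f) (t : ℝ) (x : E m)
    (w : E (m + 1)) :
    fderiv ℝ (cylMap f) (cyl t x) w = w 0 • cylVec n + cylInc n (fderiv ℝ f x (cylProj m w)) := by
  have h0 : HasFDerivAt (fun z : E (m + 1) => z 0)
      (EuclideanSpace.proj (𝕜 := ℝ) 0 : E (m + 1) →L[ℝ] ℝ) (cyl t x) :=
    (EuclideanSpace.proj (𝕜 := ℝ) 0 : E (m + 1) →L[ℝ] ℝ).hasFDerivAt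
  have h1 : HasFDerivAt f (fderiv ℝ f x) (cylProj m (cyl t x)) := by
    rw [cylProj_cyl]
    exact (hf.differentiable (by simp) x).hasFDerivAt
  have h2 := (h0.smul_const (cylVec n)).add
    ((cylInc n).hasFDerivAt.comp (cyl t x) (h1.comp (cyl t x) (cylProj m).hasFDerivAt))
  rw [show fderiv ℝ (cylMap f) (cyl t x) = _ from h2.fderiv]
  rfl

/-- Contraction of a form on the cylinder with `∂/∂t`, restricted to the slices. -/
noncomputable def cylContr (n p : ℕ) :
    (E (n + 1) [⋀^Fin (p + 1)]→L[ℝ] ℝ) →L[ℝ] (E n [⋀^Fin p]→L[ℝ] ℝ) :=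
  (ContinuousAlternatingMap.compContinuousLinearMapCLM (cylInc n)).comp
    ((ContinuousLinearMap.apply ℝ _ (cylVec n)).comp
      ContinuousAlternatingMap.curryLeftLI.toContinuousLinearMap)

theorem cylContr_apply {n p : ℕ} (w : E (n + 1) [⋀^Fin (p + 1)]→L[ℝ] ℝ) (v : Fin p → E n) :
    cylContr n p w v = w (Fin.cons (cylVec n) (cylInc n ∘ v)) := rfl

/-- The derivative of `id × f` fixes `∂/∂t` and acts by `df` on vectors tangent to the slices.
Contraction with `∂/∂t` therefore commutes with pullback, which makes the homotopy operator produce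
natural families. -/
theorem cylContr_comp {m n p : ℕ} {f : E m → E n} (hf : ContDiff ℝ ∞ f) (t : ℝ) (x : E m)
    (w : E (n + 1) [⋀^Fin (p + 1)]→L[ℝ] ℝ) :
    cylContr m p (w.compContinuousLinearMap (fderiv ℝ (cylMap f) (cyl t x)))
      = (cylContr n p w).compContinuousLinearMap (fderiv ℝ f x) := by
  ext v
  rw [cylContr_apply, ContinuousAlternatingMap.compContinuousLinearMap_apply,
    ContinuousAlternatingMap.compContinuousLinearMap_apply, cylContr_apply]
  congr 1
  funext i
  refine Fin.cases ?_ (fun j => ?_) i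
  · simp only [Function.comp_apply, Fin.cons_zero, fderiv_cylMap hf, cylProj_cylVec, map_zero,
      add_zero]
    simp [cylVec]
  · simp only [Function.comp_apply, Fin.cons_succ, fderiv_cylMap hf]
    simp [cylInc_zero]

end Cylinder

/-- A smooth homotopy `ℝ × Y → Y`. -/
structure DHomotopy (Y : Type u) [DiffeologicalSpace Y] where
  toFun : ℝ → Y → Y
  isPlot : ∀ {n : ℕ} {σ : E n → Y}, IsPlot σ →
    IsPlot fun z : E (n + 1) => toFun (z 0) (σ (cylProj n z))

/-! ### The homotopy formula for smooth homotopies -/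

namespace DHomotopy

variable {Y : Type u} [DiffeologicalSpace Y] (Φ : DHomotopy Y)

/-- The cylinder `(t, x) ↦ Φ(t, σ(x))` over a plot. -/
noncomputable def cylPlot {n : ℕ} (σ : Plot Y n) : Plot Y (n + 1) :=
  ⟨fun z => Φ.toFun (z 0) (σ.1 (cylProj n z)), Φ.isPlot σ.2⟩

theorem cylPlot_comp {m n : ℕ} (σ : Plot Y n) {f : E m → E n} (hf : ContDiff ℝ ∞ f) :
    Φ.cylPlot (σ.comp f hf) = (Φ.cylPlot σ).comp (cylMap f) (cylMap_contDiff hf) :=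
  Subtype.ext (funext fun z => by simp [cylPlot, Plot.comp, cylMap])

theorem dSmooth (t : ℝ) : DSmooth (Φ.toFun t) := by
  intro n σ hσ
  have h := isPlot_reparam (Φ.isPlot hσ) (contDiff_cyl_right (n := n) t)
  simpa [Function.comp_def] using h

theorem cylPlot_slice {n : ℕ} (σ : Plot Y n) (t : ℝ) :
    (⟨Φ.toFun t ∘ σ.1, Φ.dSmooth t n σ.1 σ.2⟩ : Plot Y n)
      = (Φ.cylPlot σ).comp (cyl t) (contDiff_cyl_right t) :=
  Subtype.ext (funext fun x => by simp [cylPlot, Plot.comp])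

variable {p : ℕ}

theorem contDiff_integrand (τ : Form Y (p + 1)) {n : ℕ} (σ : Plot Y n) :
    ContDiff ℝ ∞ fun z : ℝ × E n =>
      cylContr n p (τ.1 (n + 1) (Φ.cylPlot σ) (cyl z.1 z.2)) :=
  (cylContr n p).contDiff.comp ((τ.smooth _).comp contDiff_cyl)

theorem continuous_integrand (τ : Form Y (p + 1)) {n : ℕ} (σ : Plot Y n) (x : E n) :
    Continuous fun t : ℝ => cylContr n p (τ.1 (n + 1) (Φ.cylPlot σ) (cyl t x)) := by
  have h : Continuous fun t : ℝ => ((t, x) : ℝ × E n) := by fun_prop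
  exact (cylContr n p).continuous.comp
    ((τ.smooth (Φ.cylPlot σ)).continuous.comp (contDiff_cyl.continuous.comp h))

/-- The homotopy operator: integration over the fibres of the cylinder. -/
noncomputable def op (p : ℕ) : Form Y (p + 1) →ₗ[ℝ] Form Y p where
  toFun τ := Form.mk (fun n σ x =>
      ∫ t in (0 : ℝ)..1, cylContr n p (τ.1 (n + 1) (Φ.cylPlot σ) (cyl t x))) <| by
    refine ⟨fun n σ => contDiff_parametric_integral (Φ.contDiff_integrand τ σ),
      fun m n σ f hf x => ?_⟩
    beta_reduce
    -- Pullback by the fixed linear map `fderiv ℝ f x` is continuous and linear, so it moves under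
    -- the integral. For each `t` the integrands then agree by naturality of `τ` along `id × f`.
    rw [← ContinuousAlternatingMap.compContinuousLinearMapCLM_apply,
      ← ContinuousLinearMap.intervalIntegral_comp_comm _
        ((Φ.continuous_integrand τ σ (f x)).intervalIntegrable 0 1)]
    congr 1
    funext t
    rw [cylPlot_comp, τ.natural, cylContr_comp hf, cylMap_cyl]
    rfl
  map_add' τ η := Form.ext fun n σ x => by
    refine Eq.trans ?_ (intervalIntegral.integral_add
      ((Φ.continuous_integrand τ σ x).intervalIntegrable 0 1)
      ((Φ.continuous_integrand η σ x).intervalIntegrable 0 1))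
    congr 1
  map_smul' c τ := Form.ext fun n σ x => by
    refine Eq.trans ?_ (intervalIntegral.integral_smul c
      fun t => cylContr n p (τ.1 (n + 1) (Φ.cylPlot σ) (cyl t x)))
    congr 1

theorem op_apply (τ : Form Y (p + 1)) {n : ℕ} (σ : Plot Y n) (x : E n) (v : Fin p → E n) :
    (Φ.op p τ).1 n σ x v
      = ∫ t in (0 : ℝ)..1, τ.1 (n + 1) (Φ.cylPlot σ) (cyl t x)
          (Fin.cons (cylVec n) (cylInc n ∘ v)) :=
  (ContinuousLinearMap.intervalIntegral_comp_comm
    (ContinuousAlternatingMap.apply ℝ (E n) ℝ v)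
    ((Φ.continuous_integrand τ σ x).intervalIntegrable 0 1)).symm

/-- The plot at time `t` is the cylinder reparametrized by `x ↦ (t, x)`, whose derivative is `cylInc
n`. Both end terms of the homotopy formula can thus be read off from one form on the cylinder. -/
theorem slice_apply (τ : Form Y p) {n : ℕ} (σ : Plot Y n) (t : ℝ) (x : E n) (v : Fin p → E n) :
    (Form.pullback (Φ.toFun t) (Φ.dSmooth t) p τ).1 n σ x v
      = τ.1 (n + 1) (Φ.cylPlot σ) (cyl t x) (cylInc n ∘ v) := by
  change τ.1 n ⟨Φ.toFun t ∘ σ.1, Φ.dSmooth t n σ.1 σ.2⟩ x v = _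
  rw [cylPlot_slice, τ.natural, (hasFDerivAt_cyl_right t x).fderiv]
  rfl

/-- The fundamental theorem of calculus along the fibres of the cylinder. -/
theorem integral_fderiv_cylVec (τ : Form Y p) {n : ℕ} (σ : Plot Y n) (x : E n) (v : Fin p → E n) :
    ∫ t in (0 : ℝ)..1, fderiv ℝ (τ.1 (n + 1) (Φ.cylPlot σ)) (cyl t x) (cylVec n) (cylInc n ∘ v)
      = (Form.pullback (Φ.toFun 1) (Φ.dSmooth 1) p τ).1 n σ x v
        - (Form.pullback (Φ.toFun 0) (Φ.dSmooth 0) p τ).1 n σ x v := by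
  rw [slice_apply, slice_apply]
  have hτ := τ.smooth (Φ.cylPlot σ)
  refine intervalIntegral.integral_eq_sub_of_hasDerivAt
    (f := fun t => τ.1 (n + 1) (Φ.cylPlot σ) (cyl t x) (cylInc n ∘ v)) (fun t _ => ?_) ?_
  · have h1 : HasDerivAt (fun t : ℝ => cyl t x) (cylVec n) t := by
      simpa [cyl] using ((hasDerivAt_id t).smul_const (cylVec n)).add_const (cylInc n x)
    have h2 := ((hτ.differentiable (by simp) (cyl t x)).hasFDerivAt.comp_hasDerivAt t h1)
    exact (ContinuousAlternatingMap.apply ℝ (E (n + 1)) ℝ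
      (cylInc n ∘ v)).hasFDerivAt.comp_hasDerivAt t h2
  · refine Continuous.intervalIntegrable ?_ _ _
    have h1 : Continuous fun t : ℝ => fderiv ℝ (τ.1 (n + 1) (Φ.cylPlot σ)) (cyl t x) (cylVec n) :=
      ((hτ.continuous_fderiv (by simp)).comp
        (contDiff_cyl.continuous.comp (by fun_prop : Continuous fun t : ℝ => (t, x)))).clm_apply
        continuous_const
    exact (ContinuousAlternatingMap.apply ℝ (E (n + 1)) ℝ (cylInc n ∘ v)).continuous.comp h1

theorem continuous_fderiv_apply (τ : Form Y p) {n : ℕ} (σ : Plot Y n) (x : E n) (w : E (n + 1))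
    (v : Fin p → E (n + 1)) :
    Continuous fun t : ℝ => fderiv ℝ (τ.1 (n + 1) (Φ.cylPlot σ)) (cyl t x) w v :=
  (ContinuousAlternatingMap.apply ℝ (E (n + 1)) ℝ v).continuous.comp
    ((((τ.smooth (Φ.cylPlot σ)).continuous_fderiv (by simp)).comp
      (contDiff_cyl.continuous.comp (by fun_prop : Continuous fun t : ℝ => (t, x)))).clm_apply
      continuous_const)

/-- Differentiation under the integral sign: moving `x` in direction `w` moves the point of the
cylinder in the slice direction `cylInc n w`. -/
theorem fderiv_op_apply (τ : Form Y (p + 1)) {n : ℕ} (σ : Plot Y n) (x w : E n)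
    (v : Fin p → E n) :
    fderiv ℝ ((Φ.op p τ).1 n σ) x w v
      = ∫ t in (0 : ℝ)..1, fderiv ℝ (τ.1 (n + 1) (Φ.cylPlot σ)) (cyl t x) (cylInc n w)
          (Fin.cons (cylVec n) (cylInc n ∘ v)) := by
  have hg := Φ.contDiff_integrand τ σ
  have h := (hasFDerivAt_parametric_integral hg x).fderiv
  have hc : Continuous fun t : ℝ => (fderiv ℝ (fun z : ℝ × E n =>
      cylContr n p (τ.1 (n + 1) (Φ.cylPlot σ) (cyl z.1 z.2))) (t, x)).comp
        (ContinuousLinearMap.inr ℝ ℝ (E n)) :=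
    ((hg.continuous_fderiv (by simp)).comp
      (by fun_prop : Continuous fun t : ℝ => (t, x))).clm_comp continuous_const
  rw [show fderiv ℝ ((Φ.op p τ).1 n σ) x = _ from h,
    ContinuousLinearMap.intervalIntegral_apply (hc.intervalIntegrable 0 1)]
  have hc' : Continuous fun t : ℝ => ((fderiv ℝ (fun z : ℝ × E n =>
      cylContr n p (τ.1 (n + 1) (Φ.cylPlot σ) (cyl z.1 z.2))) (t, x)).comp
        (ContinuousLinearMap.inr ℝ ℝ (E n))) w := hc.clm_apply continuous_const
  refine (ContinuousLinearMap.intervalIntegral_comp_comm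
    (ContinuousAlternatingMap.apply ℝ (E n) ℝ v) (hc'.intervalIntegrable 0 1)).symm.trans ?_
  congr 1
  funext t
  -- The same derivative is computed as a restriction of the joint derivative in `(t, x)` and by the
  -- chain rule through the cylinder; uniqueness equates the two.
  have h1 : HasFDerivAt (fun y : E n => cylContr n p (τ.1 (n + 1) (Φ.cylPlot σ) (cyl t y)))
      ((fderiv ℝ (fun z : ℝ × E n =>
        cylContr n p (τ.1 (n + 1) (Φ.cylPlot σ) (cyl z.1 z.2))) (t, x)).comp
          (ContinuousLinearMap.inr ℝ ℝ (E n))) x :=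
    ((hg.differentiable (by simp) (t, x)).hasFDerivAt).comp x (hasFDerivAt_prodMk_right t x)
  have h2 : HasFDerivAt (fun y : E n => cylContr n p (τ.1 (n + 1) (Φ.cylPlot σ) (cyl t y)))
      ((cylContr n p).comp ((fderiv ℝ (τ.1 (n + 1) (Φ.cylPlot σ)) (cyl t x)).comp (cylInc n))) x :=
    (cylContr n p).hasFDerivAt.comp x
      ((((τ.smooth (Φ.cylPlot σ)).differentiable (by simp) (cyl t x)).hasFDerivAt).comp x
        (hasFDerivAt_cyl_right t x))
  rw [h1.unique h2]
  rfl

theorem neg_one_pow_zsmul (k : ℕ) (r : ℝ) : (-1 : ℤ) ^ k • r = (-1 : ℝ) ^ k * r := by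
  simp [zsmul_eq_mul]

theorem removeNth_succ_cons {α : Type*} {n : ℕ} (i : Fin (n + 1)) (a : α) (v : Fin (n + 1) → α) :
    i.succ.removeNth (Fin.cons a v : Fin (n + 2) → α) = Fin.cons a (i.removeNth v) := by
  funext j
  refine Fin.cases ?_ (fun j => ?_) j <;> simp [Fin.removeNth]

/-- The homotopy formula in degree `0`. -/
theorem op_d_zero (τ : Form Y 0) :
    Φ.op 0 (Form.d 0 τ) = Form.pullback (Φ.toFun 1) (Φ.dSmooth 1) 0 τ
      - Form.pullback (Φ.toFun 0) (Φ.dSmooth 0) 0 τ := by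
  refine Form.ext fun n σ x => ?_
  ext v
  rw [op_apply]
  refine Eq.trans ?_ (Φ.integral_fderiv_cylVec τ σ x v)
  congr 1
  funext t
  change extDeriv (τ.1 (n + 1) (Φ.cylPlot σ)) (cyl t x) _ = _
  rw [extDeriv, ContinuousAlternatingMap.alternatizeUncurryFin_apply]
  -- For a `0`-form the only term of the exterior derivative is the one along `∂/∂t`.
  rw [Fin.sum_univ_succ, Finset.univ_eq_empty, Finset.sum_empty, add_zero]
  simp only [Fin.val_zero, pow_zero, one_smul, Fin.cons_zero, Fin.removeNth_zero, Fin.tail_cons]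

/-- The homotopy formula in positive degrees. -/
theorem op_d_add_d_op (τ : Form Y (p + 1)) :
    Φ.op (p + 1) (Form.d (p + 1) τ) + Form.d p (Φ.op p τ)
      = Form.pullback (Φ.toFun 1) (Φ.dSmooth 1) (p + 1) τ
        - Form.pullback (Φ.toFun 0) (Φ.dSmooth 0) (p + 1) τ := by
  refine Form.ext fun n σ x => ?_
  ext v
  have e1 : (Form.d p (Φ.op p τ)).1 n σ x v = ∑ i : Fin (p + 1), (-1 : ℝ) ^ (i : ℕ) *
      ∫ t in (0 : ℝ)..1, fderiv ℝ (τ.1 (n + 1) (Φ.cylPlot σ)) (cyl t x) (cylInc n (v i))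
          (Fin.cons (cylVec n) (cylInc n ∘ i.removeNth v)) := by
    change extDeriv ((Φ.op p τ).1 n σ) x v = _
    rw [extDeriv, ContinuousAlternatingMap.alternatizeUncurryFin_apply]
    refine Finset.sum_congr rfl fun i _ => ?_
    rw [fderiv_op_apply, neg_one_pow_zsmul]
  -- In `dτ` evaluated on `(∂/∂t, v)`, the term of index `0` differentiates along `∂/∂t` and
  -- integrates to the difference of the ends. The term of index `i + 1` has the sign opposite to
  -- term `i` of `e1`, so the rest cancels.
  have e2 : (Φ.op (p + 1) (Form.d (p + 1) τ)).1 n σ x v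
      = (∫ t in (0 : ℝ)..1,
          fderiv ℝ (τ.1 (n + 1) (Φ.cylPlot σ)) (cyl t x) (cylVec n) (cylInc n ∘ v))
        + ∑ i : Fin (p + 1), (-1 : ℝ) ^ ((i : ℕ) + 1) *
      ∫ t in (0 : ℝ)..1, fderiv ℝ (τ.1 (n + 1) (Φ.cylPlot σ)) (cyl t x) (cylInc n (v i))
          (Fin.cons (cylVec n) (cylInc n ∘ i.removeNth v)) := by
    rw [op_apply]
    have hcont : ∀ i : Fin (p + 1), Continuous fun t : ℝ => (-1 : ℝ) ^ ((i : ℕ) + 1) *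
        fderiv ℝ (τ.1 (n + 1) (Φ.cylPlot σ)) (cyl t x) (cylInc n (v i))
          (Fin.cons (cylVec n) (cylInc n ∘ i.removeNth v)) := fun i =>
      (Φ.continuous_fderiv_apply τ σ x _ _).const_mul _
    simp only [← intervalIntegral.integral_const_mul]
    rw [← intervalIntegral.integral_finsetSum (fun i _ => (hcont i).intervalIntegrable 0 1),
      ← intervalIntegral.integral_add
        ((Φ.continuous_fderiv_apply τ σ x _ _).intervalIntegrable 0 1)
        ((continuous_finsetSum _ fun i _ => hcont i).intervalIntegrable 0 1)]
    congr 1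
    funext t
    change extDeriv (τ.1 (n + 1) (Φ.cylPlot σ)) (cyl t x) _ = _
    rw [extDeriv, ContinuousAlternatingMap.alternatizeUncurryFin_apply, Fin.sum_univ_succ]
    simp only [Fin.val_zero, pow_zero, one_smul, Fin.cons_zero, Fin.removeNth_zero, Fin.tail_cons]
    congr 1
    refine Finset.sum_congr rfl fun i _ => ?_
    rw [neg_one_pow_zsmul, Fin.val_succ, Fin.cons_succ, removeNth_succ_cons]
    rfl
  change (Φ.op (p + 1) (Form.d (p + 1) τ)).1 n σ x v + (Form.d p (Φ.op p τ)).1 n σ x v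
    = (Form.pullback (Φ.toFun 1) (Φ.dSmooth 1) (p + 1) τ).1 n σ x v
        - (Form.pullback (Φ.toFun 0) (Φ.dSmooth 0) (p + 1) τ).1 n σ x v
  rw [← Φ.integral_fderiv_cylVec, e1, e2, add_assoc, ← Finset.sum_add_distrib]
  conv_rhs => rw [← add_zero (∫ t in (0 : ℝ)..1, _)]
  congr 1
  exact Finset.sum_eq_zero fun i _ => by rw [pow_succ]; ring

/-- Homotopy operators are natural. -/
theorem pullback_op {Z : Type*} [DiffeologicalSpace Z] (Ψ : DHomotopy Z) (g : Y → Z)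
    (hg : DSmooth g) (h : ∀ t y, g (Φ.toFun t y) = Ψ.toFun t (g y)) (τ : Form Z (p + 1)) :
    Form.pullback g hg p (Ψ.op p τ) = Φ.op p (Form.pullback g hg (p + 1) τ) := by
  refine Form.ext fun n σ x => ?_
  change (∫ t in (0 : ℝ)..1, cylContr n p
      (τ.1 (n + 1) (Ψ.cylPlot ⟨g ∘ σ.1, hg n σ.1 σ.2⟩) (cyl t x)))
    = ∫ t in (0 : ℝ)..1, cylContr n p
      (τ.1 (n + 1) ⟨g ∘ (Φ.cylPlot σ).1, hg _ _ (Φ.cylPlot σ).2⟩ (cyl t x))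
  have : Ψ.cylPlot ⟨g ∘ σ.1, hg n σ.1 σ.2⟩
      = ⟨g ∘ (Φ.cylPlot σ).1, hg _ _ (Φ.cylPlot σ).2⟩ :=
    Subtype.ext (funext fun z => (h _ _).symm)
  rw [this]

end DHomotopy

/-! ### Pullback of forms along constant and identity maps -/

namespace Form

variable {Y : Type u} [DiffeologicalSpace Y]

/-- The value of a `0`-form at a point. -/
noncomputable def evalAt (y : Y) : Form Y 0 →ₗ[ℝ] ℝ where
  toFun τ := τ.1 0 ⟨fun _ => y, isPlot_const⟩ 0 Fin.elim0
  map_add' _ _ := rfl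
  map_smul' _ _ := rfl

/-- A constant plot factors through `ℝ⁰`, so naturality reduces the form to a single number, its
value at `y`. -/
theorem pullback_const_zero {f : Y → Y} (hf : DSmooth f) (y : Y) (h : ∀ x, f x = y)
    (τ : Form Y 0) : pullback f hf 0 τ = evalAt y τ • one := by
  refine Form.ext fun n σ x => ?_
  have e : (⟨f ∘ σ.1, hf n σ.1 σ.2⟩ : Plot Y n)
      = Plot.comp ⟨fun _ => y, isPlot_const⟩ (fun _ => (0 : E 0)) contDiff_const :=
    Subtype.ext (funext fun z => h _)
  change τ.1 n ⟨f ∘ σ.1, hf n σ.1 σ.2⟩ x = evalAt y τ • oneForm (E n)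
  rw [e, τ.natural]
  ext v
  rw [ContinuousAlternatingMap.compContinuousLinearMap_apply]
  rw [ContinuousAlternatingMap.smul_apply, show oneForm (E n) v = 1 from rfl, smul_eq_mul, mul_one]
  exact congrArg (τ.1 0 ⟨fun _ => y, isPlot_const⟩ 0) (funext fun i => i.elim0)

/-- After factoring through `ℝ⁰` every vector argument becomes zero, and in positive degree there is
at least one argument. -/
theorem pullback_const_succ {f : Y → Y} (hf : DSmooth f) (y : Y) (h : ∀ x, f x = y) {p : ℕ}
    (τ : Form Y (p + 1)) : pullback f hf (p + 1) τ = 0 := by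
  refine Form.ext fun n σ x => ?_
  have e : (⟨f ∘ σ.1, hf n σ.1 σ.2⟩ : Plot Y n)
      = Plot.comp ⟨fun _ => y, isPlot_const⟩ (fun _ => (0 : E 0)) contDiff_const :=
    Subtype.ext (funext fun z => h _)
  change τ.1 n ⟨f ∘ σ.1, hf n σ.1 σ.2⟩ x = 0
  rw [e, τ.natural]
  ext v
  rw [ContinuousAlternatingMap.compContinuousLinearMap_apply]
  exact ContinuousAlternatingMap.map_coord_zero _ 0 (by simp)

theorem pullback_id {f : Y → Y} (hf : DSmooth f) (h : ∀ x, f x = x) {p : ℕ} (τ : Form Y p) :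
    pullback f hf p τ = τ := by
  refine Form.ext fun n σ x => ?_
  change τ.1 n ⟨f ∘ σ.1, hf n σ.1 σ.2⟩ x = τ.1 n σ x
  rw [show (⟨f ∘ σ.1, hf n σ.1 σ.2⟩ : Plot Y n) = σ from Subtype.ext (funext fun z => h _)]

end Form

/-- A smooth contraction of `Y` to the point `y`. -/
structure DContraction (Y : Type u) [DiffeologicalSpace Y] (y : Y) extends DHomotopy Y where
  at_zero : ∀ x, toFun 0 x = y
  at_one : ∀ x, toFun 1 x = x

namespace DContraction

variable {Y : Type u} [DiffeologicalSpace Y] {y : Y} (Φ : DContraction Y y)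

/-- The homotopy is the identity at `t = 1` and constant at `t = 0`, so the end terms are `τ` and
its value at `y`; in positive degree the second one disappears. -/
theorem op_d_zero (τ : Form Y 0) :
    Φ.op 0 (Form.d 0 τ) = τ - Form.evalAt y τ • Form.one := by
  rw [Φ.toDHomotopy.op_d_zero, Form.pullback_id _ Φ.at_one,
    Form.pullback_const_zero _ y Φ.at_zero]

theorem op_d_add_d_op {p : ℕ} (τ : Form Y (p + 1)) :
    Φ.op (p + 1) (Form.d (p + 1) τ) + Form.d p (Φ.op p τ) = τ := by
  rw [Φ.toDHomotopy.op_d_add_d_op, Form.pullback_id _ Φ.at_one,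
    Form.pullback_const_succ _ y Φ.at_zero, sub_zero]

end DContraction

end DeRham

namespace DeRham

open scoped ContDiff

universe u

open Diffeology

/-! ### Cochain complexes and quasi-isomorphisms -/

/-- A sequence of real vector spaces and linear maps `C⁰ → C¹ → C² → …`. -/
structure Cx where
  C : ℕ → Type u
  [grp : ∀ p, AddCommGroup (C p)]
  [mod : ∀ p, Module ℝ (C p)]
  d : ∀ p, C p →ₗ[ℝ] C (p + 1)

attribute [instance] Cx.grp Cx.mod

namespace Cx

/-- Coboundaries. -/
def B (A : Cx.{u}) : ∀ p : ℕ, Submodule ℝ (A.C p)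
  | 0 => ⊥
  | p + 1 => LinearMap.range (A.d p)

/-- A family of linear maps is bijective on cohomology. -/
def QuasiIso (A B : Cx.{u}) (f : ∀ p, A.C p →ₗ[ℝ] B.C p) : Prop :=
  ∀ p, (∀ a : A.C p, A.d p a = 0 → f p a ∈ B.B p → a ∈ A.B p) ∧
    ∀ b : B.C p, B.d p b = 0 → ∃ a : A.C p, A.d p a = 0 ∧ b - f p a ∈ B.B p

/-- Two cochain maps that are inverse to each other up to coboundaries are quasi-isomorphisms. -/
theorem QuasiIso.of_inverse {A B : Cx.{u}} {f : ∀ p, A.C p →ₗ[ℝ] B.C p}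
    {g : ∀ p, B.C p →ₗ[ℝ] A.C p} (hg : ∀ p b, g (p + 1) (B.d p b) = A.d p (g p b))
    (hgf : ∀ p a, A.d p a = 0 → a - g p (f p a) ∈ A.B p)
    (hfg : ∀ p b, B.d p b = 0 → b - f p (g p b) ∈ B.B p) : QuasiIso A B f := by
  refine fun p => ⟨fun a ha hfa => ?_, fun b hb => ⟨g p b, ?_, hfg p b hb⟩⟩
  -- As `g` commutes with the differentials, it sends the coboundary `f a` to a coboundary, and `a`
  -- differs from `g (f a)` by another one.
  · have h1 : g p (f p a) ∈ A.B p := by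
      cases p with
      | zero =>
        have : f 0 a = 0 := hfa
        rw [this, map_zero]
        exact zero_mem _
      | succ p =>
        obtain ⟨c, hc⟩ := hfa
        exact ⟨g p c, by rw [← hc, hg]⟩
    simpa using add_mem (hgf p a ha) h1
  · rw [← hg, hb, map_zero]

end Cx

/-! ### Acyclic models -/

/-- A presheaf of cochain complexes on the category of the spaces `ℝⁿ` and smooth maps. -/
structure LocCx where
  C : ℕ → ℕ → Type
  [grp : ∀ n p, AddCommGroup (C n p)]
  [mod : ∀ n p, Module ℝ (C n p)]
  d : ∀ n p, C n p →ₗ[ℝ] C n (p + 1)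
  d_d : ∀ n p z, d n (p + 1) (d n p z) = 0
  pull : ∀ {m n : ℕ} (f : E m → E n), ContDiff ℝ ∞ f → ∀ p, C n p →ₗ[ℝ] C m p
  pull_comp : ∀ {l m n : ℕ} (f : E l → E m) (hf : ContDiff ℝ ∞ f) (g : E m → E n)
    (hg : ContDiff ℝ ∞ g) (p : ℕ) (z : C n p),
    pull f hf p (pull g hg p z) = pull (g ∘ f) (hg.comp hf) p z
  pull_d : ∀ {m n : ℕ} (f : E m → E n) (hf : ContDiff ℝ ∞ f) (p : ℕ) (z : C n p),
    pull f hf (p + 1) (d n p z) = d m p (pull f hf p z)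

attribute [instance] LocCx.grp LocCx.mod

/-- The identity plot of `ℝⁿ`. -/
def idPlot (n : ℕ) : Plot (E n) n := ⟨id, isPlot_id⟩

namespace LocCx

/-- A contraction of each of the complexes `C n` to the constants (not natural in `n`). -/
structure Contr (L : LocCx) where
  k : ∀ n p, L.C n (p + 1) →ₗ[ℝ] L.C n p
  one : ∀ n, L.C n 0
  d_one : ∀ n, L.d n 0 (one n) = 0
  k_d : ∀ n p z, k n (p + 1) (L.d n (p + 1) z) + L.d n p (k n p z) = z
  k_d_zero : ∀ n (z : L.C n 0), ∃ r : ℝ, k n 0 (L.d n 0 z) = z - r • one n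

/-- The presheaves `C p` are natural retracts of the presheaves of functions on plots of dimension
`dim p`. -/
structure Cofree (L : LocCx) where
  dim : ℕ → ℕ
  ev : ∀ n p, L.C n p →ₗ[ℝ] (Plot (E n) (dim p) → ℝ)
  rho : ∀ n p, (Plot (E n) (dim p) → ℝ) →ₗ[ℝ] L.C n p
  rho_ev : ∀ n p z, rho n p (ev n p z) = z
  ev_pull : ∀ {m n : ℕ} (f : E m → E n) (hf : ContDiff ℝ ∞ f) (p : ℕ) (z : L.C n p)
    (t : Plot (E m) (dim p)), ev m p (L.pull f hf p z) t = ev n p z ⟨f ∘ t.1, hf.dSmooth _ _ t.2⟩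
  pull_rho : ∀ {m n : ℕ} (f : E m → E n) (hf : ContDiff ℝ ∞ f) (p : ℕ)
    (u : Plot (E n) (dim p) → ℝ),
    L.pull f hf p (rho n p u) = rho m p fun t => u ⟨f ∘ t.1, hf.dSmooth _ _ t.2⟩

/-- A natural family of linear maps `L n p → G n m`, indexed by the plots `ℝⁿ → X`. -/
structure NatMap (X : Type u) [DiffeologicalSpace X] (L G : LocCx) (p m : ℕ) where
  f : ∀ {n : ℕ}, Plot X n → (L.C n p →ₗ[ℝ] G.C n m)
  nat : ∀ {l n : ℕ} (σ : Plot X n) (g : E l → E n) (hg : ContDiff ℝ ∞ g) (z : L.C n p),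
    G.pull g hg m (f σ z) = f (σ.comp g hg) (L.pull g hg p z)

namespace NatMap

variable {X : Type u} [DiffeologicalSpace X] {L G M : LocCx} {p q m : ℕ}

/-- The identity. -/
def id (L : LocCx) (p : ℕ) : NatMap X L L p p where
  f _ := LinearMap.id
  nat _ _ _ _ := rfl

/-- Composition of natural families. -/
def comp (ψ : NatMap X G M q m) (φ : NatMap X L G p q) : NatMap X L M p m where
  f σ := ψ.f σ ∘ₗ φ.f σ
  nat σ g hg z := by
    rw [LinearMap.comp_apply, ψ.nat, φ.nat]; rfl

/-- Difference of natural families. -/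
def sub (φ ψ : NatMap X L G p m) : NatMap X L G p m where
  f σ := φ.f σ - ψ.f σ
  nat σ g hg z := by
    rw [LinearMap.sub_apply, map_sub, φ.nat, ψ.nat]; rfl

/-- The differential of the target as a natural family. -/
def d (G : LocCx) (m : ℕ) : NatMap X G G m (m + 1) where
  f _ := G.d _ m
  nat _ g hg z := G.pull_d g hg m z

/-- Precomposition with a contraction of the source. -/
noncomputable def ext (c : L.Contr) (e : G.Cofree) (φ : NatMap X L G p m) :
    NatMap X L G (p + 1) m where
  -- The contraction is not natural in `n`, so it is applied only on the model space of dimension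
  -- `e.dim m`. For each plot `t` from the model, the argument is pulled back along `t`, contracted
  -- there, sent through `φ` for the plot `σ ∘ t`, and evaluated at the identity plot. `rho` turns
  -- this function of `t` into a section, and naturality holds by construction.
  f {n} σ := e.rho n m ∘ₗ LinearMap.pi fun t : Plot (E n) (e.dim m) =>
    LinearMap.proj (idPlot (e.dim m)) ∘ₗ e.ev (e.dim m) m ∘ₗ
      φ.f (σ.comp t.1 t.2.contDiff) ∘ₗ c.k (e.dim m) p ∘ₗ L.pull t.1 t.2.contDiff (p + 1)
  nat {l n} σ g hg z := by
    simp only [LinearMap.comp_apply]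
    rw [e.pull_rho]
    congr 1
    funext t
    simp only [LinearMap.pi_apply, LinearMap.comp_apply]
    rw [L.pull_comp]
    rfl

/-- If `k ∘ d` does not affect `φ`, then `ext c e φ` extends `φ` along `d`. On each model the
differential passes through the pullback, `k ∘ d` is dropped by `h`, and naturality of `φ` together
with `ev_pull` recovers `ev` of `φ z` at `t`. -/
theorem ext_d (c : L.Contr) (e : G.Cofree) (φ : NatMap X L G p m)
    (h : ∀ {n : ℕ} (σ : Plot X n) (w : L.C n p), φ.f σ (c.k n p (L.d n p w)) = φ.f σ w)
    {n : ℕ} (σ : Plot X n) (z : L.C n p) : (ext c e φ).f σ (L.d n p z) = φ.f σ z := by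
  conv_rhs => rw [← e.rho_ev n m (φ.f σ z)]
  simp only [ext, LinearMap.comp_apply]
  congr 1
  funext t
  simp only [LinearMap.pi_apply, LinearMap.comp_apply]
  rw [L.pull_d, h, ← φ.nat, LinearMap.proj_apply, e.ev_pull]
  rfl

/-- A natural cochain map is determined up to homotopy by its values on constants: a natural
cochain map that vanishes on constants is null-homotopic. -/
theorem exists_homotopy (c : L.Contr) (e : G.Cofree) (φ : ∀ p, NatMap X L G p p)
    (hφ : ∀ (p : ℕ) {n : ℕ} (σ : Plot X n) (z : L.C n p),
      (φ (p + 1)).f σ (L.d n p z) = G.d n p ((φ p).f σ z))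
    (h0 : ∀ {n : ℕ} (σ : Plot X n), (φ 0).f σ (c.one n) = 0) :
    ∃ H : ∀ p, NatMap X L G (p + 1) p,
      (∀ {n : ℕ} (σ : Plot X n) (z : L.C n 0), (H 0).f σ (L.d n 0 z) = (φ 0).f σ z) ∧
      ∀ (p : ℕ) {n : ℕ} (σ : Plot X n) (z : L.C n (p + 1)),
        (H (p + 1)).f σ (L.d n (p + 1) z) = (φ (p + 1)).f σ z - G.d n p ((H p).f σ z) := by
  -- `H 0` extends `φ 0` along `d`, and `H (p + 1)` extends the remaining error `φ (p + 1) - d ∘ H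
  -- p`.
  let H : ∀ p, NatMap X L G (p + 1) p := fun p => Nat.rec (motive := fun p => NatMap X L G (p + 1) p)
    (ext c e (φ 0)) (fun p h => ext c e ((φ (p + 1)).sub ((d G p).comp h))) p
  have hH0 : ∀ {n : ℕ} (σ : Plot X n) (z : L.C n 0), (H 0).f σ (L.d n 0 z) = (φ 0).f σ z := by
    intro n σ z
    refine ext_d c e (φ 0) (fun {n} σ w => ?_) σ z
    -- In degree `0`, `k ∘ d` changes `w` by a multiple of the constant, which `φ 0` kills.
    obtain ⟨r, hr⟩ := c.k_d_zero n w
    rw [hr, map_sub, map_smul, h0, smul_zero, sub_zero]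
  have key : ∀ (p : ℕ) {n : ℕ} (σ : Plot X n) (w : L.C n p),
      G.d n p ((H p).f σ (L.d n p w)) = G.d n p ((φ p).f σ w) →
      ((φ (p + 1)).sub ((d G p).comp (H p))).f σ (L.d n p w) = 0 := by
    intro p n σ w h
    change (φ (p + 1)).f σ (L.d n p w) - G.d n p ((H p).f σ (L.d n p w)) = 0
    rw [hφ, h, sub_self]
  -- An error term that vanishes on coboundaries is unaffected by `k ∘ d`, because `w = k (d w) + d
  -- (k w)`. So `ext_d` applies, and `key` supplies the vanishing inductively.
  have step : ∀ p : ℕ,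
      (∀ {n : ℕ} (σ : Plot X n) (w : L.C n p),
        ((φ (p + 1)).sub ((d G p).comp (H p))).f σ (L.d n p w) = 0) →
      ∀ {n : ℕ} (σ : Plot X n) (z : L.C n (p + 1)),
        (H (p + 1)).f σ (L.d n (p + 1) z) = (φ (p + 1)).f σ z - G.d n p ((H p).f σ z) := by
    intro p h n σ z
    refine ext_d c e ((φ (p + 1)).sub ((d G p).comp (H p))) (fun {n} σ w => ?_) σ z
    conv_rhs => rw [← c.k_d n p w]
    rw [map_add, h, add_zero]
  refine ⟨H, hH0, fun p => ?_⟩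
  induction p with
  | zero =>
    exact step 0 fun σ w => key 0 σ w (by rw [hH0])
  | succ p ih =>
    exact step (p + 1) fun σ w => key (p + 1) σ w (by rw [ih, map_sub, G.d_d, sub_zero])

/-- A natural map in degree `0` that respects constants extends to a natural cochain map. -/
theorem exists_map (c : L.Contr) (e : G.Cofree) (φ : NatMap X L G 0 0)
    (h0 : ∀ {n : ℕ} (σ : Plot X n), G.d n 0 (φ.f σ (c.one n)) = 0) :
    ∃ g : ∀ p, NatMap X L G p p, g 0 = φ ∧
      ∀ (p : ℕ) {n : ℕ} (σ : Plot X n) (z : L.C n p),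
        (g (p + 1)).f σ (L.d n p z) = G.d n p ((g p).f σ z) := by
  -- Each `g (p + 1)` extends `d ∘ g p` along the differential of `L`.
  let g : ∀ p, NatMap X L G p p := fun p => Nat.rec (motive := fun p => NatMap X L G p p)
    φ (fun p h => ext c e ((d G p).comp h)) p
  refine ⟨g, rfl, fun p => ?_⟩
  induction p with
  | zero =>
    intro n σ z
    refine ext_d c e ((d G 0).comp φ) (fun {n} σ w => ?_) σ z
    obtain ⟨r, hr⟩ := c.k_d_zero n w
    rw [hr, map_sub, map_smul, show ((d G 0).comp φ).f σ (c.one n) = 0 from h0 σ, smul_zero,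
      sub_zero]
  | succ p ih =>
    intro n σ z
    refine ext_d c e ((d G (p + 1)).comp (g (p + 1))) (fun {n} σ w => ?_) σ z
    conv_rhs => rw [← c.k_d n p w]
    rw [map_add]
    -- On the coboundary part of `w` the map is `d ∘ d ∘ g p = 0`, so `k ∘ d` may be inserted
    -- freely.
    have : ((d G (p + 1)).comp (g (p + 1))).f σ (L.d n p (c.k n p w)) = 0 := by
      change G.d n (p + 1) ((g (p + 1)).f σ (L.d n p (c.k n p w))) = 0
      rw [ih, G.d_d]
    rw [this, add_zero]

end NatMap

/-! ### Global sections -/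

/-- A complex of vector spaces over `X` restricting along plots to a presheaf of complexes. -/
structure Glob (L : LocCx) (X : Type u) [DiffeologicalSpace X] extends Cx.{u} where
  res : ∀ {n : ℕ} (_ : Plot X n) (p : ℕ), C p →ₗ[ℝ] L.C n p
  res_d : ∀ {n : ℕ} (σ : Plot X n) (p : ℕ) (z : C p), res σ (p + 1) (d p z) = L.d n p (res σ p z)
  pull_res : ∀ {m n : ℕ} (σ : Plot X n) (f : E m → E n) (hf : ContDiff ℝ ∞ f) (p : ℕ) (z : C p),
    L.pull f hf p (res σ p z) = res (σ.comp f hf) p z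

/-- The elements of the complex are exactly the compatible families of local sections. -/
structure Glob.IsSheaf {L : LocCx} {X : Type u} [DiffeologicalSpace X] (A : Glob L X) : Prop where
  sep : ∀ {p : ℕ} {z w : A.C p}, (∀ {n : ℕ} (σ : Plot X n), A.res σ p z = A.res σ p w) → z = w
  glue : ∀ {p : ℕ} (s : ∀ {n : ℕ}, Plot X n → L.C n p),
    (∀ {m n : ℕ} (σ : Plot X n) (f : E m → E n) (hf : ContDiff ℝ ∞ f),
      L.pull f hf p (s σ) = s (σ.comp f hf)) →
    ∃ z : A.C p, ∀ {n : ℕ} (σ : Plot X n), A.res σ p z = s σ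

namespace Glob

variable {X : Type u} [DiffeologicalSpace X] {L G : LocCx} {A : Glob.{u} L X} {B : Glob.{u} G X}
  {p m : ℕ}

/-- A natural family of maps induces a map on global sections. -/
theorem exists_map (hB : B.IsSheaf) (φ : NatMap X L G p m) :
    ∃ F : A.C p →ₗ[ℝ] B.C m, ∀ (z : A.C p) {n : ℕ} (σ : Plot X n),
      B.res σ m (F z) = φ.f σ (A.res σ p z) := by
  -- Naturality of `φ` is exactly the gluing condition for its values on the restrictions of `z`.
  -- The glued element is unique, which gives linearity.
  have h : ∀ z : A.C p, ∃ w : B.C m, ∀ {n : ℕ} (σ : Plot X n),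
      B.res σ m w = φ.f σ (A.res σ p z) := fun z =>
    hB.glue (fun σ => φ.f σ (A.res σ p z)) fun σ f hf => by rw [φ.nat, A.pull_res]
  choose F hF using h
  refine ⟨{ toFun := F, map_add' := fun z w => hB.sep fun σ => ?_,
            map_smul' := fun r z => hB.sep fun σ => ?_ }, fun z n σ => hF z σ⟩
  · rw [map_add, hF, hF, hF, map_add, map_add]
  · rw [RingHom.id_apply, map_smul, hF, hF, map_smul, map_smul]

/-- On cocycles, a natural cochain map vanishing on constants takes values in coboundaries. -/
theorem mem_B_of_natural (hB : B.IsSheaf) (c : L.Contr) (e : G.Cofree)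
    (φ : ∀ p, NatMap X L G p p)
    (hφ : ∀ (p : ℕ) {n : ℕ} (σ : Plot X n) (z : L.C n p),
      (φ (p + 1)).f σ (L.d n p z) = G.d n p ((φ p).f σ z))
    (h0 : ∀ {n : ℕ} (σ : Plot X n), (φ 0).f σ (c.one n) = 0)
    {p : ℕ} {a : A.C p} (ha : A.d p a = 0) {b : B.C p}
    (hb : ∀ {n : ℕ} (σ : Plot X n), B.res σ p b = (φ p).f σ (A.res σ p a)) : b ∈ B.B p := by
  obtain ⟨H, hH0, hH⟩ := NatMap.exists_homotopy c e φ hφ h0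
  have hz : ∀ {n : ℕ} (σ : Plot X n), L.d n p (A.res σ p a) = 0 := fun σ => by
    rw [← A.res_d, ha, map_zero]
  cases p with
  | zero =>
    change b = 0
    refine hB.sep fun σ => ?_
    rw [hb, ← hH0, hz, map_zero, map_zero]
  | succ p =>
    -- The local homotopies glue to a map on global sections. Since `d a = 0`, the homotopy identity
    -- on each plot reduces to `b = d (F a)`.
    obtain ⟨F, hF⟩ := exists_map (A := A) hB (H p)
    refine ⟨F a, hB.sep fun σ => ?_⟩
    have h := hH p σ (A.res σ (p + 1) a)
    rw [hz, map_zero] at h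
    rw [B.res_d, hF, hb]
    exact (sub_eq_zero.1 h.symm).symm

/-- Two presheaves of complexes that are contractible and cofree have quasi-isomorphic complexes
of global sections. -/
theorem exists_quasiIso (hA : A.IsSheaf) (hB : B.IsSheaf) (cL : L.Contr) (eL : L.Cofree)
    (cG : G.Contr) (eG : G.Cofree) (dL : eL.dim 0 = 0) (dG : eG.dim 0 = 0)
    (oneL : ∀ n t, eL.ev n 0 (cL.one n) t = 1) (oneG : ∀ n t, eG.ev n 0 (cG.one n) t = 1) :
    ∃ (g : ∀ p, NatMap X L G p p) (F : ∀ p, A.C p →ₗ[ℝ] B.C p),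
      (∀ (p : ℕ) {n : ℕ} (σ : Plot X n) (z : L.C n p),
        (g (p + 1)).f σ (L.d n p z) = G.d n p ((g p).f σ z)) ∧
      (∀ {n : ℕ} (σ : Plot X n), (g 0).f σ (cL.one n) = cG.one n) ∧
      (∀ (p : ℕ) (z : A.C p) {n : ℕ} (σ : Plot X n),
        B.res σ p (F p z) = (g p).f σ (A.res σ p z)) ∧
      Cx.QuasiIso A.toCx B.toCx F := by
  -- the natural map in degree `0` that is the identity on functions of points
  have deg0 : ∀ {L G : LocCx} (cL : L.Contr) (eL : L.Cofree) (cG : G.Contr) (eG : G.Cofree),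
      eL.dim 0 = 0 → eG.dim 0 = 0 → (∀ n t, eL.ev n 0 (cL.one n) t = 1) →
      (∀ n t, eG.ev n 0 (cG.one n) t = 1) → ∃ g : ∀ p, NatMap X L G p p,
      (∀ {n : ℕ} (σ : Plot X n), (g 0).f σ (cL.one n) = cG.one n) ∧
      ∀ (p : ℕ) {n : ℕ} (σ : Plot X n) (z : L.C n p),
        (g (p + 1)).f σ (L.d n p z) = G.d n p ((g p).f σ z) := by
    intro L G cL eL cG eG dL dG oneL oneG
    -- Both kinds of plots are points, but the two dimensions are only propositionally equal, so
    -- plots are converted by relabelling coordinates.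
    have dLG : eG.dim 0 = eL.dim 0 := dG.trans dL.symm
    let conv : ∀ n, Plot (E n) (eG.dim 0) → Plot (E n) (eL.dim 0) := fun n t =>
      ⟨fun x => t.1 (WithLp.toLp 2 fun i => x (Fin.cast dLG i)),
        isPlot_reparam t.2 (f := fun x : E (eL.dim 0) =>
          (WithLp.toLp 2 fun i => x (Fin.cast dLG i) : E (eG.dim 0)))
          (contDiff_euclidean.2 fun i => by fun_prop)⟩
    let tr : ∀ n, (Plot (E n) (eL.dim 0) → ℝ) →ₗ[ℝ] (Plot (E n) (eG.dim 0) → ℝ) := fun n =>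
      LinearMap.funLeft ℝ ℝ (conv n)
    let φ : NatMap X L G 0 0 :=
      { f := fun {n} _ => eG.rho n 0 ∘ₗ tr n ∘ₗ eL.ev n 0
        nat := fun {l n} σ g hg z => by
          simp only [LinearMap.comp_apply]
          rw [eG.pull_rho]
          congr 1
          funext t
          exact (eL.ev_pull g hg 0 z (conv l t)).symm }
    have h1 : ∀ {n : ℕ} (σ : Plot X n), φ.f σ (cL.one n) = cG.one n := by
      intro n σ
      rw [← eG.rho_ev n 0 (cG.one n)]
      change eG.rho n 0 _ = _
      congr 1
      funext t
      exact (oneL n _).trans (oneG n _).symm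
    obtain ⟨g, hg0, hg⟩ := NatMap.exists_map cL eG φ (fun σ => by rw [h1, cG.d_one])
    exact ⟨g, fun σ => by rw [hg0, h1], hg⟩
  -- composites are homotopic to the identity
  have hom : ∀ {L G : LocCx} {A : Glob.{u} L X} {B : Glob.{u} G X} (_ : A.IsSheaf)
      (_ : B.IsSheaf) (cL : L.Contr) (eL : L.Cofree) (cG : G.Contr)
      (g : ∀ p, NatMap X L G p p) (g' : ∀ p, NatMap X G L p p)
      (F : ∀ p, A.C p →ₗ[ℝ] B.C p) (F' : ∀ p, B.C p →ₗ[ℝ] A.C p),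
      (∀ {n : ℕ} (σ : Plot X n), (g 0).f σ (cL.one n) = cG.one n) →
      (∀ {n : ℕ} (σ : Plot X n), (g' 0).f σ (cG.one n) = cL.one n) →
      (∀ (p : ℕ) {n : ℕ} (σ : Plot X n) (z : L.C n p),
        (g (p + 1)).f σ (L.d n p z) = G.d n p ((g p).f σ z)) →
      (∀ (p : ℕ) {n : ℕ} (σ : Plot X n) (z : G.C n p),
        (g' (p + 1)).f σ (G.d n p z) = L.d n p ((g' p).f σ z)) →
      (∀ (p : ℕ) (z : A.C p) {n : ℕ} (σ : Plot X n),
        B.res σ p (F p z) = (g p).f σ (A.res σ p z)) →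
      (∀ (p : ℕ) (z : B.C p) {n : ℕ} (σ : Plot X n),
        A.res σ p (F' p z) = (g' p).f σ (B.res σ p z)) →
      ∀ p a, A.d p a = 0 → a - F' p (F p a) ∈ A.B p := by
    intro L G A B hA hB cL eL cG g g' F F' g1 g1' hg hg' hF hF' p a ha
    -- The natural cochain map `id - g' ∘ g` kills constants, because `g` and `g'` exchange the two
    -- constant sections.
    refine mem_B_of_natural (A := A) hA cL eL
      (fun p => (NatMap.id L p).sub ((g' p).comp (g p))) (fun p n σ z => ?_) (fun σ => ?_) ha
      (fun σ => ?_)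
    · change L.d n p z - (g' (p + 1)).f σ ((g (p + 1)).f σ (L.d n p z))
        = L.d n p (z - (g' p).f σ ((g p).f σ z))
      rw [hg, hg', map_sub]
    · change cL.one _ - (g' 0).f σ ((g 0).f σ (cL.one _)) = 0
      rw [g1, g1', sub_self]
    · change _ = A.res σ p a - (g' p).f σ ((g p).f σ (A.res σ p a))
      rw [map_sub, hF', hF]
  obtain ⟨g, g1, hg⟩ := deg0 cL eL cG eG dL dG oneL oneG
  obtain ⟨g', g1', hg'⟩ := deg0 cG eG cL eL dG dL oneG oneL
  choose F hF using fun p => exists_map (A := A) hB (g p)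
  choose F' hF' using fun p => exists_map (A := B) hA (g' p)
  refine ⟨g, F, hg, g1, hF, Cx.QuasiIso.of_inverse (g := F') (fun p b => hA.sep fun σ => ?_)
    (hom hA hB cL eL cG g g' F F' g1 g1' hg hg' hF hF')
    (hom hB hA cG eG cL g' g F' F g1' g1 hg' hg hF' hF)⟩
  rw [hF', B.res_d, hg', A.res_d, hF']

end Glob

/-! ### Shifted complexes -/

/-- The complex `C^q → C^{q+1} → …`. -/
def shift (G : LocCx) (q : ℕ) : LocCx where
  C n p := G.C n (q + p)
  d n p := G.d n (q + p)
  d_d n p z := G.d_d n (q + p) z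
  pull f hf p := G.pull f hf (q + p)
  pull_comp f hf g hg p z := G.pull_comp f hf g hg (q + p) z
  pull_d f hf p z := G.pull_d f hf (q + p) z

/-- Shifts of cofree complexes are cofree. -/
def Cofree.shift {G : LocCx} (e : G.Cofree) (q : ℕ) : (G.shift q).Cofree where
  dim p := e.dim (q + p)
  ev n p := e.ev n (q + p)
  rho n p := e.rho n (q + p)
  rho_ev n p z := e.rho_ev n (q + p) z
  ev_pull f hf p z t := e.ev_pull f hf (q + p) z t
  pull_rho f hf p u := e.pull_rho f hf (q + p) u

/-- Shifts of complexes of global sections. -/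
def Glob.shift {G : LocCx} {X : Type u} [DiffeologicalSpace X] (A : Glob G X) (q : ℕ) :
    Glob (G.shift q) X where
  C p := A.C (q + p)
  d p := A.d (q + p)
  res σ p := A.res σ (q + p)
  res_d σ p z := A.res_d σ (q + p) z
  pull_res σ f hf p z := A.pull_res σ f hf (q + p) z

theorem Glob.IsSheaf.shift {G : LocCx} {X : Type u} [DiffeologicalSpace X] {A : Glob G X}
    (hA : A.IsSheaf) (q : ℕ) : (A.shift q).IsSheaf where
  sep h := hA.sep h
  glue s h := hA.glue s h

/-- The shift has no differential into its degree `0`, so its only coboundary there is zero; in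
higher degrees the coboundaries coincide. -/
theorem Glob.mem_B_of_mem_shift_B {G : LocCx} {X : Type u} [DiffeologicalSpace X] {A : Glob G X}
    {q : ℕ} : ∀ {p : ℕ} {a : A.C (q + p)}, a ∈ (A.shift q).B p → a ∈ A.B (q + p)
  | 0, a, h => by
    have h' : a = 0 := h
    rw [h']
    exact zero_mem _
  | _ + 1, _, h => h

end LocCx

end DeRham

namespace DeRham

universe u v

/-! ### Double complexes with contractible rows and columns -/

/-- A double complex with anticommuting differentials `d` and `δ`, both of which are contracted:
the `d`-direction by `h` to the complex `B`, the `δ`-direction by `c` to the complex `A`. -/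
structure DoubleCx where
  D : ℕ → ℕ → Type u
  [grp : ∀ p q, AddCommGroup (D p q)]
  [mod : ∀ p q, Module ℝ (D p q)]
  A : Cx.{u}
  B : Cx.{u}
  d : ∀ p q, D p q →ₗ[ℝ] D (p + 1) q
  δ : ∀ p q, D p q →ₗ[ℝ] D p (q + 1)
  d_δ : ∀ p q x, d p (q + 1) (δ p q x) = - δ (p + 1) q (d p q x)
  d_d : ∀ p q x, d (p + 1) q (d p q x) = 0
  δ_δ : ∀ p q x, δ p (q + 1) (δ p q x) = 0
  h : ∀ p q, D (p + 1) q →ₗ[ℝ] D p q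
  c : ∀ p q, D p (q + 1) →ₗ[ℝ] D p q
  h_d : ∀ p q x, h (p + 1) q (d (p + 1) q x) + d p q (h p q x) = x
  c_δ : ∀ p q x, c p (q + 1) (δ p (q + 1) x) + δ p q (c p q x) = x
  iA : ∀ p, A.C p →ₗ[ℝ] D p 0
  eA : ∀ p, D p 0 →ₗ[ℝ] A.C p
  eA_iA : ∀ p a, eA p (iA p a) = a
  c_δ_zero : ∀ p x, c p 0 (δ p 0 x) = x - iA p (eA p x)
  δ_iA : ∀ p a, δ p 0 (iA p a) = 0
  d_iA : ∀ p a, d p 0 (iA p a) = iA (p + 1) (A.d p a)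
  iB : ∀ q, B.C q →ₗ[ℝ] D 0 q
  eB : ∀ q, D 0 q →ₗ[ℝ] B.C q
  eB_iB : ∀ q b, eB q (iB q b) = b
  h_d_zero : ∀ q x, h 0 q (d 0 q x) = x - iB q (eB q x)
  d_iB : ∀ q b, d 0 q (iB q b) = 0
  δ_iB : ∀ q b, δ 0 q (iB q b) = iB (q + 1) (B.d q b)

attribute [instance] DoubleCx.grp DoubleCx.mod

namespace DoubleCx

variable (K : DoubleCx.{u})

/-- The double complex with the two directions exchanged. -/
def transpose : DoubleCx.{u} where
  D p q := K.D q p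
  A := K.B
  B := K.A
  d p q := K.δ q p
  δ p q := K.d q p
  d_δ p q x := by rw [K.d_δ, neg_neg]
  d_d p q x := K.δ_δ q p x
  δ_δ p q x := K.d_d q p x
  h p q := K.c q p
  c p q := K.h q p
  h_d p q x := K.c_δ q p x
  c_δ p q x := K.h_d q p x
  iA := K.iB
  eA := K.eB
  eA_iA := K.eB_iB
  c_δ_zero := K.h_d_zero
  δ_iA := K.d_iB
  d_iA := K.δ_iB
  iB := K.iA
  eB := K.eA
  eB_iB := K.eA_iA
  h_d_zero := K.c_δ_zero
  d_iB := K.δ_iA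
  δ_iB := K.d_iA

/-- The projection of the total complex to `B`, given by `eB (-δ h)ᵖ` on `D p q`. -/
def toB : ∀ (p q n : ℕ), p + q = n → (K.D p q →ₗ[ℝ] K.B.C n)
  | 0, q, n, e => by
    rw [Nat.zero_add] at e
    subst e
    exact K.eB q
  | p + 1, q, n, e => - (toB p (q + 1) n (by omega) ∘ₗ K.δ p q ∘ₗ K.h p q)

theorem toB_zero (q : ℕ) (e : 0 + q = q) : K.toB 0 q q e = K.eB q := rfl

theorem toB_succ (p q n : ℕ) (e : p + 1 + q = n) (x : K.D (p + 1) q) :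
    K.toB (p + 1) q n e x = - K.toB p (q + 1) n (by omega) (K.δ p q (K.h p q x)) := rfl

/-- The projection to `B` is a cochain map on the total complex. -/
theorem toB_d_add_toB_δ (p : ℕ) : ∀ (q n : ℕ) (e : p + q = n) (x : K.D p q),
    K.toB (p + 1) q (n + 1) (by omega) (K.d p q x) + K.toB p (q + 1) (n + 1) (by omega) (K.δ p q x)
      = K.B.d n (K.toB p q n e x) := by
  induction p with
  | zero =>
    intro q n e x
    obtain rfl : q = n := by omega
    rw [toB_succ, K.h_d_zero, map_sub, K.δ_iB, toB_zero, toB_zero, map_sub, K.eB_iB]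
    abel
  | succ p ih =>
    intro q n e x
    -- Replacing `h d x` by `x - d h x` and anticommuting `δ` past `d` leaves a `d`-term of `δ h x`.
    -- The induction hypothesis evaluates it, because `δ δ h x = 0`.
    have h1 : K.h (p + 1) q (K.d (p + 1) q x) = x - K.d p q (K.h p q x) :=
      eq_sub_of_add_eq (K.h_d p q x)
    have h2 : K.δ (p + 1) q (K.d p q (K.h p q x)) = - K.d p (q + 1) (K.δ p q (K.h p q x)) := by
      rw [K.d_δ, neg_neg]
    have h3 := ih (q + 1) n (by omega) (K.δ p q (K.h p q x))
    rw [K.δ_δ, map_zero, add_zero] at h3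
    rw [toB_succ, h1, map_sub, h2, toB_succ K p q n, map_neg, ← h3, map_sub, map_neg]
    abel

/-- The projection of the total complex to `A`. -/
def toA (p q n : ℕ) (e : p + q = n) : K.D p q →ₗ[ℝ] K.A.C n :=
  K.transpose.toB q p n (by omega)

/-- This is the statement for `B` read in the transposed double complex, with the two summands
exchanged. -/
theorem toA_d_add_toA_δ (p q n : ℕ) (e : p + q = n) (x : K.D p q) :
    K.toA (p + 1) q (n + 1) (by omega) (K.d p q x) + K.toA p (q + 1) (n + 1) (by omega) (K.δ p q x)
      = K.A.d n (K.toA p q n e x) := by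
  exact (add_comm _ _).trans (K.transpose.toB_d_add_toB_δ q p n (by omega) x)

theorem toA_iA (p : ℕ) (a : K.A.C p) : K.toA p 0 p rfl (K.iA p a) = a := K.eA_iA p a

/-- The class of an element that is a cocycle in both directions does not change when the element
is moved to `B`. -/
theorem toA_sub_toA_toB_mem (p : ℕ) : ∀ (q n : ℕ) (e : p + q = n) (x : K.D p q),
    K.d p q x = 0 → K.δ p q x = 0 →
    K.toA p q n e x - K.toA 0 n n (by omega) (K.iB n (K.toB p q n e x)) ∈ K.A.B n := by
  induction p with
  | zero =>
    intro q n e x hd hδ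
    obtain rfl : q = n := by omega
    have h := K.h_d_zero q x
    rw [hd, map_zero] at h
    rw [toB_zero, ← sub_eq_zero.1 h.symm, sub_self]
    exact zero_mem _
  | succ p ih =>
    intro q n e x hd hδ
    obtain ⟨n, rfl⟩ : ∃ k, n = k + 1 := ⟨p + q, by omega⟩
    -- Since `x = d (h x)`, the elements `x` and `-δ (h x)` differ by the total differential of `h
    -- x`, which `toA` sends to a coboundary. The element `-δ (h x)` is again closed in both
    -- directions, has the same image under `toB`, and has first degree smaller by one.
    have h1 : K.d p q (K.h p q x) = x := by
      have := K.h_d p q x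
      rwa [hd, map_zero, zero_add] at this
    have h2 := K.toA_d_add_toA_δ p q n (by omega) (K.h p q x)
    rw [h1] at h2
    have h3 := ih (q + 1) (n + 1) (by omega) (- K.δ p q (K.h p q x))
      (by rw [map_neg, K.d_δ, h1, hδ, neg_zero, neg_zero]) (by rw [map_neg, K.δ_δ, neg_zero])
    have h4 : K.toB p (q + 1) (n + 1) (by omega) (- K.δ p q (K.h p q x))
        = K.toB (p + 1) q (n + 1) e x := by
      rw [map_neg, toB_succ]
    rw [h4, map_neg] at h3
    have h5 : K.A.d n (K.toA p q n (by omega) (K.h p q x)) ∈ K.A.B (n + 1) := ⟨_, rfl⟩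
    rw [← h2] at h5
    convert add_mem h5 h3 using 1
    abel

/-- The comparison map `A → B`. -/
def comparison (p : ℕ) : K.A.C p →ₗ[ℝ] K.B.C p := K.toB p 0 p rfl ∘ₗ K.iA p

theorem comparison_d (p : ℕ) (a : K.A.C p) :
    K.comparison (p + 1) (K.A.d p a) = K.B.d p (K.comparison p a) := by
  have h := K.toB_d_add_toB_δ p 0 p rfl (K.iA p a)
  rw [K.δ_iA, map_zero, add_zero, K.d_iA] at h
  exact h

/-- The comparison map is a quasi-isomorphism. -/
theorem quasiIso_comparison : Cx.QuasiIso K.A K.B K.comparison := by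
  -- The inverse up to coboundaries is the comparison of the transposed complex: `iA a` is closed in
  -- both directions for a cocycle `a`, so moving it to `B` and back keeps its class.
  refine Cx.QuasiIso.of_inverse (g := K.transpose.comparison) K.transpose.comparison_d
    (fun p a ha => ?_) fun p b hb => ?_
  · have h := K.toA_sub_toA_toB_mem p 0 p rfl (K.iA p a)
      (by rw [K.d_iA, ha, map_zero]) (K.δ_iA p a)
    rw [toA_iA] at h
    exact h
  · have h := K.transpose.toA_sub_toA_toB_mem p 0 p rfl (K.iB p b)
      ((K.δ_iB p b).trans (by rw [hb, map_zero]; rfl)) (K.d_iB p b)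
    rw [show K.transpose.toA p 0 p rfl (K.iB p b) = b from K.transpose.toA_iA p b] at h
    exact h

/-- The projection to `B` is natural. -/
theorem toB_natural {K : DoubleCx.{u}} {K' : DoubleCx.{v}}
    (F : ∀ p q, K.D p q →ₗ[ℝ] K'.D p q) (FB : ∀ q, K.B.C q →ₗ[ℝ] K'.B.C q)
    (hδ : ∀ p q x, F p (q + 1) (K.δ p q x) = K'.δ p q (F p q x))
    (hh : ∀ p q x, F p q (K.h p q x) = K'.h p q (F (p + 1) q x))
    (he : ∀ q x, FB q (K.eB q x) = K'.eB q (F 0 q x)) (p : ℕ) :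
    ∀ (q n : ℕ) (e : p + q = n) (x : K.D p q),
      FB n (K.toB p q n e x) = K'.toB p q n e (F p q x) := by
  induction p with
  | zero =>
    intro q n e x
    obtain rfl : q = n := by omega
    exact he q x
  | succ p ih =>
    intro q n e x
    rw [toB_succ, toB_succ, map_neg, ih, hδ, hh]

end DoubleCx

end DeRham

namespace DeRham

open scoped ContDiff

universe u

open Diffeology Equiv

/-! ### Alternating functions of tuples -/

section Tuples

variable {ι : Type*} {V : Type*} [AddCommGroup V] [Module ℝ V]

/-- A function of `k`-tuples is alternating. -/
def IsAlt {k : ℕ} (x : (Fin k → ι) → V) : Prop :=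
  ∀ (π : Perm (Fin k)) (I : Fin k → ι), x (I ∘ π) = ((Perm.sign π : ℤ) : ℝ) • x I

/-- Adjacent transpositions generate the symmetric group, and the sign is multiplicative. -/
theorem isAlt_of_adjacent {k : ℕ} {x : (Fin (k + 1) → ι) → V}
    (h : ∀ (a : Fin k) I, x (I ∘ swap a.castSucc a.succ) = - x I) : IsAlt x := by
  intro π
  have hπ : π ∈ Submonoid.closure (Set.range fun a : Fin k => swap a.castSucc a.succ) := by
    rw [Perm.mclosure_swap_castSucc_succ]
    trivial
  induction hπ using Submonoid.closure_induction with
  | mem π hπ =>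
    obtain ⟨a, rfl⟩ := hπ
    intro I
    rw [h, Perm.sign_swap (Fin.castSucc_lt_succ).ne]
    simp
  | one => intro I; simp
  | mul π ρ _ _ hπ hρ =>
    intro I
    rw [Perm.coe_mul, ← Function.comp_assoc, hρ, hπ, smul_smul, Perm.sign_mul]
    push_cast
    rw [mul_comm]

/-- Swapping two equal entries fixes the tuple and negates the value. -/
theorem IsAlt.eq_zero {k : ℕ} {x : (Fin k → ι) → V} (hx : IsAlt x) {I : Fin k → ι}
    (hI : ¬ Function.Injective I) : x I = 0 := by
  simp only [Function.Injective, not_forall] at hI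
  obtain ⟨a, b, hab, hne⟩ := hI
  have h1 : I ∘ swap a b = I := by
    funext c
    rw [Function.comp_apply, swap_apply_def]
    split_ifs with h h'
    · rw [h, hab]
    · rw [h', hab]
    · rfl
  have h := hx (swap a b) I
  rw [h1, Perm.sign_swap hne] at h
  simp only [Units.val_neg, Units.val_one, Int.cast_neg, Int.cast_one, neg_smul, one_smul] at h
  have h2 : (2 : ℝ) • x I = 0 := by rw [two_smul]; nth_rewrite 1 [h]; simp
  exact (smul_eq_zero.1 h2).resolve_left two_ne_zero

/-- The alternating sum over the omission of an entry of a tuple. -/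
def tupD {k : ℕ} : ((Fin k → ι) → V) →ₗ[ℝ] ((Fin (k + 1) → ι) → V) where
  toFun x I := ∑ j : Fin (k + 1), (-1 : ℝ) ^ (j : ℕ) • x (I ∘ j.succAbove)
  map_add' x y := by
    funext I
    simp only [Pi.add_apply, smul_add, Finset.sum_add_distrib]
  map_smul' r x := by
    funext I
    simp only [Pi.smul_apply, Finset.smul_sum, RingHom.id_apply]
    exact Finset.sum_congr rfl fun j _ => smul_comm _ _ _

theorem tupD_apply {k : ℕ} (x : (Fin k → ι) → V) (I : Fin (k + 1) → ι) :
    tupD x I = ∑ j : Fin (k + 1), (-1 : ℝ) ^ (j : ℕ) • x (I ∘ j.succAbove) := rfl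

theorem cons_comp_succAbove_succ {k : ℕ} (a : ι) (I : Fin (k + 1) → ι) (j : Fin (k + 1)) :
    (Fin.cons a I : Fin (k + 2) → ι) ∘ j.succ.succAbove
      = Fin.cons a (I ∘ j.succAbove) := by
  funext i
  refine Fin.cases ?_ (fun i => ?_) i <;> simp

/-- Omitting the leading entry returns `I`; every other omission keeps `a` and has its sign shifted
by one. This cone formula underlies `d² = 0` and every contraction in the tuple direction, by
barycentric coordinates or by geometric cones. -/
theorem tupD_cons {k : ℕ} (x : (Fin (k + 1) → ι) → V) (a : ι) (I : Fin (k + 1) → ι) :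
    tupD x (Fin.cons a I) = x I - tupD (fun J => x (Fin.cons a J)) I := by
  rw [tupD_apply, Fin.sum_univ_succ, tupD_apply, sub_eq_add_neg, ← Finset.sum_neg_distrib]
  congr 1
  · rw [Fin.val_zero, pow_zero, one_smul]
    congr 1
  · refine Finset.sum_congr rfl fun j _ => ?_
    rw [cons_comp_succAbove_succ, Fin.val_succ, pow_succ, mul_neg_one, neg_smul]

/-- Induction on the length by the cone formula. With `y J = x (a, J)`, the value at `(a, J)` is `D
x J - D (x - D y) J`, which equals `D (D y) J`. -/
theorem tupD_tupD {k : ℕ} (x : (Fin k → ι) → V) : tupD (tupD x) = 0 := by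
  induction k with
  | zero =>
    funext I
    have h : ∀ J : Fin 1 → ι, tupD x J = x Fin.elim0 := fun J => by
      rw [tupD_apply]
      rw [Fin.sum_univ_succ, Fin.sum_univ_zero, add_zero, Fin.val_zero, pow_zero, one_smul]
      exact congrArg x (funext fun i => i.elim0)
    rw [tupD_apply, Fin.sum_univ_two, h, h]
    simp
  | succ k ih =>
    funext I
    obtain ⟨a, J, rfl⟩ : ∃ a J, I = Fin.cons a J := ⟨I 0, Fin.tail I, (Fin.cons_self_tail I).symm⟩
    rw [tupD_cons]
    have h : (fun J => tupD x (Fin.cons a J)) = x - tupD fun J => x (Fin.cons a J) :=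
      funext fun J => tupD_cons x a J
    rw [h, map_sub, ih]
    simp

/-- It suffices to treat adjacent transpositions. The two terms omitting a swapped position are
exchanged, and their signs are opposite because the positions are adjacent. In each other term the
transposition acts on the remaining entries and alternation of `x` gives the sign. -/
theorem IsAlt.tupD {k : ℕ} {x : (Fin (k + 1) → ι) → V} (hx : IsAlt x) :
    IsAlt (DeRham.tupD x) := by
  refine isAlt_of_adjacent fun a I => ?_
  have hne : a.castSucc ≠ a.succ := (Fin.castSucc_lt_succ).ne
  let s := swap a.castSucc a.succ
  have hl : s ∘ a.castSucc.succAbove = a.succ.succAbove := by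
    funext i
    rcases lt_trichotomy i a with h | rfl | h
    · have h1 : a.castSucc.succAbove i = i.castSucc :=
        Fin.succAbove_of_castSucc_lt _ _ (Fin.castSucc_lt_castSucc_iff.2 h)
      have h2 : a.succ.succAbove i = i.castSucc :=
        Fin.succAbove_of_castSucc_lt _ _ (lt_trans (Fin.castSucc_lt_castSucc_iff.2 h)
          Fin.castSucc_lt_succ)
      rw [Function.comp_apply, h1, h2]
      refine swap_apply_of_ne_of_ne (fun h' => h.ne (Fin.castSucc_injective _ h')) (fun h' => ?_)
      exact absurd (congrArg Fin.val h') (by simp; omega)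
    · rw [Function.comp_apply, Fin.succAbove_castSucc_self, Fin.succAbove_succ_self]
      exact swap_apply_right _ _
    · have h1 : a.castSucc.succAbove i = i.succ :=
        Fin.succAbove_of_le_castSucc _ _ (Fin.castSucc_le_castSucc_iff.2 h.le)
      have h2 : a.succ.succAbove i = i.succ :=
        Fin.succAbove_of_le_castSucc _ _ (by rw [Fin.le_def]; simp; omega)
      rw [Function.comp_apply, h1, h2]
      refine swap_apply_of_ne_of_ne (fun h' => ?_) (fun h' => h.ne' (Fin.succ_injective _ h'))
      exact absurd (congrArg Fin.val h') (by simp; omega)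
  have hr : s ∘ a.succ.succAbove = a.castSucc.succAbove := by
    rw [← hl, ← Function.comp_assoc]
    funext i
    simp [s]
  have key : ∀ j : Fin (k + 2), (-1 : ℝ) ^ (j : ℕ) • x ((I ∘ s) ∘ j.succAbove)
      = - ((-1 : ℝ) ^ (s j : ℕ) • x (I ∘ (s j).succAbove)) := by
    intro j
    rw [Function.comp_assoc]
    by_cases h1 : j = a.castSucc
    · subst h1
      rw [hl, show s a.castSucc = a.succ from swap_apply_left _ _, Fin.val_succ, pow_succ]
      simp
    by_cases h2 : j = a.succ
    · subst h2
      rw [hr, show s a.succ = a.castSucc from swap_apply_right _ _, Fin.val_succ, pow_succ]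
      simp
    -- `c` and `b` are the places of the two swapped entries after position `j` has been omitted.
    obtain ⟨c, hc⟩ := Fin.exists_succAbove_eq (Ne.symm h1)
    obtain ⟨b, hb⟩ := Fin.exists_succAbove_eq (Ne.symm h2)
    have hcb : c ≠ b := fun h => hne (by rw [← hc, ← hb, h])
    have h3 : s ∘ j.succAbove = j.succAbove ∘ swap c b := by
      funext i
      rw [Function.comp_apply, Function.comp_apply, (Fin.succAbove_right_injective).map_swap,
        hc, hb]
    rw [h3, ← Function.comp_assoc, hx, show s j = j from swap_apply_of_ne_of_ne h1 h2,
      Perm.sign_swap hcb]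
    simp
  rw [tupD_apply, tupD_apply, Finset.sum_congr rfl fun j _ => key j, Finset.sum_neg_distrib]
  congr 1
  exact Equiv.sum_comp s fun j => (-1 : ℝ) ^ (j : ℕ) • x (I ∘ j.succAbove)

/-- A permutation of the tail extends to the whole tuple by fixing the first entry, without changing
its sign; `decomposeFin.symm (0, π)` is this extension. -/
theorem IsAlt.cons {k : ℕ} {x : (Fin (k + 1) → ι) → V} (hx : IsAlt x) (a : ι) :
    IsAlt fun I : Fin k → ι => x (Fin.cons a I) := by
  intro π I
  have h : (Fin.cons a (I ∘ π) : Fin (k + 1) → ι)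
      = Fin.cons a I ∘ Perm.decomposeFin.symm (0, π) := by
    funext i
    refine Fin.cases ?_ (fun i => ?_) i
    · simp
    · simp [Perm.decomposeFin_symm_apply_succ]
  simp only [h]
  rw [hx, Perm.decomposeFin.symm_sign]
  simp

theorem IsAlt.sum {k : ℕ} {κ : Type*} {s : Finset κ} {x : κ → (Fin k → ι) → V}
    (hx : ∀ i ∈ s, IsAlt (x i)) : IsAlt fun I => ∑ i ∈ s, x i I := by
  intro π I
  simp only [Finset.smul_sum]
  exact Finset.sum_congr rfl fun i hi => hx i hi π I

theorem IsAlt.map {W : Type*} [AddCommGroup W] [Module ℝ W] {k : ℕ} {x : (Fin k → ι) → V}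
    (hx : IsAlt x) (f : V →ₗ[ℝ] W) : IsAlt fun I => f (x I) := by
  intro π I
  simp only [hx π I, map_smul]

/-- Averaging over the entries of the tuple operators that depend on the entry. -/
theorem IsAlt.average {W : Type*} [AddCommGroup W] [Module ℝ W] {k : ℕ} {x : (Fin k → ι) → V}
    (hx : IsAlt x) (r : ℝ) (f : ι → V →ₗ[ℝ] W) : IsAlt fun I => r • ∑ j, f (I j) (x I) := by
  intro π I
  simp only [hx π I, map_smul, ← Finset.smul_sum, Function.comp_apply]
  rw [smul_comm, Equiv.sum_comp π fun j => f (I j) (x I)]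

end Tuples

/-! ### Smooth simplices and families of alternating functions over them -/

/-- The smooth `n`-simplices `𝔸ⁿ → Y`. -/
abbrev Simp (Y : Type u) [DiffeologicalSpace Y] (n : ℕ) : Type u := {s : Aff n → Y // DSmooth s}

/-- The action of maps of vertices on smooth simplices. -/
noncomputable def Simp.comp {Y : Type u} [DiffeologicalSpace Y] {m n : ℕ} (s : Simp Y n)
    (θ : Fin (m + 1) → Fin (n + 1)) : Simp Y m :=
  ⟨s.1 ∘ affMap θ, s.2.comp (affMap_dSmooth θ)⟩

theorem Simp.comp_comp {Y : Type u} [DiffeologicalSpace Y] {l m n : ℕ} (s : Simp Y n)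
    (θ : Fin (m + 1) → Fin (n + 1)) (η : Fin (l + 1) → Fin (m + 1)) :
    (s.comp θ).comp η = s.comp (θ ∘ η) :=
  Subtype.ext (funext fun x => congrArg s.1 (affMap_comp η θ x).symm)

/-- The image of a smooth simplex under a smooth map. -/
def Simp.map {Y : Type u} [DiffeologicalSpace Y] {Z : Type*} [DiffeologicalSpace Z] {n : ℕ}
    (s : Simp Y n) (g : Y → Z) (hg : DSmooth g) : Simp Z n := ⟨g ∘ s.1, hg.comp s.2⟩

/-- A coefficient system on the category of finite ordinals. -/
structure Coeff where
  V : ℕ → Type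
  [grp : ∀ n, AddCommGroup (V n)]
  [mod : ∀ n, Module ℝ (V n)]
  pull : ∀ {m n : ℕ}, (Fin (m + 1) →o Fin (n + 1)) → (V n →ₗ[ℝ] V m)

attribute [instance] Coeff.grp Coeff.mod

/-- The coefficient system `n ↦ Ω^p(𝔸ⁿ)`. -/
noncomputable abbrev formCoeff (p : ℕ) : Coeff where
  V n := Form (Aff n) p
  pull θ := Form.pullback (affMap θ) (affMap_dSmooth θ) p

/-- The constant coefficient system. -/
abbrev realCoeff : Coeff where
  V _ := ℝ
  pull _ := LinearMap.id

/-- Families assigning to a smooth `n`-simplex of `Y` an alternating function of `(q + 1)`-tuples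
of its vertices with values in `V n`, naturally with respect to monotone maps. -/
def famSubmodule (V : Coeff) (Y : Type u) [DiffeologicalSpace Y] (q : ℕ) :
    Submodule ℝ (∀ n : ℕ, Simp Y n → (Fin (q + 1) → Fin (n + 1)) → V.V n) where
  carrier := {f | (∀ n s, IsAlt (f n s)) ∧
    ∀ (m n : ℕ) (θ : Fin (m + 1) →o Fin (n + 1)) (s : Simp Y n) (I : Fin (q + 1) → Fin (m + 1)),
      f m (s.comp θ) I = V.pull θ (f n s (θ ∘ I))}
  zero_mem' := ⟨fun _ _ _ _ => (smul_zero _).symm, fun _ _ _ _ _ => (map_zero _).symm⟩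
  add_mem' {f g} hf hg := ⟨fun n s π I => by
      simp only [Pi.add_apply, hf.1 n s π I, hg.1 n s π I, smul_add],
    fun m n θ s I => by simp only [Pi.add_apply, hf.2, hg.2, map_add]⟩
  smul_mem' r f hf := ⟨fun n s π I => by
      simp only [Pi.smul_apply, hf.1 n s π I]
      exact smul_comm _ _ _,
    fun m n θ s I => by simp only [Pi.smul_apply, hf.2, map_smul]⟩

/-- The space of natural families of alternating functions. -/
def Fam (V : Coeff) (Y : Type u) [DiffeologicalSpace Y] (q : ℕ) : Type u := famSubmodule V Y q

noncomputable instance (V : Coeff) (Y : Type u) [DiffeologicalSpace Y] (q : ℕ) :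
    AddCommGroup (Fam V Y q) :=
  inferInstanceAs (AddCommGroup (famSubmodule V Y q))

noncomputable instance (V : Coeff) (Y : Type u) [DiffeologicalSpace Y] (q : ℕ) :
    Module ℝ (Fam V Y q) :=
  inferInstanceAs (Module ℝ (famSubmodule V Y q))

namespace Fam

variable {V W : Coeff} {Y : Type u} [DiffeologicalSpace Y] {q r : ℕ}

/-- Constructor for families. -/
def mk (f : ∀ n : ℕ, Simp Y n → (Fin (q + 1) → Fin (n + 1)) → V.V n)
    (h : f ∈ famSubmodule V Y q) : Fam V Y q := ⟨f, h⟩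

theorem ext {f g : Fam V Y q} (h : ∀ n s I, f.1 n s I = g.1 n s I) : f = g :=
  Subtype.ext (funext fun n => funext fun s => funext fun I => h n s I)

theorem alt (f : Fam V Y q) {n : ℕ} (s : Simp Y n) : IsAlt (f.1 n s) := f.2.1 n s

theorem nat (f : Fam V Y q) {m n : ℕ} (θ : Fin (m + 1) →o Fin (n + 1)) (s : Simp Y n)
    (I : Fin (q + 1) → Fin (m + 1)) : f.1 m (s.comp θ) I = V.pull θ (f.1 n s (θ ∘ I)) :=
  f.2.2 m n θ s I

/-- Pullback of families along a smooth map. -/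
def pull {Z : Type*} [DiffeologicalSpace Z] (g : Y → Z) (hg : DSmooth g) :
    Fam V Z q →ₗ[ℝ] Fam V Y q where
  toFun f := mk (fun n s => f.1 n (s.map g hg))
    ⟨fun _ _ => f.alt _, fun _ _ θ s I => f.nat θ (s.map g hg) I⟩
  map_add' _ _ := rfl
  map_smul' _ _ := rfl

end Fam

/-- The action of a monotone map on functions of tuples. -/
def tupPull (V : Coeff) {k m n : ℕ} (θ : Fin (m + 1) →o Fin (n + 1))
    (x : (Fin k → Fin (n + 1)) → V.V n) : (Fin k → Fin (m + 1)) → V.V m :=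
  fun I => V.pull θ (x (θ ∘ I))

/-- A natural operator on alternating functions of tuples. -/
structure TupOp (V W : Coeff) (q r : ℕ) where
  T : ∀ n, ((Fin (q + 1) → Fin (n + 1)) → V.V n) →ₗ[ℝ] ((Fin (r + 1) → Fin (n + 1)) → W.V n)
  alt : ∀ {n x}, IsAlt x → IsAlt (T n x)
  nat : ∀ {m n : ℕ} (θ : Fin (m + 1) →o Fin (n + 1)) x,
    tupPull W θ (T n x) = T m (tupPull V θ x)

/-- The operator on families induced by a natural operator on functions of tuples. -/
def TupOp.lift {V W : Coeff} {q r : ℕ} (T : TupOp V W q r) (Y : Type u) [DiffeologicalSpace Y] :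
    Fam V Y q →ₗ[ℝ] Fam W Y r where
  toFun f := Fam.mk (fun n s => T.T n (f.1 n s)) ⟨fun n s => T.alt (f.alt s), fun m n θ s I => by
    have h : f.1 m (s.comp θ) = tupPull V θ (f.1 n s) := funext fun J => f.nat θ s J
    beta_reduce
    rw [h, ← T.nat]
    rfl⟩
  map_add' f g := Fam.ext fun n s I => congrFun ((T.T n).map_add (f.1 n s) (g.1 n s)) I
  map_smul' r f := Fam.ext fun n s I => congrFun ((T.T n).map_smul r (f.1 n s)) I

end DeRham

namespace DeRham

open scoped ContDiff

universe u

open Diffeology Equiv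

/-! ### Vertices, barycentric coordinates and contractions of the affine spaces -/

/-- The vertices of `𝔸ⁿ`. -/
noncomputable def vert {n : ℕ} (i : Fin (n + 1)) : Aff n :=
  ⟨EuclideanSpace.single i 1, by simp⟩

theorem affMap_vert {m n : ℕ} (θ : Fin (m + 1) → Fin (n + 1)) (i : Fin (m + 1)) :
    affMap θ (vert i) = vert (θ i) :=
  Aff.ext fun j => by
    rw [affMap_apply, Finset.sum_eq_single i]
    · by_cases h : θ i = j
      · subst h; simp [vert]
      · simp [vert, h, Ne.symm h]
    · intro k _ hk
      simp [vert, hk]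
    · simp

/-- The contraction `(t, x) ↦ (1 - t) eᵢ + t x` of `𝔸ⁿ` to the vertex `eᵢ`. -/
noncomputable def affContr {n : ℕ} (i : Fin (n + 1)) : DContraction (Aff n) (vert i) where
  toFun t x := ⟨(1 - t) • (vert i).1 + t • x.1, by
    simp only [PiLp.add_apply, PiLp.smul_apply, smul_eq_mul, Finset.sum_add_distrib,
      ← Finset.mul_sum, x.2, (vert i).2]
    ring⟩
  isPlot {k σ} hσ := by
    have hσ' : ContDiff ℝ ∞ fun x => ((σ x).1 : E (n + 1)) := hσ
    change ContDiff ℝ ∞ fun z : E (k + 1) =>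
      (1 - z 0) • (vert i).1 + z 0 • ((σ (cylProj k z)).1 : E (n + 1))
    have h0 : ContDiff ℝ ∞ fun z : E (k + 1) => z 0 := by fun_prop
    exact ((contDiff_const.sub h0).smul contDiff_const).add
      (h0.smul (hσ'.comp (cylProj k).contDiff))
  at_zero x := Subtype.ext (by simp)
  at_one x := Subtype.ext (by simp)

/-- Affine maps send the segment from `x` to a vertex onto the segment between the images. The
homotopy operators attached to vertices are therefore natural. -/
theorem affMap_affContr {m n : ℕ} (θ : Fin (m + 1) → Fin (n + 1)) (i : Fin (m + 1)) (t : ℝ)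
    (x : Aff m) : affMap θ ((affContr i).toFun t x) = (affContr (θ i)).toFun t (affMap θ x) := by
  refine Aff.ext fun j => ?_
  have h := congrArg (fun y : Aff n => y.1 j) (affMap_vert θ i)
  simp only [affMap_apply] at h
  change ∑ k, (if θ k = j then (1 - t) * (vert i).1 k + t * x.1 k else 0)
    = (1 - t) * (vert (θ i)).1 j + t * ∑ k, if θ k = j then x.1 k else 0
  rw [← h, Finset.mul_sum, Finset.mul_sum, ← Finset.sum_add_distrib]
  refine Finset.sum_congr rfl fun k _ => ?_
  split_ifs <;> simp

/-- The barycentric coordinates as `0`-forms. -/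
noncomputable def coordForm {n : ℕ} (i : Fin (n + 1)) : Form (Aff n) 0 :=
  Form.mk (fun k σ x => ((σ.1 x).1 i) • oneForm (E k)) ⟨fun k σ => by
    have hσ : ContDiff ℝ ∞ fun x => ((σ.1 x).1 : E (n + 1)) := σ.2
    rw [contDiff_euclidean] at hσ
    exact (hσ i).smul contDiff_const, fun _ _ _ _ _ _ => rfl⟩

/-- Multiplication by a barycentric coordinate. -/
noncomputable def mulCoord {n : ℕ} (p : ℕ) (i : Fin (n + 1)) : Form (Aff n) p →ₗ[ℝ] Form (Aff n) p :=
  Form.mul (zero_add p) (coordForm i)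

/-- The barycentric coordinates sum to `1` on `𝔸ⁿ`, so they act as an algebraic partition of unity.
-/
theorem sum_mulCoord {n p : ℕ} (τ : Form (Aff n) p) : ∑ i, mulCoord p i τ = τ := by
  have h1 : ∑ i : Fin (n + 1), coordForm i = (Form.one : Form (Aff n) 0) := by
    refine Form.ext fun k σ x => ?_
    have h2 : (∑ i : Fin (n + 1), coordForm i : Form (Aff n) 0).1 k σ x
        = ∑ i : Fin (n + 1), ((σ.1 x).1 i) • oneForm (E k) := by
      have := congrFun (congrFun (congrFun (map_sum (Submodule.subtype (formSubmodule (Aff n) 0))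
        (fun i : Fin (n + 1) => (coordForm i : Form (Aff n) 0)) Finset.univ) k) σ) x
      refine this.trans ?_
      simp only [Finset.sum_apply]
      rfl
    rw [h2, ← Finset.sum_smul, (σ.1 x).2, one_smul]
    rfl
  simp only [mulCoord]
  rw [← LinearMap.sum_apply, ← map_sum, h1]
  exact (Omega (Aff n)).one_mul (zero_add p) τ

/-- Along `θ` the coordinate of the vertex `j` pulls back to the sum of the coordinates of all
vertices in the fibre over `j`. -/
theorem pullback_mulCoord {m n p : ℕ} (θ : Fin (m + 1) → Fin (n + 1)) (j : Fin (n + 1))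
    (τ : Form (Aff n) p) :
    Form.pullback (affMap θ) (affMap_dSmooth θ) p (mulCoord p j τ)
      = ∑ i, if θ i = j then mulCoord p i (Form.pullback (affMap θ) (affMap_dSmooth θ) p τ)
        else 0 := by
  have h1 : Form.pullback (affMap θ) (affMap_dSmooth θ) 0 (coordForm j)
      = ∑ i, if θ i = j then coordForm i else 0 := by
    refine Form.ext fun k σ x => ?_
    have := congrFun (congrFun (congrFun (map_sum (Submodule.subtype (formSubmodule (Aff m) 0))
        (fun i : Fin (m + 1) => (if θ i = j then coordForm i else 0 : Form (Aff m) 0))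
        Finset.univ) k) σ) x
    refine Eq.trans ?_ this.symm
    simp only [Finset.sum_apply]
    change (∑ i, if θ i = j then (σ.1 x).1 i else 0) • oneForm (E k) = _
    rw [Finset.sum_smul]
    refine Finset.sum_congr rfl fun i _ => ?_
    split_ifs
    · rfl
    · exact zero_smul _ _
  have h2 : Form.pullback (affMap θ) (affMap_dSmooth θ) p (mulCoord p j τ)
      = Form.mul (zero_add p) (Form.pullback (affMap θ) (affMap_dSmooth θ) 0 (coordForm j))
        (Form.pullback (affMap θ) (affMap_dSmooth θ) p τ) := rfl
  rw [h2, h1, map_sum, LinearMap.sum_apply]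
  refine Finset.sum_congr rfl fun i _ => ?_
  split_ifs
  · rfl
  · rw [map_zero, LinearMap.zero_apply]

/-! ### The operators of the double complex -/

theorem tupD_map {ι V W : Type*} [AddCommGroup V] [Module ℝ V] [AddCommGroup W] [Module ℝ W]
    {k : ℕ} (f : V →ₗ[ℝ] W) (x : (Fin k → ι) → V) (I : Fin (k + 1) → ι) :
    f (tupD x I) = tupD (fun J => f (x J)) I := by
  simp only [tupD_apply, map_sum, map_smul]

/-- The alternating sum over omissions. -/
def deltaOp (V : Coeff) (q : ℕ) : TupOp V V q (q + 1) where
  T _ := tupD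
  alt hx := hx.tupD
  nat θ x := funext fun I => tupD_map (V.pull θ) x (θ ∘ I)

section Operators

variable {n p q : ℕ}

/-- The exterior derivative, with sign. -/
noncomputable def tupExt (n p q : ℕ) : ((Fin (q + 1) → Fin (n + 1)) → Form (Aff n) p) →ₗ[ℝ]
    ((Fin (q + 1) → Fin (n + 1)) → Form (Aff n) (p + 1)) :=
  LinearMap.pi fun I => (-1 : ℝ) ^ q • Form.d p ∘ₗ LinearMap.proj I

theorem tupExt_apply (x : (Fin (q + 1) → Fin (n + 1)) → Form (Aff n) p)
    (I : Fin (q + 1) → Fin (n + 1)) : tupExt n p q x I = (-1 : ℝ) ^ q • Form.d p (x I) := rfl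

/-- The average of the homotopy operators that contract to the vertices of the tuple. -/
noncomputable def tupHom (n p q : ℕ) : ((Fin (q + 1) → Fin (n + 1)) → Form (Aff n) (p + 1)) →ₗ[ℝ]
    ((Fin (q + 1) → Fin (n + 1)) → Form (Aff n) p) :=
  LinearMap.pi fun I => ((-1 : ℝ) ^ q * (q + 1 : ℝ)⁻¹) •
    (∑ j, (affContr (I j)).op p) ∘ₗ LinearMap.proj I

theorem tupHom_apply (x : (Fin (q + 1) → Fin (n + 1)) → Form (Aff n) (p + 1))
    (I : Fin (q + 1) → Fin (n + 1)) : tupHom n p q x I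
      = ((-1 : ℝ) ^ q * (q + 1 : ℝ)⁻¹) • ∑ j, (affContr (I j)).op p (x I) := by
  rw [← LinearMap.sum_apply]; rfl

/-- The contraction of functions of tuples by the barycentric coordinates. -/
noncomputable def tupBary (n p q : ℕ) : ((Fin (q + 1) → Fin (n + 1)) → Form (Aff n) p) →ₗ[ℝ]
    ((Fin q → Fin (n + 1)) → Form (Aff n) p) :=
  LinearMap.pi fun I => ∑ i, mulCoord p i ∘ₗ LinearMap.proj (Fin.cons i I)

theorem tupBary_apply (x : (Fin (q + 1) → Fin (n + 1)) → Form (Aff n) p)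
    (I : Fin q → Fin (n + 1)) :
    tupBary n p q x I = ∑ i, mulCoord p i (x (Fin.cons i I)) :=
  LinearMap.sum_apply _ _ _

/-- The inclusion of constant functions. -/
noncomputable def tupConst (n q : ℕ) : ((Fin (q + 1) → Fin (n + 1)) → ℝ) →ₗ[ℝ]
    ((Fin (q + 1) → Fin (n + 1)) → Form (Aff n) 0) :=
  LinearMap.pi fun I => (LinearMap.lsmul ℝ (Form (Aff n) 0)).flip Form.one ∘ₗ LinearMap.proj I

theorem tupConst_apply (x : (Fin (q + 1) → Fin (n + 1)) → ℝ)
    (I : Fin (q + 1) → Fin (n + 1)) : tupConst n q x I = x I • Form.one := rfl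

/-- The average of the values at the vertices of the tuple. -/
noncomputable def tupMean (n q : ℕ) : ((Fin (q + 1) → Fin (n + 1)) → Form (Aff n) 0) →ₗ[ℝ]
    ((Fin (q + 1) → Fin (n + 1)) → ℝ) :=
  LinearMap.pi fun I => (q + 1 : ℝ)⁻¹ • (∑ j, Form.evalAt (vert (I j))) ∘ₗ LinearMap.proj I

theorem tupMean_apply (x : (Fin (q + 1) → Fin (n + 1)) → Form (Aff n) 0)
    (I : Fin (q + 1) → Fin (n + 1)) :
    tupMean n q x I = (q + 1 : ℝ)⁻¹ • ∑ j, Form.evalAt (vert (I j)) (x I) := by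
  rw [← LinearMap.sum_apply]; rfl

theorem evalAt_one {Y : Type*} [DiffeologicalSpace Y] (y : Y) :
    Form.evalAt y (Form.one : Form Y 0) = 1 := by
  rfl

theorem neg_one_pow_mul_self (q : ℕ) : (-1 : ℝ) ^ q * (-1 : ℝ) ^ q = 1 := by
  rw [← mul_pow]; simp

/-- Passing from `q` to `q + 1` changes the factor `(-1)^q` in `tupExt`; this sign is there to make
the two differentials anticommute. -/
theorem tupExt_tupD (x : (Fin (q + 1) → Fin (n + 1)) → Form (Aff n) p) :
    tupExt n p (q + 1) (tupD x) = - tupD (tupExt n p q x) := by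
  funext I
  have h := tupD_map ((-1 : ℝ) ^ q • Form.d p) x I
  change _ = - tupD (fun J => ((-1 : ℝ) ^ q • Form.d p) (x J)) I
  rw [← h, tupExt_apply, pow_succ, mul_neg_one, neg_smul, LinearMap.smul_apply]

theorem tupExt_tupExt (x : (Fin (q + 1) → Fin (n + 1)) → Form (Aff n) p) :
    tupExt n (p + 1) q (tupExt n p q x) = 0 := by
  funext I
  rw [tupExt_apply, tupExt_apply, map_smul, Form.d_d, smul_zero, smul_zero, Pi.zero_apply]

/-- Every vertex of the tuple gives a homotopy formula, hence so does their average, and the two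
factors `(-1)^q` cancel. Averaging rather than choosing a vertex preserves alternation. -/
theorem tupHom_tupExt (x : (Fin (q + 1) → Fin (n + 1)) → Form (Aff n) (p + 1)) :
    tupHom n (p + 1) q (tupExt n (p + 1) q x) + tupExt n p q (tupHom n p q x) = x := by
  funext I
  have hq : (q + 1 : ℝ) ≠ 0 := by positivity
  rw [Pi.add_apply, tupHom_apply, tupExt_apply, tupExt_apply, tupHom_apply]
  simp only [map_smul, ← Finset.smul_sum, map_sum, smul_smul]
  rw [mul_right_comm, ← mul_assoc, neg_one_pow_mul_self, one_mul, ← smul_add,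
    ← Finset.sum_add_distrib]
  simp only [DContraction.op_d_add_d_op]
  rw [Finset.sum_const, Finset.card_univ, Fintype.card_fin, ← Nat.cast_smul_eq_nsmul ℝ, smul_smul]
  push_cast
  rw [inv_mul_cancel₀ hq, one_smul]

theorem tupHom_tupExt_zero (x : (Fin (q + 1) → Fin (n + 1)) → Form (Aff n) 0) :
    tupHom n 0 q (tupExt n 0 q x) = x - tupConst n q (tupMean n q x) := by
  funext I
  have hq : (q + 1 : ℝ) ≠ 0 := by positivity
  rw [Pi.sub_apply, tupHom_apply, tupExt_apply, tupConst_apply, tupMean_apply]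
  simp only [map_smul, ← Finset.smul_sum, smul_smul]
  rw [mul_right_comm, neg_one_pow_mul_self, one_mul]
  simp only [DContraction.op_d_zero]
  rw [Finset.sum_sub_distrib, smul_sub, Finset.sum_const, Finset.card_univ, Fintype.card_fin,
    ← Nat.cast_smul_eq_nsmul ℝ, smul_smul]
  push_cast
  rw [inv_mul_cancel₀ hq, one_smul, ← Finset.sum_smul, smul_smul, smul_eq_mul]

theorem tupMean_tupConst (x : (Fin (q + 1) → Fin (n + 1)) → ℝ) :
    tupMean n q (tupConst n q x) = x := by
  funext I
  have hq : (q + 1 : ℝ) ≠ 0 := by positivity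
  rw [tupMean_apply, tupConst_apply]
  simp only [map_smul, evalAt_one]
  rw [Finset.sum_const, Finset.card_univ, Fintype.card_fin, nsmul_eq_mul]
  push_cast
  rw [smul_eq_mul, smul_eq_mul, mul_one, inv_mul_cancel_left₀ hq]

theorem tupExt_tupConst (x : (Fin (q + 1) → Fin (n + 1)) → ℝ) :
    tupExt n 0 q (tupConst n q x) = 0 := by
  funext I
  have h : Form.d (X := Aff n) 0 Form.one = 0 := CochainAlg.one_mem_Z (A := Omega (Aff n))
  rw [tupExt_apply, tupConst_apply, map_smul, h, smul_zero, smul_zero, Pi.zero_apply]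

theorem tupD_tupConst (x : (Fin (q + 1) → Fin (n + 1)) → ℝ) :
    tupD (tupConst n q x) = tupConst n (q + 1) (tupD x) :=
  funext fun I => (tupD_map ((LinearMap.lsmul ℝ (Form (Aff n) 0)).flip Form.one) x I).symm

/-- The cone formula with apex `i`, weighted by the `i`-th coordinate and summed over `i`; the
weights sum to `1`. For `q = 0` the last term is the barycentric mean, i.e. the projection to
simplicial forms. -/
theorem tupBary_tupD_apply (x : (Fin (q + 1) → Fin (n + 1)) → Form (Aff n) p)
    (I : Fin (q + 1) → Fin (n + 1)) :
    tupBary n p (q + 1) (tupD x) I = x I - tupD (tupBary n p q x) I := by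
  rw [tupBary_apply]
  simp only [tupD_cons, map_sub, Finset.sum_sub_distrib, sum_mulCoord]
  congr 1
  simp only [tupD_apply, tupBary_apply, Finset.smul_sum, map_sum, map_smul]
  exact Finset.sum_comm

theorem tupBary_tupD (x : (Fin (q + 1) → Fin (n + 1)) → Form (Aff n) p) :
    tupBary n p (q + 1) (tupD x) + tupD (tupBary n p q x) = x := by
  funext I
  rw [Pi.add_apply, tupBary_tupD_apply, sub_add_cancel]

variable {m : ℕ} (θ : Fin (m + 1) → Fin (n + 1))

theorem pullback_tupHom (x : (Fin (q + 1) → Fin (n + 1)) → Form (Aff n) (p + 1))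
    (I : Fin (q + 1) → Fin (m + 1)) :
    Form.pullback (affMap θ) (affMap_dSmooth θ) p (tupHom n p q x (θ ∘ I))
      = tupHom m p q (fun J => Form.pullback (affMap θ) (affMap_dSmooth θ) (p + 1) (x (θ ∘ J)))
        I := by
  rw [tupHom_apply, tupHom_apply, map_smul, map_sum]
  congr 1
  refine Finset.sum_congr rfl fun j _ => ?_
  exact DHomotopy.pullback_op (affContr (I j)).toDHomotopy (affContr (θ (I j))).toDHomotopy
    (affMap θ) (affMap_dSmooth θ) (affMap_affContr θ (I j)) _

theorem cons_comp {α β : Type*} {k : ℕ} (f : α → β) (a : α) (I : Fin k → α) :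
    (Fin.cons (f a) (f ∘ I) : Fin (k + 1) → β) = f ∘ Fin.cons a I :=
  funext fun i => by refine Fin.cases ?_ (fun i => ?_) i <;> simp

/-- Each summand over a vertex of the target splits into summands over its fibre; exchanging the
sums leaves exactly one summand for every vertex of the source. -/
theorem pullback_tupBary (x : (Fin (q + 1) → Fin (n + 1)) → Form (Aff n) p)
    (I : Fin q → Fin (m + 1)) :
    Form.pullback (affMap θ) (affMap_dSmooth θ) p (tupBary n p q x (θ ∘ I))
      = tupBary m p q (fun J => Form.pullback (affMap θ) (affMap_dSmooth θ) p (x (θ ∘ J))) I := by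
  rw [tupBary_apply, tupBary_apply, map_sum]
  simp only [pullback_mulCoord]
  rw [Finset.sum_comm]
  refine Finset.sum_congr rfl fun i _ => ?_
  rw [Finset.sum_ite_eq, if_pos (Finset.mem_univ _), cons_comp]

theorem tupMean_comp (x : (Fin (q + 1) → Fin (n + 1)) → Form (Aff n) 0)
    (I : Fin (q + 1) → Fin (m + 1)) :
    tupMean n q x (θ ∘ I)
      = tupMean m q (fun J => Form.pullback (affMap θ) (affMap_dSmooth θ) 0 (x (θ ∘ J))) I := by
  rw [tupMean_apply, tupMean_apply]
  congr 1
  refine Finset.sum_congr rfl fun j _ => ?_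
  rw [Function.comp_apply, ← affMap_vert θ (I j)]
  rfl

theorem IsAlt.tupHom {x : (Fin (q + 1) → Fin (n + 1)) → Form (Aff n) (p + 1)} (hx : IsAlt x) :
    IsAlt (DeRham.tupHom n p q x) := by
  have h := hx.average ((-1 : ℝ) ^ q * (q + 1 : ℝ)⁻¹) fun i => (affContr i).op p
  rwa [← funext fun I => tupHom_apply x I] at h

theorem IsAlt.tupMean {x : (Fin (q + 1) → Fin (n + 1)) → Form (Aff n) 0} (hx : IsAlt x) :
    IsAlt (DeRham.tupMean n q x) := by
  have h := hx.average ((q + 1 : ℝ)⁻¹) fun i => Form.evalAt (vert i)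
  rwa [← funext fun I => tupMean_apply x I] at h

theorem IsAlt.tupBary {x : (Fin (q + 1) → Fin (n + 1)) → Form (Aff n) p} (hx : IsAlt x) :
    IsAlt (DeRham.tupBary n p q x) := by
  have h : IsAlt fun I => ∑ i, mulCoord p i (x (Fin.cons i I)) :=
    IsAlt.sum fun i _ => (hx.cons i).map (mulCoord p i)
  rwa [← funext fun I => tupBary_apply x I] at h

end Operators

/-! ### The double complex of simplicial forms and its comparison map -/

/-- The exterior derivative as a natural operator. -/
noncomputable def dOp (p q : ℕ) : TupOp (formCoeff p) (formCoeff (p + 1)) q q where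
  T n := tupExt n p q
  alt {n _} hx := hx.map ((-1 : ℝ) ^ q • Form.d (X := Aff n) p)
  nat _ _ := rfl

/-- The averaged homotopy operators as a natural operator. -/
noncomputable def hOp (p q : ℕ) : TupOp (formCoeff (p + 1)) (formCoeff p) q q where
  T n := tupHom n p q
  alt hx := hx.tupHom
  nat θ x := funext fun I => pullback_tupHom θ x I

/-- The contraction by barycentric coordinates as a natural operator. -/
noncomputable def cOp (p q : ℕ) : TupOp (formCoeff p) (formCoeff p) (q + 1) q where
  T n := tupBary n p (q + 1)
  alt hx := hx.tupBary
  nat θ x := funext fun I => pullback_tupBary θ x I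

/-- The inclusion of constants as a natural operator. -/
noncomputable def constOp (q : ℕ) : TupOp realCoeff (formCoeff 0) q q where
  T n := tupConst n q
  alt {n _} hx := hx.map ((LinearMap.lsmul ℝ (Form (Aff n) 0)).flip Form.one)
  nat _ _ := rfl

/-- The average of the values at the vertices as a natural operator. -/
noncomputable def meanOp (q : ℕ) : TupOp (formCoeff 0) realCoeff q q where
  T n := tupMean n q
  alt hx := hx.tupMean
  nat θ x := funext fun I => tupMean_comp θ x I

/-- A cochain algebra without its product. -/
def CochainAlg.toCx (A : CochainAlg.{u}) : Cx.{u} where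
  C := A.C
  d := A.d

/-- The complex of alternating simplicial cochains of smooth simplices. -/
noncomputable def altCx (Y : Type u) [DiffeologicalSpace Y] : Cx.{u} where
  C q := Fam realCoeff Y q
  d q := (deltaOp realCoeff q).lift Y

/-- The inclusion of simplicial forms as families that are independent of the vertex. -/
noncomputable def adrInc (Y : Type u) [DiffeologicalSpace Y] (p : ℕ) :
    ADRForm (smoothSing Y) p →ₗ[ℝ] Fam (formCoeff p) Y 0 where
  toFun a := Fam.mk (fun n s _ => a.1 n s) ⟨fun n s π I => by
    have h : π = 1 := Equiv.ext fun i => Subsingleton.elim (α := Fin 1) _ _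
    rw [h, Perm.sign_one, Units.val_one, Int.cast_one, one_smul],
    fun m n θ s I => a.2 m n (SimplexCategory.mkHom θ) s⟩
  map_add' _ _ := rfl
  map_smul' _ _ := rfl

/-- The average of a family with respect to the barycentric coordinates. -/
noncomputable def adrMean (Y : Type u) [DiffeologicalSpace Y] (p : ℕ) :
    Fam (formCoeff p) Y 0 →ₗ[ℝ] ADRForm (smoothSing Y) p where
  toFun f := ADRForm.mk (fun n s => tupBary n p 0 (f.1 n s) Fin.elim0) fun m n θ s => by
    have h : f.1 m (Simp.comp s θ.toOrderHom) = fun I => Form.pullback (affMap θ.toOrderHom)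
      (affMap_dSmooth _) p (f.1 n s (θ.toOrderHom ∘ I)) := funext fun I => f.nat θ.toOrderHom s I
    refine (congrArg (fun x => tupBary m p 0 x Fin.elim0) h).trans ?_
    refine (pullback_tupBary θ.toOrderHom (f.1 n s) Fin.elim0).symm.trans ?_
    rw [Subsingleton.elim (θ.toOrderHom ∘ Fin.elim0) Fin.elim0]
  map_add' f g := ADRForm.ext fun n s =>
    congrFun ((tupBary n p 0).map_add (f.1 n s) (g.1 n s)) Fin.elim0
  map_smul' r f := ADRForm.ext fun n s =>
    congrFun ((tupBary n p 0).map_smul r (f.1 n s)) Fin.elim0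

/-- The double complex of families of forms, which compares the simplicial de Rham complex with
the alternating simplicial cochains. -/
noncomputable def simplicialDoubleCx (Y : Type u) [DiffeologicalSpace Y] : DoubleCx.{u} where
  D p q := Fam (formCoeff p) Y q
  A := (ADR (smoothSing Y)).toCx
  B := altCx Y
  d p q := (dOp p q).lift Y
  δ p q := (deltaOp (formCoeff p) q).lift Y
  d_δ p q x := Fam.ext fun n s I => congrFun (tupExt_tupD (x.1 n s)) I
  d_d p q x := Fam.ext fun n s I => congrFun (tupExt_tupExt (x.1 n s)) I
  δ_δ p q x := Fam.ext fun n s I => congrFun (tupD_tupD (x.1 n s)) I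
  h p q := (hOp p q).lift Y
  c p q := (cOp p q).lift Y
  h_d p q x := Fam.ext fun n s I => congrFun (tupHom_tupExt (x.1 n s)) I
  c_δ p q x := Fam.ext fun n s I => congrFun (tupBary_tupD (x.1 n s)) I
  iA := adrInc Y
  eA := adrMean Y
  eA_iA p a := ADRForm.ext fun n s =>
    (tupBary_apply (fun _ => a.1 n s) Fin.elim0).trans (sum_mulCoord (a.1 n s))
  c_δ_zero p x := Fam.ext fun n s I => by
    have h := tupBary_tupD_apply (x.1 n s) I
    rw [tupD_apply, Fin.sum_univ_succ, Fin.sum_univ_zero, add_zero, Fin.val_zero, pow_zero,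
      one_smul, Subsingleton.elim (I ∘ Fin.succAbove 0) Fin.elim0] at h
    exact h
  -- A family independent of the vertex has the same value for both omissions from a pair, and these
  -- enter with opposite signs.
  δ_iA p a := Fam.ext fun n s I => by
    have h : tupD (fun _ : Fin 1 → Fin (n + 1) => a.1 n s) I = 0 := by
      rw [tupD_apply, Fin.sum_univ_two]
      simp
    exact h
  d_iA p a := Fam.ext fun n s I => by
    refine (tupExt_apply (fun _ => a.1 n s) I).trans ?_
    rw [pow_zero, one_smul]
    rfl
  iB q := (constOp q).lift Y
  eB q := (meanOp q).lift Y
  eB_iB q b := Fam.ext fun n s I => congrFun (tupMean_tupConst (b.1 n s)) I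
  h_d_zero q x := Fam.ext fun n s I => congrFun (tupHom_tupExt_zero (x.1 n s)) I
  d_iB q b := Fam.ext fun n s I => congrFun (tupExt_tupConst (b.1 n s)) I
  δ_iB q b := Fam.ext fun n s I => congrFun (tupD_tupConst (b.1 n s)) I

/-- The natural comparison of the simplicial de Rham complex with alternating cochains. -/
noncomputable def theta (Y : Type u) [DiffeologicalSpace Y] (p : ℕ) :
    ADRForm (smoothSing Y) p →ₗ[ℝ] Fam realCoeff Y p := (simplicialDoubleCx Y).comparison p

theorem theta_d (Y : Type u) [DiffeologicalSpace Y] (p : ℕ) (a : ADRForm (smoothSing Y) p) :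
    theta Y (p + 1) (ADRForm.d p a) = (deltaOp realCoeff p).lift Y (theta Y p a) :=
  (simplicialDoubleCx Y).comparison_d p a

theorem quasiIso_theta (Y : Type u) [DiffeologicalSpace Y] :
    Cx.QuasiIso (ADR (smoothSing Y)).toCx (altCx Y) (theta Y) :=
  (simplicialDoubleCx Y).quasiIso_comparison

/-- In degree `0` the comparison is the mean of the values at the vertices. This is the
normalization on constants that the acyclic models argument needs. -/
theorem theta_one (Y : Type u) [DiffeologicalSpace Y] {n : ℕ} (s : Simp Y n)
    (I : Fin 1 → Fin (n + 1)) : (theta Y 0 (ADR (smoothSing Y)).one).1 n s I = (1 : ℝ) := by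
  refine (tupMean_apply (fun _ => (Form.one : Form (Aff n) 0)) I).trans ?_
  simp [evalAt_one]

/-- The comparison with alternating cochains is natural for the pullback of forms. -/
theorem pull_theta_alpha {Y : Type u} {Z : Type*} [DiffeologicalSpace Y] [DiffeologicalSpace Z]
    (g : Y → Z) (hg : DSmooth g) (p : ℕ) (τ : Form Z p) :
    Fam.pull g hg (theta Z p ((alpha Z).f p τ)) = theta Y p ((alpha Y).f p (Form.pullback g hg p τ)) :=
  DoubleCx.toB_natural (K := simplicialDoubleCx Z) (K' := simplicialDoubleCx Y)
    (fun _ _ => Fam.pull g hg) (fun _ => Fam.pull g hg) (fun _ _ _ => rfl) (fun _ _ _ => rfl)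
    (fun _ _ => rfl) p 0 p rfl _

end DeRham

namespace DeRham

open scoped ContDiff

universe u

open Diffeology

/-! ### Cubical cochains as a contractible and cofree presheaf of complexes -/

/-- The image of a plot under a smooth map. -/
def Plot.map {Y : Type*} {Z : Type*} [DiffeologicalSpace Y] [DiffeologicalSpace Z] {p : ℕ}
    (t : Plot Y p) (g : Y → Z) (hg : DSmooth g) : Plot Z p := ⟨g ∘ t.1, hg p t.1 t.2⟩

theorem Degenerate.map {Y : Type*} {Z : Type*} [DiffeologicalSpace Y] [DiffeologicalSpace Z] {p : ℕ}
    {t : Plot Y p} (ht : Degenerate t) (g : Y → Z) (hg : DSmooth g) : Degenerate (t.map g hg) := by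
  obtain ⟨i, hi⟩ := ht
  exact ⟨i, fun x y h => congrArg g (hi x y h)⟩

/-- Pullback of cubical cochains. -/
def CubeCochain.pull {Y : Type*} {Z : Type*} [DiffeologicalSpace Y] [DiffeologicalSpace Z]
    (g : Y → Z) (hg : DSmooth g) (p : ℕ) : CubeCochain Z p →ₗ[ℝ] CubeCochain Y p where
  toFun f := CubeCochain.mk (fun t => f.1 (t.map g hg)) fun _ ht => f.2 _ (ht.map g hg)
  map_add' _ _ := rfl
  map_smul' _ _ := rfl

/-- Cubical cochains of the spaces `ℝⁿ`. -/
noncomputable def cubeLoc : LocCx where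
  C n p := CubeCochain (E n) p
  d _ p := CubeCochain.d p
  d_d n p z := (Cube (E n)).d_d p z
  pull f hf p := CubeCochain.pull f hf.dSmooth p
  pull_comp _ _ _ _ _ _ := rfl
  pull_d _ _ _ _ := rfl

/-- Cubical cochains of `X`, with their restrictions to plots. -/
noncomputable def cubeGlob (X : Type u) [DiffeologicalSpace X] : cubeLoc.Glob X where
  toCx := (Cube X).toCx
  res σ p := CubeCochain.pull σ.1 σ.2.dSmooth p
  res_d _ _ _ := rfl
  pull_res _ _ _ _ _ := rfl

/-- The map that replaces the coordinates in `S` by zero. -/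
noncomputable def zeroOn {p : ℕ} (S : Finset (Fin p)) (y : E p) : E p :=
  WithLp.toLp 2 fun j => if j ∈ S then 0 else y j

theorem zeroOn_apply {p : ℕ} (S : Finset (Fin p)) (y : E p) (j : Fin p) :
    zeroOn S y j = if j ∈ S then 0 else y j := rfl

theorem contDiff_zeroOn {p : ℕ} (S : Finset (Fin p)) : ContDiff ℝ ∞ (zeroOn S) := by
  rw [contDiff_euclidean]
  intro j
  simp only [zeroOn_apply]
  split_ifs
  · exact contDiff_const
  · fun_prop

theorem degenerate_comp_zeroOn {X : Type*} [DiffeologicalSpace X] {p : ℕ} (σ : Plot X p)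
    {S : Finset (Fin p)} (hS : S.Nonempty) : Degenerate (σ.comp (zeroOn S) (contDiff_zeroOn S)) := by
  obtain ⟨i, hi⟩ := hS
  refine ⟨i, fun x y h => congrArg σ.1 (PiLp.ext fun j => ?_)⟩
  rw [zeroOn_apply, zeroOn_apply]
  split_ifs with hj
  · rfl
  · exact h j fun hji => hj (hji ▸ hi)

theorem zeroOn_empty {p : ℕ} (y : E p) : zeroOn ∅ y = y :=
  PiLp.ext fun j => by rw [zeroOn_apply, if_neg (Finset.notMem_empty _)]

/-- A `p`-cube `σ` is the image under itself of the identity cube of `ℝᵖ`. A cochain is thus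
recovered from its restrictions, and a compatible family glues by evaluating `s σ` at the identity
cube. -/
theorem cubeGlob_isSheaf (X : Type u) [DiffeologicalSpace X] : (cubeGlob X).IsSheaf where
  sep {p z w} h := CubeCochain.ext fun σ => congrArg (fun f : CubeCochain (E p) p => f.1 (idPlot p))
    (h σ)
  glue {p} s hs := by
    have key : ∀ {m : ℕ} (σ : Plot X m) (t : Plot (E m) p),
        (s (σ.comp t.1 t.2.contDiff) : CubeCochain (E p) p).1 (idPlot p)
          = (s σ : CubeCochain (E m) p).1 t := fun σ t =>
      (congrArg (fun f : CubeCochain (E p) p => f.1 (idPlot p)) (hs σ t.1 t.2.contDiff)).symm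
    refine ⟨CubeCochain.mk (fun σ => (s σ : CubeCochain (E p) p).1 (idPlot p)) ?_, fun {n} σ =>
      CubeCochain.ext fun t => key σ t⟩
    rintro σ ⟨i, hi⟩
    -- A cube that ignores its `i`-th coordinate is unchanged by setting that coordinate to zero. So
    -- the value at `σ` equals the value of `s σ` on a degenerate cube of `ℝᵖ`, which is zero.
    have h1 : σ.comp (zeroOn {i}) (contDiff_zeroOn {i}) = σ :=
      Subtype.ext (funext fun y => hi _ _ fun j hj => by
        rw [zeroOn_apply, if_neg (by simpa using hj)])
    have h2 := key σ ((idPlot p).comp (zeroOn {i}) (contDiff_zeroOn {i}))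
    have h3 : σ.comp ((idPlot p).comp (zeroOn {i}) (contDiff_zeroOn {i})).1
        (Subtype.property ((idPlot p).comp (zeroOn {i}) (contDiff_zeroOn {i}))).contDiff = σ := h1
    rw [h3] at h2
    beta_reduce
    rw [h2]
    exact (s σ : CubeCochain (E p) p).2 _ (degenerate_comp_zeroOn _ ⟨i, by simp⟩)

/-- The projection of functions of cubes onto normalized cochains. -/
noncomputable def cubeNormalize {X : Type*} [DiffeologicalSpace X] (p : ℕ) :
    (Plot X p → ℝ) →ₗ[ℝ] CubeCochain X p where
  toFun u := CubeCochain.mk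
    (fun σ => ∑ S : Finset (Fin p), (-1 : ℝ) ^ S.card * u (σ.comp (zeroOn S) (contDiff_zeroOn S)))
    (by
      rintro σ ⟨i, hi⟩
      -- For a cube independent of `i`, adding `i` to `S` or removing it does not change the cube
      -- but flips the sign, so the terms cancel in pairs.
      have h1 : ∀ S T : Finset (Fin p), (∀ j, j ≠ i → (j ∈ S ↔ j ∈ T)) →
          σ.comp (zeroOn S) (contDiff_zeroOn S) = σ.comp (zeroOn T) (contDiff_zeroOn T) :=
        fun S T h => Subtype.ext (funext fun y => hi _ _ fun j hj => by
          rw [zeroOn_apply, zeroOn_apply, if_congr (h j hj) rfl rfl])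
      refine Finset.sum_involution (fun S _ => if i ∈ S then S.erase i else insert i S)
        (fun S _ => ?_) (fun S _ _ => ?_) (fun S _ => Finset.mem_univ _) (fun S _ => ?_)
      · split_ifs with h
        · rw [h1 (S.erase i) S (fun j hj => by simp [hj]), ← Finset.card_erase_add_one h, pow_succ]
          ring
        · rw [h1 (insert i S) S (fun j hj => by simp [hj]), Finset.card_insert_of_notMem h, pow_succ]
          ring
      · split_ifs with h
        · exact fun h' => by
            rw [← h'] at h; simp at h
        · exact fun h' => h (by rw [← h']; simp)
      · by_cases h : i ∈ S
        · simp [h]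
        · simp [h])
  map_add' u v := CubeCochain.ext fun σ => by
    change ∑ S : Finset (Fin p), _ * (u _ + v _) = _
    simp only [mul_add, Finset.sum_add_distrib]
    rfl
  map_smul' r u := CubeCochain.ext fun σ => by
    change ∑ S : Finset (Fin p), _ * (r * u _) = r * ∑ S : Finset (Fin p), _ * u _
    rw [Finset.mul_sum]
    exact Finset.sum_congr rfl fun S _ => mul_left_comm _ _ _

/-- Setting a nonempty set of coordinates to zero gives a degenerate cube, so on normalized cochains
only the term of the empty set survives. -/
theorem cubeNormalize_apply {X : Type*} [DiffeologicalSpace X] {p : ℕ} (f : CubeCochain X p) :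
    cubeNormalize p f.1 = f := CubeCochain.ext fun σ => by
  change ∑ S : Finset (Fin p), (-1 : ℝ) ^ S.card * f.1 (σ.comp (zeroOn S) (contDiff_zeroOn S)) = _
  rw [Finset.sum_eq_single ∅]
  · have : σ.comp (zeroOn ∅) (contDiff_zeroOn ∅) = σ :=
      Subtype.ext (funext fun y => congrArg σ.1 (zeroOn_empty y))
    rw [this]; simp
  · intro S _ hS
    rw [f.2 _ (degenerate_comp_zeroOn σ (Finset.nonempty_iff_ne_empty.2 hS)), mul_zero]
  · simp

/-- Cubical cochains are cofree. -/
noncomputable def cubeCofree : cubeLoc.Cofree where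
  dim p := p
  ev n p := (cubeSubmodule (E n) p).subtype
  rho _ p := cubeNormalize p
  rho_ev _ _ z := cubeNormalize_apply z
  ev_pull _ _ _ _ _ := rfl
  pull_rho _ _ _ _ := rfl

/-! ### Cones of cubes and contractibility of cubical cochains -/

/-- The cone of a cube in `ℝⁿ`. -/
noncomputable def cubeCone {n p : ℕ} (σ : Plot (E n) p) : Plot (E n) (p + 1) :=
  ⟨fun z => z 0 • σ.1 (cylProj p z), by
    have h : ContDiff ℝ ∞ σ.1 := σ.2.contDiff
    have h0 : ContDiff ℝ ∞ fun z : E (p + 1) => z 0 := by fun_prop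
    exact (h0.smul (h.comp (cylProj p).contDiff)).isPlot⟩

theorem cubeCone_degenerate {n p : ℕ} {σ : Plot (E n) p} (hσ : Degenerate σ) :
    Degenerate (cubeCone σ) := by
  obtain ⟨i, hi⟩ := hσ
  refine ⟨i.succ, fun x y h => ?_⟩
  change x 0 • σ.1 (cylProj p x) = y 0 • σ.1 (cylProj p y)
  rw [h 0 (Fin.succ_ne_zero i).symm, hi (cylProj p x) (cylProj p y) fun j hj => ?_]
  rw [cylProj_apply, cylProj_apply]
  exact h j.succ fun h' => hj (Fin.succ_injective _ h')

/-- The cone parameter is the new coordinate `0`. All faces in other directions are cones of faces,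
with the index and hence the sign shifted by one. -/
theorem cubeCone_face_succ {n p : ℕ} (σ : Plot (E n) (p + 1)) (i : Fin (p + 1)) (a : ℝ) :
    (cubeCone σ).comp (faceMap i.succ.succAboveOrderEmb fun _ => a) (faceMap_contDiff _ _)
      = cubeCone (σ.comp (faceMap i.succAboveOrderEmb fun _ => a) (faceMap_contDiff _ _)) := by
  refine Subtype.ext (funext fun z => ?_)
  have h0 : faceMap i.succ.succAboveOrderEmb (fun _ => a) z 0 = z 0 := by
    have := faceMap_of i.succ.succAboveOrderEmb.injective (fun _ => a) z 0
    simpa using this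
  have h1 : cylProj (p + 1) (faceMap i.succ.succAboveOrderEmb (fun _ => a) z)
      = faceMap i.succAboveOrderEmb (fun _ => a) (cylProj p z) := by
    refine PiLp.ext fun k => ?_
    rw [cylProj_apply]
    refine Fin.succAboveCases i ?_ (fun j => ?_) k
    · rw [faceMap_of_not, faceMap_of_not]
      · rintro ⟨j, hj⟩
        exact Fin.succAbove_ne i j hj
      · rintro ⟨j, hj⟩
        exact Fin.succAbove_ne i.succ j hj
    · have h2 := faceMap_of i.succ.succAboveOrderEmb.injective (fun _ => a) z j.succ
      have h3 := faceMap_of i.succAboveOrderEmb.injective (fun _ => a) (cylProj p z) j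
      rw [Fin.succAboveOrderEmb_apply] at h2 h3
      rw [Fin.succ_succAbove_succ] at h2
      rw [h2, h3, cylProj_apply]
  change faceMap i.succ.succAboveOrderEmb (fun _ => a) z 0 • σ.1 (cylProj (p + 1)
    (faceMap i.succ.succAboveOrderEmb (fun _ => a) z)) = _
  rw [h0, h1]
  rfl

theorem faceMap_zero_eq {p : ℕ} (a : ℝ) (z : E p) :
    faceMap (Fin.succAboveOrderEmb (0 : Fin (p + 1))) (fun _ => a) z = cyl a z := by
  refine PiLp.ext fun k => ?_
  refine Fin.cases ?_ (fun j => ?_) k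
  · rw [cyl_zero, faceMap_of_not]
    rintro ⟨j, hj⟩
    exact Fin.succAbove_ne 0 j hj
  · have h := faceMap_of (Fin.succAboveOrderEmb (0 : Fin (p + 1))).injective (fun _ => a) z j
    rw [Fin.succAboveOrderEmb_apply, Fin.zero_succAbove] at h
    rw [h, cyl_succ]

theorem cubeCone_face_one {n p : ℕ} (σ : Plot (E n) p) :
    (cubeCone σ).comp (faceMap (Fin.succAboveOrderEmb 0) fun _ => 1) (faceMap_contDiff _ _) = σ := by
  refine Subtype.ext (funext fun z => ?_)
  change faceMap (Fin.succAboveOrderEmb 0) (fun _ => 1) z 0 • σ.1 (cylProj p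
    (faceMap (Fin.succAboveOrderEmb 0) (fun _ => 1) z)) = σ.1 z
  rw [faceMap_zero_eq, cyl_zero, cylProj_cyl, one_smul]

/-- The constant cube at the origin. -/
noncomputable def originCube (n p : ℕ) : Plot (E n) p := ⟨fun _ => 0, isPlot_const⟩

theorem cubeCone_face_zero {n p : ℕ} (σ : Plot (E n) p) :
    (cubeCone σ).comp (faceMap (Fin.succAboveOrderEmb 0) fun _ => 0) (faceMap_contDiff _ _)
      = originCube n p := by
  refine Subtype.ext (funext fun z => ?_)
  change faceMap (Fin.succAboveOrderEmb 0) (fun _ => 0) z 0 • σ.1 (cylProj p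
    (faceMap (Fin.succAboveOrderEmb 0) (fun _ => 0) z)) = 0
  rw [faceMap_zero_eq, cyl_zero, zero_smul]

/-- Evaluation on cones. -/
noncomputable def cubeConeOp (n p : ℕ) : CubeCochain (E n) (p + 1) →ₗ[ℝ] CubeCochain (E n) p where
  toFun f := CubeCochain.mk (fun σ => f.1 (cubeCone σ)) fun _ hσ => f.2 _ (cubeCone_degenerate hσ)
  map_add' _ _ := rfl
  map_smul' _ _ := rfl

/-- Cubical cochains of `ℝⁿ` are contractible. -/
noncomputable def cubeContr : cubeLoc.Contr where
  k n p := cubeConeOp n p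
  one n := (Cube (E n)).one
  d_one n := CochainAlg.one_mem_Z (A := Cube (E n))
  k_d n p z := CubeCochain.ext fun σ => by
    -- The face of the cone at parameter `0` is constant. In positive dimension it is degenerate and
    -- contributes nothing; in degree `0` it yields the constant `r` of `k_d_zero`.
    have hf : (z : CubeCochain (E n) (p + 1)).1 (originCube n (p + 1)) = 0 :=
      Subtype.property z _ ⟨0, fun _ _ _ => rfl⟩
    change coboundary z.1 (cubeCone σ) + coboundary (fun t => z.1 (cubeCone t)) σ = z.1 σ
    rw [coboundary, Fin.sum_univ_succ, cubeCone_face_one, cubeCone_face_zero, hf]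
    simp only [cubeCone_face_succ]
    rw [coboundary, add_assoc, ← Finset.sum_add_distrib, Finset.sum_eq_zero]
    · simp
    -- The face of the cone in direction `i + 1` has the sign opposite to the `i`-th term of the
    -- coboundary of `z ∘ cubeCone`.
    · intro i _
      rw [Fin.val_succ, pow_succ]
      ring
  k_d_zero n z := ⟨(z : CubeCochain (E n) 0).1 (originCube n 0), CubeCochain.ext fun σ => by
    change coboundary z.1 (cubeCone σ) = z.1 σ - z.1 (originCube n 0) * 1
    rw [coboundary, Fin.sum_univ_succ, Fin.sum_univ_zero, cubeCone_face_one, cubeCone_face_zero]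
    simp⟩

end DeRham

namespace DeRham

open scoped ContDiff

universe u

open Diffeology Equiv

/-! ### Charts of the affine spaces -/

/-- The chart `(y₁, …, yₙ) ↦ (1 - ∑ yᵢ, y₁, …, yₙ)` of `𝔸ⁿ`. -/
noncomputable def toAff {n : ℕ} (y : E n) : Aff n :=
  ⟨cyl (1 - ∑ i, y i) y, by
    rw [Fin.sum_univ_succ, cyl_zero]
    simp only [cyl_succ]
    ring⟩

/-- The inverse chart. -/
noncomputable def fromAff {n : ℕ} (x : Aff n) : E n := cylProj n x.1

-- This composite alone makes simplices a retract of plots: every simplex is recovered from its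
-- plot, which is all that gluing and cofreeness use.
@[simp]
theorem toAff_fromAff {n : ℕ} (x : Aff n) : toAff (fromAff x) = x := by
  refine Subtype.ext ?_
  have h : 1 - ∑ i, fromAff x i = x.1 0 := by
    have := x.2
    rw [Fin.sum_univ_succ] at this
    exact sub_eq_of_eq_add this.symm
  change cyl (1 - ∑ i, fromAff x i) (fromAff x) = x.1
  rw [h]
  exact cyl_cylProj x.1

theorem isPlot_toAff (n : ℕ) : IsPlot (toAff : E n → Aff n) := by
  change ContDiff ℝ ∞ fun y : E n => cyl (1 - ∑ i, y i) y
  exact contDiff_cyl.comp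
    ((contDiff_const.sub (ContDiff.sum fun i _ => by fun_prop)).prodMk contDiff_id)

theorem dSmooth_fromAff (n : ℕ) : DSmooth (fromAff : Aff n → E n) := by
  intro k σ hσ
  have hσ' : ContDiff ℝ ∞ fun x => ((σ x).1 : E (n + 1)) := hσ
  exact ((cylProj n).contDiff.comp hσ').isPlot

section Charts

variable {X : Type u} [DiffeologicalSpace X]

/-- The simplex that corresponds to a plot under the chart. -/
noncomputable def Plot.toSimp {n : ℕ} (σ : Plot X n) : Simp X n :=
  ⟨σ.1 ∘ fromAff, σ.2.dSmooth.comp (dSmooth_fromAff n)⟩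

/-- The plot that corresponds to a simplex under the chart. -/
noncomputable def Simp.toPlot {n : ℕ} (s : Simp X n) : Plot X n :=
  ⟨s.1 ∘ toAff, s.2 n toAff (isPlot_toAff n)⟩

theorem Simp.toSimp_toPlot {n : ℕ} (s : Simp X n) : s.toPlot.toSimp = s :=
  Subtype.ext (funext fun x => congrArg s.1 (toAff_fromAff x))

end Charts

/-! ### Alternating cochains as a presheaf of complexes -/

/-- Alternating cochains of the spaces `ℝⁿ`. -/
noncomputable def altLoc : LocCx where
  C n q := Fam realCoeff (E n) q
  d n q := (deltaOp realCoeff q).lift (E n)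
  d_d _ _ z := Fam.ext fun k s I => congrFun (tupD_tupD (z.1 k s)) I
  pull f hf _ := Fam.pull f hf.dSmooth
  pull_comp _ _ _ _ _ _ := rfl
  pull_d _ _ _ _ := rfl

/-- Alternating cochains of `X`, with their restrictions to plots. -/
noncomputable def altGlob (X : Type u) [DiffeologicalSpace X] : altLoc.Glob X where
  toCx := altCx X
  res σ _ := Fam.pull σ.1 σ.2.dSmooth
  res_d _ _ _ := rfl
  pull_res _ _ _ _ _ := rfl

/-- Every smooth `n`-simplex of `X` is the image, under its plot, of the chart simplex of `ℝⁿ`.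
Values on this simplex determine a cochain and define the glued one. -/
theorem altGlob_isSheaf (X : Type u) [DiffeologicalSpace X] : (altGlob X).IsSheaf where
  sep {q z w} h := Fam.ext fun n s I => by
    have h1 := congrArg (fun f : Fam realCoeff (E n) q => f.1 n (idPlot n).toSimp I) (h s.toPlot)
    have h2 : (idPlot n).toSimp.map s.toPlot.1 s.toPlot.2.dSmooth = s := s.toSimp_toPlot
    change (z : Fam realCoeff X q).1 n ((idPlot n).toSimp.map s.toPlot.1 s.toPlot.2.dSmooth) I
      = (w : Fam realCoeff X q).1 n ((idPlot n).toSimp.map s.toPlot.1 s.toPlot.2.dSmooth) I at h1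
    rwa [h2] at h1
  glue {q} c hc := by
    have key : ∀ {m k : ℕ} (σ : Plot X m) (t : Simp (E m) k) (I : Fin (q + 1) → Fin (k + 1)),
        (c (σ.comp t.toPlot.1 t.toPlot.2.contDiff) : Fam realCoeff (E k) q).1 k
          (idPlot k).toSimp I = (c σ : Fam realCoeff (E m) q).1 k t I := by
      intro m k σ t I
      have h := congrArg (fun f : Fam realCoeff (E k) q => f.1 k (idPlot k).toSimp I)
        (hc σ t.toPlot.1 t.toPlot.2.contDiff)
      refine h.symm.trans ?_
      exact congrArg (fun t => (c σ : Fam realCoeff (E m) q).1 k t I) t.toSimp_toPlot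
    refine ⟨Fam.mk (fun n s I => (c s.toPlot : Fam realCoeff (E n) q).1 n (idPlot n).toSimp I)
      ⟨fun n s => Fam.alt (c s.toPlot) _, fun m n θ s I => ?_⟩, fun {n} σ => Fam.ext fun k t I =>
        key σ t I⟩
    -- The face of `s` along `θ` is the image under the plot of `s` of the corresponding face of the
    -- chart simplex; naturality of the local cochain on `ℝⁿ` does the rest.
    have h1 := key s.toPlot ((idPlot n).toSimp.comp θ) I
    have h2 : s.toPlot.comp ((idPlot n).toSimp.comp θ).toPlot.1
        ((idPlot n).toSimp.comp θ).toPlot.2.contDiff = (s.comp θ).toPlot :=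
      Subtype.ext (funext fun y => congrArg s.1 (toAff_fromAff _))
    rw [h2] at h1
    exact h1.trans (Fam.nat (c s.toPlot : Fam realCoeff (E n) q) θ (idPlot n).toSimp I)

/-! ### Alternating cochains of Euclidean spaces are contractible -/

/-- A cutoff function that is `1` at `0` and vanishes near `1`. -/
noncomputable def coneCut (r : ℝ) : ℝ := Real.smoothTransition (1 - 2 * r)

theorem coneCut_zero : coneCut 0 = 1 := by simp [coneCut]

theorem coneCut_of_le {r : ℝ} (h : 1 / 2 ≤ r) : coneCut r = 0 :=
  Real.smoothTransition.zero_of_nonpos (by linarith)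

theorem contDiff_coneCut : ContDiff ℝ ∞ coneCut :=
  Real.smoothTransition.contDiff.comp (by fun_prop)

/-- The projection of the cone on its base from the apex, in charts. -/
noncomputable def conePt {m : ℕ} (x : Aff (m + 1)) : Aff m :=
  toAff ((1 - x.1 0)⁻¹ • cylProj m (cylProj (m + 1) x.1))

/-- Away from the hyperplane `x₀ = 1` the remaining coordinates sum to the nonzero number `1 - x₀`,
and dividing by it gives barycentric coordinates of the base. -/
theorem conePt_apply {m : ℕ} {x : Aff (m + 1)} (hx : x.1 0 ≠ 1) (i : Fin (m + 1)) :
    (conePt x).1 i = (1 - x.1 0)⁻¹ * x.1 i.succ := by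
  refine Fin.cases ?_ (fun i => ?_) i
  · have h := x.2
    rw [Fin.sum_univ_succ, Fin.sum_univ_succ] at h
    have h' : 1 - x.1 0 ≠ 0 := sub_ne_zero.2 hx.symm
    change cyl (1 - ∑ i : Fin m, (1 - x.1 0)⁻¹ * x.1 i.succ.succ) _ 0 = _
    rw [cyl_zero, ← Finset.mul_sum]
    field_simp
    linarith
  · change cyl _ ((1 - x.1 0)⁻¹ • cylProj m (cylProj (m + 1) x.1)) i.succ = _
    rw [cyl_succ]
    rfl

/-- The cone of a smooth simplex in `ℝⁿ` with apex the origin, cut off near the apex. -/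
noncomputable def simpCone {n m : ℕ} (s : Simp (E n) m) : Simp (E n) (m + 1) :=
  ⟨fun x => coneCut (x.1 0) • s.1 (conePt x), by
    intro k σ hσ
    have hσ' : ContDiff ℝ ∞ fun x => ((σ x).1 : E (m + 1 + 1)) := hσ
    have h0 : ContDiff ℝ ∞ fun x => (σ x).1 0 := contDiff_euclidean.1 hσ' 0
    have hs : ContDiff ℝ ∞ (s.1 ∘ toAff) := s.toPlot.2.contDiff
    refine ContDiff.isPlot (contDiff_iff_contDiffAt.2 fun x => ?_)
    -- The radial projection is singular on the hyperplane `x₀ = 1`, but the cutoff vanishes for `x₀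
    -- ≥ 1/2`, so the cone is locally constant there. Elsewhere `1 - x₀` is invertible.
    by_cases hx : (σ x).1 0 = 1
    · have h1 : ∀ᶠ y in nhds x, 1 / 2 < (σ y).1 0 :=
        h0.continuous.continuousAt.eventually_const_lt (by simp only [hx]; norm_num)
      refine (contDiffAt_const (c := (0 : E n))).congr_of_eventuallyEq ?_
      filter_upwards [h1] with y hy
      change coneCut ((σ y).1 0) • _ = _
      rw [coneCut_of_le hy.le, zero_smul]
    · have h2 : ContDiffAt ℝ ∞ (fun y => (1 - (σ y).1 0)⁻¹) x :=
        (contDiffAt_const.sub h0.contDiffAt).inv (sub_ne_zero.2 (Ne.symm hx))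
      refine ((contDiff_coneCut.comp h0).contDiffAt).smul ?_
      refine ContDiffAt.comp (g := s.1 ∘ toAff) x hs.contDiffAt (h2.smul ?_)
      exact ((cylProj m).contDiff.comp ((cylProj (m + 1)).contDiff.comp hσ')).contDiffAt⟩

/-- The extension of a monotone map by the apex. -/
def coneHom {m n : ℕ} (θ : Fin (m + 1) →o Fin (n + 1)) : Fin (m + 2) →o Fin (n + 2) where
  toFun := Fin.cons 0 (Fin.succ ∘ θ)
  monotone' := by
    intro i j hij
    refine Fin.cases (fun _ => ?_) (fun i hij => ?_) i hij
    · simp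
    · obtain ⟨j, rfl⟩ : ∃ j', j = Fin.succ j' :=
        Fin.exists_succ_eq_of_ne_zero (fun h => by simp [h] at hij) |>.imp fun _ h => h.symm
      simpa using θ.monotone (Fin.succ_le_succ_iff.1 hij)

theorem coneHom_zero {m n : ℕ} (θ : Fin (m + 1) →o Fin (n + 1)) : coneHom θ 0 = 0 := rfl

theorem coneHom_succ {m n : ℕ} (θ : Fin (m + 1) →o Fin (n + 1)) (i : Fin (m + 1)) :
    coneHom θ i.succ = (θ i).succ := rfl

theorem coneHom_comp_cons {m n q : ℕ} (θ : Fin (m + 1) →o Fin (n + 1)) (I : Fin q → Fin (m + 1)) :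
    coneHom θ ∘ (Fin.cons 0 (Fin.succ ∘ I)) = Fin.cons 0 (Fin.succ ∘ θ ∘ I) := by
  funext i
  refine Fin.cases ?_ (fun i => ?_) i
  · exact coneHom_zero θ
  · exact coneHom_succ θ (I i)

theorem affMap_coneHom_zero {m n : ℕ} (θ : Fin (m + 1) →o Fin (n + 1)) (x : Aff (m + 1)) :
    (affMap (coneHom θ) x).1 0 = x.1 0 := by
  rw [affMap_apply, Fin.sum_univ_succ]
  simp [coneHom_zero, coneHom_succ]

theorem affMap_coneHom_succ {m n : ℕ} (θ : Fin (m + 1) →o Fin (n + 1)) (x : Aff (m + 1))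
    (j : Fin (n + 1)) :
    (affMap (coneHom θ) x).1 j.succ = ∑ i, if θ i = j then x.1 i.succ else 0 := by
  rw [affMap_apply, Fin.sum_univ_succ]
  simp [coneHom_zero, coneHom_succ, (Fin.succ_ne_zero j).symm]

/-- `coneHom θ` preserves the apex coordinate. Where it equals `1` the cutoff makes both sides zero;
elsewhere the radial projection commutes with the affine map. -/
theorem simpCone_comp {n m l : ℕ} (s : Simp (E n) m) (θ : Fin (l + 1) →o Fin (m + 1)) :
    simpCone (s.comp θ) = (simpCone s).comp (coneHom θ) := by
  refine Subtype.ext (funext fun x => ?_)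
  change coneCut (x.1 0) • s.1 (affMap θ (conePt x))
    = coneCut ((affMap (coneHom θ) x).1 0) • s.1 (conePt (affMap (coneHom θ) x))
  rw [affMap_coneHom_zero]
  by_cases hx : x.1 0 = 1
  · rw [hx, coneCut_of_le (by norm_num), zero_smul, zero_smul]
  · congr 1
    refine congrArg s.1 (Aff.ext fun j => ?_)
    rw [conePt_apply (by rwa [affMap_coneHom_zero]), affMap_coneHom_zero, affMap_coneHom_succ,
      affMap_apply, Finset.mul_sum]
    refine Finset.sum_congr rfl fun i _ => ?_
    rw [conePt_apply hx, mul_ite, mul_zero]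

theorem simpCone_comp_succ {n m : ℕ} (s : Simp (E n) m) : (simpCone s).comp Fin.succ = s := by
  refine Subtype.ext (funext fun x => ?_)
  have h0 : (affMap Fin.succ x : Aff (m + 1)).1 0 = 0 := by
    rw [affMap_apply]
    simp [Fin.succ_ne_zero]
  have h1 : conePt (affMap Fin.succ x : Aff (m + 1)) = x := by
    refine Aff.ext fun j => ?_
    rw [conePt_apply (by rw [h0]; norm_num), h0, affMap_apply]
    simp
  change coneCut ((affMap Fin.succ x : Aff (m + 1)).1 0) • s.1 (conePt (affMap Fin.succ x)) = _
  rw [h0, h1, coneCut_zero, one_smul]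

/-- The `0`-simplex at the origin. -/
noncomputable def originSimp (n : ℕ) : Simp (E n) 0 := ⟨fun _ => 0, dSmooth_const⟩

theorem simpCone_comp_zero {n m : ℕ} (s : Simp (E n) m) :
    (simpCone s).comp (fun _ : Fin 1 => 0) = originSimp n := by
  refine Subtype.ext (funext fun x => ?_)
  change coneCut ((affMap (fun _ : Fin 1 => (0 : Fin (m + 2))) x).1 0) • _ = (0 : E n)
  have h : (affMap (fun _ : Fin 1 => (0 : Fin (m + 2))) x).1 0 = 1 := by
    rw [affMap_apply]
    simpa using x.2
  rw [h, coneCut_of_le (by norm_num), zero_smul]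

/-- Evaluation on cones. -/
noncomputable def simpConeOp (n q : ℕ) :
    Fam realCoeff (E n) (q + 1) →ₗ[ℝ] Fam realCoeff (E n) q where
  toFun c := Fam.mk (fun m s I => c.1 (m + 1) (simpCone s) (Fin.cons 0 (Fin.succ ∘ I)))
    ⟨fun m s π I => (c.alt (simpCone s)).cons 0 π (Fin.succ ∘ I), fun m k θ s I => by
      have h := c.nat (coneHom θ) (simpCone s) (Fin.cons 0 (Fin.succ ∘ I))
      rw [coneHom_comp_cons, ← simpCone_comp] at h
      exact h⟩
  map_add' _ _ := rfl
  map_smul' _ _ := rfl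

/-- The monotone map `Fin.succ`. -/
def succHom (m : ℕ) : Fin (m + 1) →o Fin (m + 2) := ⟨Fin.succ, Fin.strictMono_succ.monotone⟩

/-- Naturality along the inclusion of the base face, which is `s` itself because the cutoff is `1`
at `x₀ = 0`. -/
theorem fam_simpCone_succ {n m q : ℕ} (z : Fam realCoeff (E n) q) (s : Simp (E n) m)
    (I : Fin (q + 1) → Fin (m + 1)) : z.1 (m + 1) (simpCone s) (Fin.succ ∘ I) = z.1 m s I := by
  have h := z.nat (succHom m) (simpCone s) I
  have h' : (simpCone s).comp (succHom m) = s := simpCone_comp_succ s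
  rw [h'] at h
  exact h.symm

/-- Alternating cochains of `ℝⁿ` are contractible. -/
noncomputable def altContr : altLoc.Contr where
  k n q := simpConeOp n q
  one n := Fam.mk (fun _ _ _ => (1 : ℝ)) ⟨fun m s π I => by
    have h : π = 1 := Equiv.ext fun i => Subsingleton.elim (α := Fin 1) _ _
    rw [h, Perm.sign_one, Units.val_one, Int.cast_one, one_smul], fun _ _ _ _ _ => rfl⟩
  d_one n := Fam.ext fun m s I => by
    have h : tupD (fun _ : Fin 1 → Fin (m + 1) => (1 : ℝ)) I = 0 := by
      rw [tupD_apply, Fin.sum_univ_two]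
      simp
    exact h
  k_d n q z := Fam.ext fun m s I => by
    let x : (Fin (q + 1 + 1) → Fin (m + 1 + 1)) → ℝ :=
      (z : Fam realCoeff (E n) (q + 1)).1 (m + 1) (simpCone s)
    have h1 : tupD x (Fin.cons 0 (Fin.succ ∘ I)) + tupD (fun J => x (Fin.cons 0 (Fin.succ ∘ J))) I
        = x (Fin.succ ∘ I) := by
      rw [tupD_cons]
      exact sub_add_cancel _ _
    exact h1.trans (fam_simpCone_succ z s I)
  k_d_zero n z := ⟨(z : Fam realCoeff (E n) 0).1 0 (originSimp n) (fun _ => 0), Fam.ext fun m s I => by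
    let x : (Fin 1 → Fin (m + 1 + 1)) → ℝ := (z : Fam realCoeff (E n) 0).1 (m + 1) (simpCone s)
    have h1 : tupD x (Fin.cons 0 (Fin.succ ∘ I)) = x (Fin.succ ∘ I) - x (fun _ => 0) := by
      rw [tupD_cons, tupD_apply, Fin.sum_univ_succ, Fin.sum_univ_zero, add_zero, Fin.val_zero,
        pow_zero, one_smul]
      congr 2
      funext i
      rw [Subsingleton.elim (α := Fin 1) i 0]
      rfl
    -- By naturality along the inclusion of the apex, the value there is the value on the origin
    -- simplex. It does not depend on `s`, hence serves as the constant `r`.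
    have h2 : x (fun _ => 0) = (z : Fam realCoeff (E n) 0).1 0 (originSimp n) (fun _ => 0) := by
      have h := Fam.nat (z : Fam realCoeff (E n) 0)
        (⟨fun _ => 0, monotone_const⟩ : Fin (0 + 1) →o Fin (m + 1 + 1)) (simpCone s) (fun _ => 0)
      have h' := simpCone_comp_zero s
      refine h.symm.trans ?_
      exact congrArg (fun t => (z : Fam realCoeff (E n) 0).1 0 t fun _ => 0) h'
    have h3 : x (Fin.succ ∘ I) = (z : Fam realCoeff (E n) 0).1 m s I := fam_simpCone_succ z s I
    rw [h2, h3] at h1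
    refine h1.trans ?_
    exact congrArg _ (mul_one _).symm⟩

end DeRham

namespace DeRham

open scoped ContDiff

universe u

open Diffeology Equiv

/-! ### Alternating cochains are cofree -/

/-- The monotone map that sends the vertex `i + 1` to `i` and fixes all other vertices. -/
def collapse (q i : ℕ) : Fin (q + 1) →o Fin (q + 1) where
  toFun k := if h : (k : ℕ) = i + 1 then ⟨i, by omega⟩ else k
  monotone' := by
    intro a b hab
    rw [Fin.le_def] at hab ⊢
    dsimp only
    split_ifs <;> simp <;> omega

theorem collapse_val (q i : ℕ) (k : Fin (q + 1)) :
    (collapse q i k : ℕ) = if (k : ℕ) = i + 1 then i else k := by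
  change ((if h : (k : ℕ) = i + 1 then ⟨i, by omega⟩ else k : Fin (q + 1)) : ℕ) = _
  split_ifs <;> rfl

/-- This relation implies that a simplex invariant under `collapse q j` stays so after composition
with `collapse q i`, so a later normalization step does not undo an earlier one. -/
theorem collapse_collapse_collapse {q i j : ℕ} (h : j < i) :
    collapse q j ∘ collapse q i ∘ collapse q j = collapse q j ∘ collapse q i := by
  funext k
  apply Fin.ext
  simp only [Function.comp_apply, collapse_val]
  split_ifs <;> omega

theorem collapse_not_injective {q i : ℕ} (h : i < q) : ¬ Function.Injective (collapse q i) := by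
  intro hinj
  have h1 : collapse q i ⟨i + 1, by omega⟩ = collapse q i ⟨i, by omega⟩ := by
    apply Fin.ext
    simp [collapse_val]
  exact absurd (congrArg Fin.val (hinj h1)) (by simp)

theorem comp_collapse {q : ℕ} {α : Type*} (f : Fin (q + 1) → α) (i : Fin q)
    (h : f i.castSucc = f i.succ) : f ∘ collapse q i = f := by
  funext k
  rw [Function.comp_apply]
  by_cases hk : (k : ℕ) = i + 1
  · have h1 : collapse q i k = i.castSucc := by
      apply Fin.ext
      rw [collapse_val, if_pos hk]
      rfl
    have h2 : k = i.succ := Fin.ext hk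
    rw [h1, h, h2]
  · congr 1
    apply Fin.ext
    rw [collapse_val, if_neg hk]

section Normalize

variable {X : Type u} [DiffeologicalSpace X] {q : ℕ}

/-- The projection of functions of simplices onto those that vanish on simplices which are
invariant under one of the first `i` collapses. -/
noncomputable def simpNormalize (q : ℕ) : ℕ → (Simp X q → ℝ) →ₗ[ℝ] (Simp X q → ℝ)
  | 0 => LinearMap.id
  | i + 1 => simpNormalize q i
      - LinearMap.funLeft ℝ ℝ (fun s : Simp X q => s.comp (collapse q i)) ∘ₗ simpNormalize q i

theorem simpNormalize_succ (u : Simp X q → ℝ) (i : ℕ) (s : Simp X q) :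
    simpNormalize q (i + 1) u s
      = simpNormalize q i u s - simpNormalize q i u (s.comp (collapse q i)) := rfl

/-- The step that treats collapse `j` subtracts two equal values on a `j`-invariant simplex. Later
steps evaluate only at `s` and at a collapse of `s`, both still `j`-invariant. -/
theorem simpNormalize_eq_zero (u : Simp X q → ℝ) {i j : ℕ} (hij : j < i) {s : Simp X q}
    (hs : s.comp (collapse q j) = s) : simpNormalize q i u s = 0 := by
  induction i generalizing s with
  | zero => omega
  | succ i ih =>
    rw [simpNormalize_succ]
    rcases Nat.lt_succ_iff_lt_or_eq.1 hij with h | rfl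
    · rw [ih h hs, ih h, sub_zero]
      -- From `s = s ∘ cⱼ` it follows that `s ∘ cᵢ ∘ cⱼ = s ∘ cⱼ ∘ cᵢ ∘ cⱼ = s ∘ cⱼ ∘ cᵢ = s ∘ cᵢ`.
      have h1 := congrArg s.comp (collapse_collapse_collapse (q := q) h)
      rwa [← Simp.comp_comp, ← Simp.comp_comp, ← Simp.comp_comp, hs] at h1
    · rw [hs, sub_self]

theorem simpNormalize_eq_self {u : Simp X q → ℝ}
    (hu : ∀ (i : ℕ) (s : Simp X q), i < q → u (s.comp (collapse q i)) = 0) {i : ℕ} (hi : i ≤ q) :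
    simpNormalize q i u = u := by
  induction i with
  | zero => rfl
  | succ i ih =>
    funext s
    rw [simpNormalize_succ, ih (by omega), hu i s (by omega), sub_zero]

theorem simpNormalize_map {Y : Type*} [DiffeologicalSpace Y] (g : Y → X) (hg : DSmooth g)
    (u : Simp X q → ℝ) (i : ℕ) (s : Simp Y q) :
    simpNormalize q i u (s.map g hg) = simpNormalize q i (fun t => u (t.map g hg)) s := by
  induction i generalizing s with
  | zero => rfl
  | succ i ih =>
    rw [simpNormalize_succ, simpNormalize_succ, ← ih, ← ih]
    rfl

open Classical in
/-- The value of a normalized function of simplices on a face with increasing vertices, and zero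
on other tuples. -/
noncomputable def faceValue (u : Simp X q → ℝ) {n : ℕ} (s : Simp X n)
    (J : Fin (q + 1) → Fin (n + 1)) : ℝ :=
  if StrictMono J then simpNormalize q q u (s.comp J) else 0

/-- Normalization is what makes the extension by zero natural. If `J` is strictly increasing but `θ
∘ J` is not, then `θ ∘ J` repeats two adjacent values. The face is then invariant under a collapse,
and the normalized function vanishes on it. -/
theorem faceValue_comp (u : Simp X q → ℝ) {m n : ℕ} (s : Simp X n)
    (θ : Fin (m + 1) →o Fin (n + 1)) (J : Fin (q + 1) → Fin (m + 1)) :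
    faceValue u (s.comp θ) J = faceValue u s (θ ∘ J) := by
  unfold faceValue
  rw [Simp.comp_comp]
  by_cases h : StrictMono J
  · rw [if_pos h]
    by_cases h' : StrictMono (θ ∘ J)
    · rw [if_pos h']
    · rw [if_neg h']
      rw [Fin.strictMono_iff_lt_succ] at h'
      push Not at h'
      obtain ⟨i, hi⟩ := h'
      have heq : (θ ∘ J) i.castSucc = (θ ∘ J) i.succ :=
        le_antisymm (θ.monotone (h.monotone (Fin.castSucc_lt_succ).le)) hi
      refine simpNormalize_eq_zero u i.2 ?_
      rw [Simp.comp_comp, comp_collapse _ i heq]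
  · rw [if_neg h, if_neg]
    refine fun h' => h fun a b hab => ?_
    by_contra hle
    exact absurd (h' hab) (not_lt.2 (θ.monotone (not_lt.1 hle)))

/-- The antisymmetrization of functions of simplices. -/
noncomputable def simpAlt (X : Type u) [DiffeologicalSpace X] (q : ℕ) :
    (Simp X q → ℝ) →ₗ[ℝ] Fam realCoeff X q where
  toFun u := Fam.mk
    (fun _ s I => ∑ π : Perm (Fin (q + 1)), ((Perm.sign π : ℤ) : ℝ) * faceValue u s (I ∘ π))
    ⟨fun n s ρ I => by
      change _ = _ * _
      beta_reduce
      -- Substituting `ρ⁻¹ * π` for `π` absorbs `ρ` into the tuple and produces the sign of `ρ`.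
      rw [Finset.mul_sum, ← Equiv.sum_comp (Equiv.mulLeft ρ⁻¹)]
      refine Finset.sum_congr rfl fun π _ => ?_
      rw [Equiv.coe_mulLeft, Function.comp_assoc, ← Perm.coe_mul, mul_inv_cancel_left, Perm.sign_mul,
        Perm.sign_inv, ← mul_assoc]
      push_cast
      rfl, fun m n θ s I => by
      change _ = ∑ π : Perm (Fin (q + 1)), ((Perm.sign π : ℤ) : ℝ) * faceValue u s ((θ ∘ I) ∘ π)
      exact Finset.sum_congr rfl fun π _ => by rw [faceValue_comp, Function.comp_assoc]⟩
  map_add' u v := Fam.ext fun n s I => by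
    change _ = (∑ π : Perm (Fin (q + 1)), ((Perm.sign π : ℤ) : ℝ) * faceValue u s (I ∘ π))
      + ∑ π : Perm (Fin (q + 1)), ((Perm.sign π : ℤ) : ℝ) * faceValue v s (I ∘ π)
    rw [← Finset.sum_add_distrib]
    refine Finset.sum_congr rfl fun π _ => ?_
    rw [← mul_add]
    unfold faceValue
    split_ifs
    · rw [map_add]; rfl
    · rw [add_zero]
  map_smul' r u := Fam.ext fun n s I => by
    change _ = r * ∑ π : Perm (Fin (q + 1)), ((Perm.sign π : ℤ) : ℝ) * faceValue u s (I ∘ π)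
    rw [Finset.mul_sum]
    refine Finset.sum_congr rfl fun π _ => ?_
    rw [mul_left_comm]
    unfold faceValue
    split_ifs
    · rw [map_smul]; rfl
    · rw [mul_zero, mul_zero, mul_zero]

theorem simpAlt_apply (u : Simp X q → ℝ) {n : ℕ} (s : Simp X n) (I : Fin (q + 1) → Fin (n + 1)) :
    (simpAlt X q u).1 n s I
      = ∑ π : Perm (Fin (q + 1)), ((Perm.sign π : ℤ) : ℝ) * faceValue u s (I ∘ π) := rfl

/-- An alternating cochain vanishes on collapsed tuples, because collapses are not injective, so
normalization leaves it unchanged. Naturality along `J` gives the value on the face. -/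
theorem faceValue_fam (c : Fam realCoeff X q) {n : ℕ} (s : Simp X n)
    {J : Fin (q + 1) → Fin (n + 1)} (hJ : StrictMono J) :
    faceValue (fun t => (c.1 q t id : ℝ)) s J = c.1 n s J := by
  rw [faceValue, if_pos hJ, simpNormalize_eq_self _ le_rfl]
  · exact c.nat ⟨J, hJ.monotone⟩ s id
  · intro i s hi
    exact (c.nat (collapse q i) s id).trans ((c.alt s).eq_zero (collapse_not_injective hi))

/-- Exactly one permutation sorts an injective tuple, so a single term survives and alternation
carries it back to `I`. A tuple with a repetition cannot be sorted strictly, and both sides vanish.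
-/
theorem simpAlt_fam (c : Fam realCoeff X q) :
    simpAlt X q (fun t => (c.1 q t id : ℝ)) = c := by
  refine Fam.ext fun n s I => ?_
  rw [simpAlt_apply]
  by_cases hI : Function.Injective I
  · have hs : StrictMono (I ∘ Tuple.sort I) := (Tuple.monotone_sort I).strictMono_of_injective
      (hI.comp (Tuple.sort I).injective)
    rw [Finset.sum_eq_single (Tuple.sort I)]
    · rw [faceValue_fam c s hs]
      have h := c.alt s (Tuple.sort I) I
      refine (congrArg _ h).trans ?_
      change ((Perm.sign (Tuple.sort I) : ℤ) : ℝ) * (((Perm.sign (Tuple.sort I) : ℤ) : ℝ) * _) = _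
      rw [← mul_assoc, ← Int.cast_mul, ← Units.val_mul, Int.units_mul_self]
      simp
    · intro π _ hπ
      rw [faceValue, if_neg, mul_zero]
      intro h
      -- Two monotone rearrangements of a tuple coincide, and injectivity of `I` then identifies the
      -- permutations.
      have h1 := Tuple.unique_monotone h.monotone hs.monotone
      exact hπ (Equiv.ext fun i => hI (congrFun h1 i))
    · simp
  · rw [(c.alt s).eq_zero hI]
    refine Finset.sum_eq_zero fun π _ => ?_
    rw [faceValue, if_neg, mul_zero]
    intro h
    refine hI fun a b hab => ?_
    have h1 : (I ∘ π) (π⁻¹ a) = (I ∘ π) (π⁻¹ b) := by simpa using hab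
    simpa using h.injective h1

theorem pull_simpAlt {Y : Type*} [DiffeologicalSpace Y] (g : Y → X) (hg : DSmooth g)
    (u : Simp X q → ℝ) :
    Fam.pull g hg (simpAlt X q u) = simpAlt Y q fun t => u (t.map g hg) := by
  refine Fam.ext fun n s I => ?_
  change (simpAlt X q u).1 n (s.map g hg) I = _
  rw [simpAlt_apply, simpAlt_apply]
  refine Finset.sum_congr rfl fun π _ => ?_
  congr 1
  unfold faceValue
  rw [← simpNormalize_map g hg]
  rfl

end Normalize

/-- Alternating cochains are cofree. -/
noncomputable def altCofree : altLoc.Cofree where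
  dim q := q
  ev n q := LinearMap.pi fun t =>
    { toFun := fun z => ((z : Fam realCoeff (E n) q).1 q t.toSimp id : ℝ)
      map_add' := fun _ _ => rfl
      map_smul' := fun _ _ => rfl }
  rho n q := simpAlt (E n) q ∘ₗ LinearMap.funLeft ℝ ℝ Simp.toPlot
  rho_ev n q z := by
    refine Eq.trans ?_ (simpAlt_fam z)
    refine congrArg (simpAlt (E n) q) (funext fun t => ?_)
    exact congrArg (fun t => ((z : Fam realCoeff (E n) q).1 q t id : ℝ)) t.toSimp_toPlot
  ev_pull _ _ _ _ _ := rfl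
  pull_rho f hf q u := pull_simpAlt f hf.dSmooth fun t => u t.toPlot

end DeRham

namespace DeRham

open scoped ContDiff

universe u

open Diffeology MeasureTheory

/-! ### Differential forms as a contractible presheaf of complexes -/

/-- Differential forms on the spaces `ℝⁿ`. -/
noncomputable def omegaLoc : LocCx where
  C n p := Form (E n) p
  d _ p := Form.d p
  d_d _ p z := Form.d_d p z
  pull f hf p := Form.pullback f hf.dSmooth p
  pull_comp _ _ _ _ _ _ := rfl
  pull_d _ _ _ _ := rfl

/-- Differential forms on `X`, with their restrictions to plots. -/
noncomputable def omegaGlob (X : Type u) [DiffeologicalSpace X] : omegaLoc.Glob X where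
  toCx := (Omega X).toCx
  res σ p := Form.pullback σ.1 σ.2.dSmooth p
  res_d _ _ _ := rfl
  pull_res _ _ _ _ _ := rfl

/-- The contraction `(t, x) ↦ t x` of `ℝⁿ` to the origin. -/
noncomputable def euclideanContr (n : ℕ) : DContraction (E n) 0 where
  toFun t x := t • x
  isPlot {k σ} hσ := by
    have h0 : ContDiff ℝ ∞ fun z : E (k + 1) => z 0 := by fun_prop
    exact (h0.smul (hσ.contDiff.comp (cylProj k).contDiff)).isPlot
  at_zero x := zero_smul ℝ x
  at_one x := one_smul ℝ x

/-- The Poincaré lemma: forms on `ℝⁿ` are contractible. -/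
noncomputable def omegaContr : omegaLoc.Contr where
  k n p := (euclideanContr n).op p
  one _ := Form.one
  d_one n := CochainAlg.one_mem_Z (A := Omega (E n))
  k_d n _ z := (euclideanContr n).op_d_add_d_op z
  k_d_zero n z := ⟨_, (euclideanContr n).op_d_zero z⟩

/-! ### Cohomology of cochain algebras -/

theorem CochainAlg.toCx_B (A : CochainAlg.{u}) : ∀ p, A.toCx.B p = A.B p
  | 0 => rfl
  | _ + 1 => rfl

theorem CochainAlg.cls_eq_cls {A : CochainAlg.{u}} {p : ℕ} {a b : A.Z p} :
    CochainAlg.cls a = CochainAlg.cls b ↔ (a : A.C p) - b ∈ A.B p :=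
  Submodule.Quotient.eq (A.BZ p)

theorem CochainAlg.cls_eq_zero {A : CochainAlg.{u}} {p : ℕ} {a : A.Z p} :
    CochainAlg.cls a = 0 ↔ (a : A.C p) ∈ A.B p :=
  Submodule.Quotient.mk_eq_zero (A.BZ p)

theorem CochainMap.H_cls {A B : CochainAlg.{u}} (φ : CochainMap A B) {p : ℕ} (a : A.Z p) :
    φ.H p (CochainAlg.cls a) = CochainAlg.cls ⟨φ.f p a.1, φ.map_mem_Z a.1 a.2⟩ := rfl

/-- A quasi-isomorphism induces bijections on cohomology. -/
theorem CochainMap.H_bijective {A B : CochainAlg.{u}} {φ : CochainMap A B}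
    (h : Cx.QuasiIso A.toCx B.toCx φ.f) (p : ℕ) : Function.Bijective (φ.H p) := by
  obtain ⟨h1, h2⟩ := h p
  rw [A.toCx_B, B.toCx_B] at h1
  rw [B.toCx_B] at h2
  refine ⟨(injective_iff_map_eq_zero (φ.H p)).2 fun x hx => ?_, fun y => ?_⟩
  · obtain ⟨a, rfl⟩ := CochainAlg.cls_surjective x
    exact CochainAlg.cls_eq_zero.2 (h1 a.1 (CochainAlg.mem_Z.1 a.2) (CochainAlg.cls_eq_zero.1 hx))
  · obtain ⟨b, rfl⟩ := CochainAlg.cls_surjective y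
    obtain ⟨a, ha, hab⟩ := h2 b.1 (CochainAlg.mem_Z.1 b.2)
    refine ⟨CochainAlg.cls ⟨a, CochainAlg.mem_Z.2 ha⟩, ?_⟩
    rw [CochainMap.H_cls]
    exact (CochainAlg.cls_eq_cls.2 hab).symm

theorem Cx.map_mem_B {A B : Cx.{u}} {f : ∀ p, A.C p →ₗ[ℝ] B.C p}
    (hf : ∀ p a, f (p + 1) (A.d p a) = B.d p (f p a)) :
    ∀ {p : ℕ} {a : A.C p}, a ∈ A.B p → f p a ∈ B.B p
  | 0, a, ha => by
    have : a = 0 := ha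
    rw [this, map_zero]
    exact zero_mem _
  | p + 1, _, ⟨c, hc⟩ => ⟨f p c, by rw [← hc, hf]⟩

/-- Composites of quasi-isomorphisms are quasi-isomorphisms. -/
theorem Cx.QuasiIso.comp {A B C : Cx.{u}} {f : ∀ p, A.C p →ₗ[ℝ] B.C p}
    {g : ∀ p, B.C p →ₗ[ℝ] C.C p} (hg : Cx.QuasiIso B C g) (hf : Cx.QuasiIso A B f)
    (cf : ∀ p a, f (p + 1) (A.d p a) = B.d p (f p a))
    (cg : ∀ p b, g (p + 1) (B.d p b) = C.d p (g p b)) :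
    Cx.QuasiIso A C fun p => g p ∘ₗ f p := by
  refine fun p => ⟨fun a ha h => (hf p).1 a ha ((hg p).1 _ (by rw [← cf, ha, map_zero]) h),
    fun c hc => ?_⟩
  obtain ⟨b, hb, hbc⟩ := (hg p).2 c hc
  obtain ⟨a, ha, hab⟩ := (hf p).2 b hb
  refine ⟨a, ha, ?_⟩
  have h := add_mem hbc (Cx.map_mem_B cg hab)
  rw [map_sub, sub_add_sub_cancel] at h
  exact h

/-! ### Integration as a natural transformation -/

/-- The unit cube of `ℝ⁰` is a point of volume `1`. -/
theorem iz_one (X : Type u) [DiffeologicalSpace X] : (iz X).f 0 (Omega X).one = (Cube X).one := by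
  refine CubeCochain.ext fun σ => ?_
  change ∫ x in Set.Icc (0 : Fin 0 → ℝ) 1, (1 : ℝ) = 1
  simp [Measure.real, Real.volume_Icc_pi]

/-- For a closed form `b`, the defect `a ↦ ∫ (a ∧ b) - (∫ a) ∪ (∫ b)` of multiplicativity commutes
with the differentials. -/
theorem iz_mul_sub_d {Y : Type u} [DiffeologicalSpace Y] {p q n : ℕ} (h : p + q = n)
    (h' : p + 1 + q = n + 1) (a : (Omega Y).C p) {b : (Omega Y).C q} (hb : (Omega Y).d q b = 0) :
    (iz Y).f (n + 1) ((Omega Y).mul h' ((Omega Y).d p a) b)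
        - (Cube Y).mul h' ((iz Y).f (p + 1) ((Omega Y).d p a)) ((iz Y).f q b)
      = (Cube Y).d n ((iz Y).f n ((Omega Y).mul h a b)
        - (Cube Y).mul h ((iz Y).f p a) ((iz Y).f q b)) := by
  have hb' : (Cube Y).d q ((iz Y).f q b) = 0 := by rw [← (iz Y).comm, hb, map_zero]
  rw [map_sub, ← (iz Y).comm, (Omega Y).leibniz h, hb, (Cube Y).leibniz h, hb', (iz Y).comm p]
  simp only [map_zero, smul_zero, add_zero]

/-- Products of cohomology classes are preserved by integration. -/
theorem iz_mul_sub_mem_B (X : Type u) [DiffeologicalSpace X] {p q n : ℕ} (h : p + q = n)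
    {a : Form X p} {b : Form X q} (ha : Form.d p a = 0) (hb : Form.d q b = 0) :
    (iz X).f n (Form.mul h a b) - (Cube X).mul h ((iz X).f p a) ((iz X).f q b) ∈ (Cube X).B n := by
  -- In this form the degree is definitionally degree `p` of the complex shifted by `q`.
  obtain rfl : n = q + p := by omega
  rw [← CochainAlg.toCx_B]
  let bσ : ∀ {n : ℕ}, Plot X n → Form (E n) q := fun σ => Form.pullback σ.1 σ.2.dSmooth q b
  have hbσ : ∀ {n : ℕ} (σ : Plot X n), Form.d q (bσ σ) = 0 := fun {n} σ => by
    change Form.pullback σ.1 σ.2.dSmooth (q + 1) (Form.d q b) = 0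
    rw [hb, map_zero]
  -- The defect depends on the plot through `σ^* b`. Natural families are indexed by plots of `X`,
  -- and not only by dimensions, to allow such a twist.
  let φ : ∀ p, LocCx.NatMap X omegaLoc (cubeLoc.shift q) p p := fun p =>
    { f := fun {n} σ => (iz (E n)).f (q + p) ∘ₗ ((Omega (E n)).mul (Nat.add_comm p q)).flip (bσ σ)
        - ((Cube (E n)).mul (Nat.add_comm p q)).flip ((iz (E n)).f q (bσ σ)) ∘ₗ (iz (E n)).f p
      nat := fun _ _ _ _ => rfl }
  refine LocCx.Glob.mem_B_of_mem_shift_B (A := cubeGlob X) ?_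
  refine LocCx.Glob.mem_B_of_natural (A := omegaGlob X) ((cubeGlob_isSheaf X).shift q) omegaContr
    (cubeCofree.shift q) φ (fun p n σ z => ?_) (fun {n} σ => ?_) ha (fun _ => rfl)
  · exact iz_mul_sub_d (Nat.add_comm p q) (by omega) z (hbσ σ)
  · change (iz (E n)).f q ((Omega (E n)).mul (Nat.add_comm 0 q) (Omega (E n)).one (bσ σ))
      - (Cube (E n)).mul (Nat.add_comm 0 q) ((iz (E n)).f 0 (Omega (E n)).one)
        ((iz (E n)).f q (bσ σ)) = 0
    rw [iz_one]
    refine sub_eq_zero.2 ?_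
    exact (congrArg ((iz (E n)).f q) ((Omega (E n)).one_mul (Nat.zero_add q) (bσ σ))).trans
      ((Cube (E n)).one_mul (Nat.zero_add q) _).symm

theorem isAlgHom_iz (X : Type u) [DiffeologicalSpace X] : IsAlgHom (iz X).H := by
  refine ⟨congrArg CochainAlg.cls (Subtype.ext (iz_one X)), fun {p q n} h x y => ?_⟩
  obtain ⟨a, rfl⟩ := CochainAlg.cls_surjective x
  obtain ⟨b, rfl⟩ := CochainAlg.cls_surjective y
  exact CochainAlg.cls_eq_cls.2 (iz_mul_sub_mem_B X h (CochainAlg.mem_Z.1 a.2)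
    (CochainAlg.mem_Z.1 b.2))

/-- Pullback of forms preserves the unit and the exterior product already at the level of cochains.
-/
theorem isAlgHom_alpha (X : Type u) [DiffeologicalSpace X] : IsAlgHom (alpha X).H := by
  refine ⟨rfl, fun {p q n} h x y => ?_⟩
  obtain ⟨a, rfl⟩ := CochainAlg.cls_surjective x
  obtain ⟨b, rfl⟩ := CochainAlg.cls_surjective y
  rfl

/-! ### Factorization of integration through `α` -/

/-- On cohomology, integration factors through `α` by an isomorphism. -/
theorem exists_iz_factorization (X : Type u) [DiffeologicalSpace X] :
    ∃ Ψ : CochainMap (ADR (smoothSing X)) (Cube X), (∀ p, Function.Bijective (Ψ.H p)) ∧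
      ∀ p x, (iz X).H p x = Ψ.H p ((alpha X).H p x) := by
  obtain ⟨g, F, hg, g1, hF, hq⟩ := LocCx.Glob.exists_quasiIso (altGlob_isSheaf X)
    (cubeGlob_isSheaf X) altContr altCofree cubeContr cubeCofree rfl rfl
    (fun _ _ => rfl) (fun _ _ => rfl)
  -- Compatibility with the differentials is checked after restriction to plots, where `F` is given
  -- by the natural cochain map `g`.
  have hFd : ∀ p z, F (p + 1) ((altCx X).d p z) = (Cube X).d p (F p z) := fun p z =>
    (cubeGlob_isSheaf X).sep fun σ => by
      refine (hF (p + 1) _ σ).trans ?_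
      refine Eq.trans ?_ ((cubeGlob X).res_d σ p (F p z)).symm
      refine Eq.trans ?_ (congrArg (cubeLoc.d _ p) (hF p z σ)).symm
      refine Eq.trans ?_ (hg p σ _)
      exact congrArg ((g (p + 1)).f σ) ((altGlob X).res_d σ p z)
  let Ψ : CochainMap (ADR (smoothSing X)) (Cube X) :=
    { f := fun p => F p ∘ₗ theta X p
      comm := fun p a => (congrArg (F (p + 1)) (theta_d X p a)).trans (hFd p _) }
  refine ⟨Ψ, CochainMap.H_bijective (hq.comp (quasiIso_theta X) (theta_d X) hFd), fun p x => ?_⟩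
  obtain ⟨a, rfl⟩ := CochainAlg.cls_surjective x
  refine CochainAlg.cls_eq_cls.2 ?_
  change (iz X).f p a.1 - Ψ.f p ((alpha X).f p a.1) ∈ (Cube X).B p
  rw [← CochainAlg.toCx_B]
  let ψ : ∀ p, LocCx.NatMap X omegaLoc cubeLoc p p := fun p =>
    { f := fun {n} σ => (g p).f σ ∘ₗ theta (E n) p ∘ₗ (alpha (E n)).f p
      nat := fun {l n} σ f hf z => by
        refine ((g p).nat σ f hf _).trans ?_
        exact congrArg ((g p).f (σ.comp f hf)) (pull_theta_alpha f hf.dSmooth p z) }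
  let φ : ∀ p, LocCx.NatMap X omegaLoc cubeLoc p p := fun p =>
    { f := fun {n} _ => (iz (E n)).f p
      nat := fun _ _ _ _ => rfl }
  -- The source is contractible by the Poincaré lemma and the target is cofree, so the two natural
  -- cochain maps need only be compared on the constant `1`.
  refine LocCx.Glob.mem_B_of_natural (A := omegaGlob X) (B := cubeGlob X) (cubeGlob_isSheaf X)
    omegaContr cubeCofree (fun p => (φ p).sub (ψ p)) (fun p n σ z => ?_) (fun {n} σ => ?_)
    (CochainAlg.mem_Z.1 a.2) (fun {n} σ => ?_)
  · have h1 : (iz (E n)).f (p + 1) (Form.d p z) = (Cube (E n)).d p ((iz (E n)).f p z) :=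
      (iz (E n)).comm p z
    have h2 : (g (p + 1)).f σ (theta (E n) (p + 1) ((alpha (E n)).f (p + 1) (Form.d p z)))
        = (Cube (E n)).d p ((g p).f σ (theta (E n) p ((alpha (E n)).f p z))) :=
      (congrArg ((g (p + 1)).f σ) (theta_d (E n) p ((alpha (E n)).f p z))).trans (hg p σ _)
    exact (congrArg₂ (fun x y : CubeCochain (E n) (p + 1) => x - y) h1 h2).trans
      (map_sub (cubeLoc.d n p) _ _).symm
  · have h1 : theta (E n) 0 ((alpha (E n)).f 0 (Omega (E n)).one) = altContr.one n :=
      Fam.ext fun m s I => theta_one (E n) s I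
    exact sub_eq_zero.2 ((iz_one (E n)).trans ((congrArg ((g 0).f σ) h1).trans (g1 σ)).symm)
  -- Naturality of `theta ∘ α` identifies the restriction of `Ψ (α a)` along `σ` with the local
  -- composite applied to `σ^* a`.
  · refine (map_sub ((cubeGlob X).res σ p) _ _).trans ?_
    refine congrArg₂ (fun x y : CubeCochain (E n) p => x - y) rfl ((hF p _ σ).trans ?_)
    exact congrArg ((g p).f σ) (pull_theta_alpha σ.1 σ.2.dSmooth p a.1)

end DeRham

/-! ### The main theorem -/

theorem corollary2p3 (X : Type*) [DiffeologicalSpace X] :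
    DeRham.IsAlgHom (DeRham.iz X).H ∧
      (DeRham.IsAlgIso (DeRham.iz X).H ↔ DeRham.IsAlgIso (DeRham.alpha X).H) := by
  refine ⟨DeRham.isAlgHom_iz X, ?_⟩
  obtain ⟨Ψ, hΨ, h⟩ := DeRham.exists_iz_factorization X
  have key : ∀ p, Function.Bijective ((DeRham.iz X).H p)
      ↔ Function.Bijective ((DeRham.alpha X).H p) := fun p => by
    -- A bijection on the left of a composite can be cancelled.
    rw [show ⇑((DeRham.iz X).H p) = Ψ.H p ∘ (DeRham.alpha X).H p from funext (h p)]
    exact Function.Bijective.of_comp_iff' (hΨ p) _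
  exact ⟨fun hi => ⟨DeRham.isAlgHom_alpha X, fun p => (key p).1 (hi.2 p)⟩,
    fun ha => ⟨DeRham.isAlgHom_iz X, fun p => (key p).2 (ha.2 p)⟩⟩
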